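/- Let $\beta$ be a formal parameter and let $\mathcal A$ be the $\mathbb Q(\beta)$-algebra generated by $\phi_n$ ($n\in\mathbb Z$) with $\phi_m\phi_n+\phi_n\phi_m=2(-1)^m\delta_{m+n,0}$. Let $\mathcal F=\mathcal A|0\rangle$ and $\mathcal F^*=\langle 0|\mathcal A$ be the left, respectively right, $\mathcal A$-modules generated by vectors with the defining relations $\phi_{-n}|0\rangle=0$, $\langle0|\phi_n=0$ ($n>0$), paired by the vacuum expectation value ($\langle0|0\rangle=1$, $\langle 0|\phi_0|0\rangle=0$). Let $\mathcal F_{even},\mathcal F^*_{even}$ be spanned by the vectors obtained from the vacuum by even products of the $\phi_n$, let $\widehat{\mathcal F}_{even}=\mathrm{Hom}_{\mathbb Q(\beta)}(\mathcal F^*_{even},\mathbb Q(\beta))$, and let $*$ be the anti-involution with $\phi_n^*=(-1)^n\phi_{-n}$, $|0\rangle^*=\langle 0|$. For odd $m$ put $b_m=\frac14\sum_{i\in\mathbb Z}(-1)^i\phi_{-i-m}\phi_i$, and for every integer $m\ne0$ let $b^{(\beta)}_m$ be obtained from $\frac12\big((X-\frac\beta2)^m-(-X-\frac\beta2)^m\big)$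 by $X^k\mapsto b_k$ (expanded in powers of $X^{-1}$ if $m<0$), and $b_m^{[\beta]}=(b_{-m}^{(\beta)})^*$. With $p_n(x)=\sum_i x_i^n$, $x=(x_1,x_2,\dots)$, put $$\mathcal H^{(\beta)}=2\sum_{n\ge1}\frac{p_n(x)}n b_n^{(\beta)},\qquad \mathcal H^{[\beta]}=2\sum_{n\ge1}\frac{p_n(x)}n b_n^{[\beta]},\qquad \Theta=2\sum_{n=1,3,5,\dots}\Big(\frac\beta2\Big)^n\frac{b_{-n}}n .$$ Let $\sum_{n\ge0}\phi_n^{(\beta)}z^n=\sum_{n\ge0}\phi_n(z+\frac\beta2)^n$ and $\Phi_n^{(\beta)}=\sum_{k\ge0}\frac12(-\frac\beta2)^k\phi^{(\beta)}_{n+k}$ for $n\geq 0$ (so $\Phi^{(\beta)}(z)=\frac1{2+\beta z^{-1}}\phi^{(\beta)}(z)$); these operators act on $\mathcal F^*$ from the right. Let $p_n^{(\beta)}=\sum_{i\ge0}\binom{-n}i(\frac\beta2)^ip_{n+i}$, $p_n^{[\beta]}=\sum_{i=1}^n\binom ni(\frac\beta2)^{n-i}p_i$, $\widehat{G\Gamma}=\mathbb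 Q(\beta)[[p_1^{(\beta)},p_3^{(\beta)},\dots]]$ and $g\Gamma=\mathbb Q(\beta)[p_1^{[\beta]},p_3^{[\beta]},\dots]$, paired by $\langle p^{(\beta)}_\lambda,p^{[\beta]}_\mu\rangle=2^{-\ell(\lambda)}z_\lambda\delta_{\lambda,\mu}$ for partitions $\lambda,\mu$ into odd parts, where $z_\lambda=\prod_i i^{m_i}m_i!$ and $m_i$ is the multiplicity of the part $i$ in $\lambda$. For $\varphi\in\widehat{\mathcal F}_{even}$ let $\Omega(\varphi)\in\widehat{G\Gamma}$ be the unique element with $\big\langle\Omega(\varphi),\langle0|e^{\mathcal H^{[\beta]}}|v\rangle\big\rangle=\varphi(|v\rangle^*)$ for all $|v\rangle\in\mathcal F_{even}$ (where $\langle0|e^{\mathcal H^{[\beta]}}|v\rangle\in g\Gamma$). For a strict partition $\lambda=(\lambda_1>\dots>\lambda_r>0)$ let $GP_\lambda(x)$ be the $K$-theoretic $P$-function: the unique formal power series in $x_1,x_2,\dots$ which, for every $n\ge r$, becomes after setting $x_{n+1}=x_{n+2}=\dots=0$ the polynomial $$GP_\lambda(x_1,\dots,x_n)=\frac1{(n-r)!}\sum_{w\in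 S_n}w\Big(\prod_{i=1}^r x_i^{\lambda_i}\prod_{i=1}^r\prod_{j=i+1}^n\frac{x_i\oplus x_j}{x_i\ominus x_j}\Big),\qquad x\oplus y=x+y+\beta xy,\quad x\ominus y=\frac{x-y}{1+\beta y}.$$ Define $|\lambda\rangle_P\in\widehat{\mathcal F}_{even}$ by $$|\lambda\rangle_P=\begin{cases}\Phi^{(\beta)}_{\lambda_1}e^\Theta\cdots\Phi^{(\beta)}_{\lambda_r}e^\Theta|0\rangle&(r\text{ even}),\\ \Phi^{(\beta)}_{\lambda_1}e^\Theta\cdots\Phi^{(\beta)}_{\lambda_r}e^\Theta\,\phi_0^{(\beta)}e^\Theta|0\rangle&(r\text{ odd}).\end{cases}$$ Then for every strict partition $\lambda$ the series $GP_\lambda(x)$ and the element $\Omega(|\lambda\rangle_P)$ are well defined (they exist and are unique), and $$GP_\lambda(x)=\langle0|e^{\mathcal H^{(\beta)}}|\lambda\rangle_P=\Omega(|\lambda\rangle_P).$$ In particular $GP_\lambda\in\widehat{G\Gamma}$. -/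

import Mathlib

noncomputable section

namespace KFermion

/-! ### Base field -/

/-- The field `ℚ(β)`. -/
abbrev K : Type := RatFunc ℚ

/-- The formal parameter `β`. -/
def β : K := RatFunc.X

/-! ### Neutral fermions -/

/-- The bilinear form on the space with basis `e_n`, `n ∈ ℤ`, given by
`(e_m, e_n) ↦ c m` if `m + n = 0` and `0` otherwise. -/
def pairForm (c : ℤ → K) : LinearMap.BilinForm K (ℤ →₀ K) :=
  Finsupp.linearCombination K fun m => c m • Finsupp.lapply (-m)

theorem pairForm_single (c : ℤ → K) (m n : ℤ) :
    pairForm c (Finsupp.single m 1) (Finsupp.single n 1) = if m + n = 0 then c m else 0 := by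
  have : n = -m ↔ m + n = 0 := by constructor <;> intro h <;> omega
  simp [pairForm, Finsupp.single_apply, this]

/-- `Q(∑ v_n e_n) = ∑ (-1)^n v_n v_{-n}`; its polar form is
`(e_m, e_n) ↦ 2 (-1)^m δ_{m+n,0}`. -/
def Q : QuadraticForm K (ℤ →₀ K) :=
  LinearMap.BilinMap.toQuadraticMap (pairForm fun m => (-1) ^ m)

/-- The algebra of neutral fermions. -/
abbrev A : Type := CliffordAlgebra Q

/-- The neutral fermion `φ_n`. -/
def φ (n : ℤ) : A := CliffordAlgebra.ι Q (Finsupp.single n 1)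

/-- The defining relation `[φ_m, φ_n]_+ = 2 (-1)^m δ_{m+n,0}`. -/
theorem φ_anticomm (m n : ℤ) :
    φ m * φ n + φ n * φ m = algebraMap K A (if m + n = 0 then 2 * (-1) ^ m else 0) := by
  have hp : QuadraticMap.polar Q (Finsupp.single m 1) (Finsupp.single n 1) = _ :=
    LinearMap.BilinMap.polar_toQuadraticMap _ _
  rw [φ, φ, CliffordAlgebra.ι_mul_ι_add_swap, hp, pairForm_single, pairForm_single]
  congr 1
  by_cases h : m + n = 0
  · have h' : n = -m := by omega
    subst h'
    simp only [add_neg_cancel, neg_add_cancel, if_true]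
    rw [zpow_neg, ← inv_zpow, inv_neg_one]; ring
  · rw [if_neg h, if_neg (by omega), if_neg h, add_zero]

/-! ### Vacuum expectation value -/

/-- The values `⟨φ_m φ_{-m}⟩`. -/
def vacCoeff (m : ℤ) : K := if m < 0 then 2 * (-1) ^ m else if m = 0 then 1 else 0

theorem ext_basis {B B' : LinearMap.BilinForm K (ℤ →₀ K)}
    (h : ∀ m n : ℤ, B (Finsupp.single m 1) (Finsupp.single n 1) =
      B' (Finsupp.single m 1) (Finsupp.single n 1)) : B = B' := by
  apply Finsupp.lhom_ext'
  intro m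
  apply LinearMap.ext_ring
  apply Finsupp.lhom_ext'
  intro n
  apply LinearMap.ext_ring
  simpa using h m n

theorem vacForm_toQuadratic :
    LinearMap.BilinMap.toQuadraticMap (-pairForm vacCoeff) =
      (0 : QuadraticForm K (ℤ →₀ K)) - Q := by
  have key : (pairForm vacCoeff - pairForm fun m => (-1) ^ m) =
      -(pairForm vacCoeff - pairForm fun m => (-1) ^ m).flip := by
    apply ext_basis
    intro m n
    simp only [LinearMap.sub_apply, LinearMap.neg_apply, LinearMap.BilinForm.flip_apply, pairForm_single]
    by_cases h : m + n = 0
    · have h' : n = -m := by omega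
      subst h'
      have e : ((-1 : K)) ^ (-m) = (-1) ^ m := by rw [zpow_neg, ← inv_zpow, inv_neg_one]
      simp only [add_neg_cancel, neg_add_cancel, if_true, e, vacCoeff]
      rcases lt_trichotomy m 0 with hm | hm | hm
      · rw [if_pos hm, if_neg (by omega), if_neg (by omega)]; ring
      · subst hm; simp
      · rw [if_neg (by omega), if_neg (by omega), if_pos (by omega)]; ring
    · rw [if_neg h, if_neg h, if_neg (by omega), if_neg (by omega)]; simp
  ext v
  have h := LinearMap.congr_fun (LinearMap.congr_fun key v) v
  simp only [LinearMap.sub_apply, LinearMap.neg_apply, LinearMap.BilinForm.flip_apply] at h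
  have h0 := self_eq_neg.mp h
  simp only [LinearMap.BilinMap.toQuadraticMap_apply, LinearMap.neg_apply,
    sub_apply, zero_apply, Q]
  linear_combination -h0

/-- The vacuum expectation value `X ↦ ⟨X⟩ = ⟨0|X|0⟩`: the scalar part of the normal ordering
(Wick expansion) of `X`. It is characterised by `vev_one`, `vev_φ_zero`, `vev_φ_mul`
and `vev_mul_φ`. -/
def vev : A →ₗ[K] K :=
  (ExteriorAlgebra.algebraMapInv (R := K) (M := ℤ →₀ K)).toLinearMap ∘ₗ
    CliffordAlgebra.changeForm vacForm_toQuadratic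

theorem vev_one : vev 1 = 1 := by simp [vev]

theorem vev_φ_zero : vev (φ 0) = 0 := by
  simp only [vev, φ, LinearMap.comp_apply, CliffordAlgebra.changeForm_ι, AlgHom.toLinearMap_apply]
  simp [ExteriorAlgebra.algebraMapInv, ExteriorAlgebra.lift]

theorem vev_φ_mul (n : ℤ) (hn : 0 < n) (X : A) : vev (φ n * X) = 0 := by
  have h : (-pairForm vacCoeff) (Finsupp.single n 1) = 0 := by
    rw [LinearMap.neg_apply, neg_eq_zero]
    simp [pairForm, vacCoeff, not_lt.mpr hn.le, hn.ne']
  simp only [vev, φ, LinearMap.comp_apply, CliffordAlgebra.changeForm_ι_mul, h]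
  simp [ExteriorAlgebra.algebraMapInv, ExteriorAlgebra.lift]

theorem contract_mul_ι (d : Module.Dual K (ℤ →₀ K)) (m : ℤ →₀ K) (hm : d m = 0)
    (a : ExteriorAlgebra K (ℤ →₀ K)) :
    CliffordAlgebra.contractLeft d (a * CliffordAlgebra.ι 0 m) =
      CliffordAlgebra.contractLeft d a * CliffordAlgebra.ι 0 m := by
  induction a using CliffordAlgebra.left_induction with
  | algebraMap r =>
    rw [CliffordAlgebra.contractLeft_algebraMap_mul, CliffordAlgebra.contractLeft_ι, hm]; simp
  | add x y hx hy => rw [add_mul, map_add, hx, hy, map_add, add_mul]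
  | ι_mul x v hx =>
    rw [mul_assoc, CliffordAlgebra.contractLeft_ι_mul, hx, CliffordAlgebra.contractLeft_ι_mul,
      sub_mul, smul_mul_assoc, mul_assoc]

theorem vev_mul_φ (n : ℤ) (hn : 0 < n) (X : A) : vev (X * φ (-n)) = 0 := by
  have h : ∀ v, (-pairForm vacCoeff) v (Finsupp.single (-n) 1) = 0 := by
    intro v
    induction v using Finsupp.induction_linear with
    | zero => simp
    | add f g hf hg => rw [map_add, LinearMap.add_apply, hf, hg, add_zero]
    | single m a =>
      have : Finsupp.single m a = a • Finsupp.single m (1 : K) := by simp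
      rw [this, map_smul, LinearMap.smul_apply, LinearMap.neg_apply, LinearMap.neg_apply,
        pairForm_single]
      by_cases hmn : m + -n = 0
      · have : m = n := by omega
        subst this
        simp [vacCoeff, not_lt.mpr hn.le, hn.ne']
      · simp [hmn]
  have key : CliffordAlgebra.changeForm vacForm_toQuadratic (X * φ (-n)) =
      CliffordAlgebra.changeForm vacForm_toQuadratic X *
        CliffordAlgebra.ι 0 (Finsupp.single (-n) 1) := by
    induction X using CliffordAlgebra.left_induction with
    | algebraMap r =>
      rw [← Algebra.smul_def, map_smul, φ, CliffordAlgebra.changeForm_ι,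
        CliffordAlgebra.changeForm_algebraMap, Algebra.smul_def]
    | add x y hx hy => rw [add_mul, map_add, hx, hy, map_add, add_mul]
    | ι_mul x v hx =>
      rw [mul_assoc, CliffordAlgebra.changeForm_ι_mul, hx, CliffordAlgebra.changeForm_ι_mul,
        contract_mul_ι _ _ (h v), sub_mul, mul_assoc]
  rw [vev, LinearMap.comp_apply, key]
  simp [ExteriorAlgebra.algebraMapInv, ExteriorAlgebra.lift]

/-! ### The anti-involution `*` -/

/-- The linear map `e_n ↦ (-1)^n e_{-n}`. -/
def starLin : (ℤ →₀ K) →ₗ[K] (ℤ →₀ K) :=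
  Finsupp.linearCombination K fun n => ((-1 : K) ^ n) • Finsupp.single (-n) 1

theorem neg_one_zpow_neg (m : ℤ) : ((-1 : K)) ^ (-m) = (-1) ^ m := by
  rw [zpow_neg, ← inv_zpow, inv_neg_one]

theorem neg_one_zpow_sq (m : ℤ) : ((-1 : K)) ^ m * (-1) ^ m = 1 := by
  rw [← mul_zpow]; simp

theorem starLin_single (n : ℤ) :
    starLin (Finsupp.single n 1) = ((-1 : K) ^ n) • Finsupp.single (-n) 1 := by
  simp [starLin]

/-- `starLin` as an isometry of `Q`. -/
def starIso : Q →qᵢ Q where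
  toLinearMap := starLin
  map_app' := by
    have key : (pairForm fun m => (-1) ^ m).compl₁₂ starLin starLin =
        pairForm fun m => (-1) ^ m := by
      apply ext_basis
      intro m n
      simp only [LinearMap.compl₁₂_apply, starLin_single, map_smul, LinearMap.smul_apply,
        pairForm_single, smul_eq_mul]
      by_cases h : m + n = 0
      · have h' : n = -m := by omega
        subst h'
        simp only [neg_neg, neg_add_cancel, add_neg_cancel, if_true, neg_one_zpow_neg]
        rw [neg_one_zpow_sq, mul_one]
      · rw [if_neg h, if_neg (by omega)]; simp
    intro v
    exact LinearMap.congr_fun (LinearMap.congr_fun key v) v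

/-- The anti-automorphism `X ↦ X*` of `A` with `φ_n* = (-1)^n φ_{-n}`. -/
def star : A →ₗ[K] A :=
  CliffordAlgebra.reverse ∘ₗ (CliffordAlgebra.map starIso).toLinearMap

theorem star_mul (X Y : A) : star (X * Y) = star Y * star X := by
  simp [star, CliffordAlgebra.reverse.map_mul]

theorem star_φ (n : ℤ) : star (φ n) = ((-1 : K) ^ n) • φ (-n) := by
  simp only [star, φ, LinearMap.comp_apply, AlgHom.toLinearMap_apply,
    CliffordAlgebra.map_apply_ι, CliffordAlgebra.reverse_ι]
  rw [← map_smul]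
  congr 1
  exact starLin_single n

theorem star_star (X : A) : star (star X) = X := by
  have hlin : ∀ v, starLin (starLin v) = v := by
    intro v
    have : starLin ∘ₗ starLin = LinearMap.id := by
      apply Finsupp.lhom_ext'
      intro m
      apply LinearMap.ext_ring
      simp only [LinearMap.comp_apply, Finsupp.lsingle_apply, starLin_single, map_smul,
        LinearMap.id_apply, neg_neg, smul_smul, neg_one_zpow_neg, neg_one_zpow_sq, one_smul]
    exact LinearMap.congr_fun this v
  have hι : ∀ v, star (CliffordAlgebra.ι Q v) = CliffordAlgebra.ι Q (starLin v) := by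
    intro v
    simp only [star, LinearMap.comp_apply, AlgHom.toLinearMap_apply,
      CliffordAlgebra.map_apply_ι, CliffordAlgebra.reverse_ι]
    rfl
  induction X using CliffordAlgebra.left_induction with
  | algebraMap r => simp [star]
  | add x y hx hy => rw [map_add, map_add, hx, hy]
  | ι_mul x v hx => rw [star_mul, star_mul, hx, hι, hι, hlin]

/-! ### Fock spaces -/

/-- The right ideal `∑_{n>0} φ_n A` annihilating `⟨0|`. -/
def braNull : Submodule K A := Submodule.span K {Z | ∃ n : ℤ, 0 < n ∧ ∃ X : A, Z = φ n * X}

/-- The left ideal `∑_{n>0} A φ_{-n}` annihilating `|0⟩`. -/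
def ketNull : Submodule K A := Submodule.span K {Z | ∃ n : ℤ, 0 < n ∧ ∃ X : A, Z = X * φ (-n)}

/-- The dual Fock space `F* = ⟨0|·A`, the right `A`-module generated by `⟨0|`. -/
abbrev Bra : Type := A ⧸ braNull

/-- The Fock space `F = A·|0⟩`, the left `A`-module generated by `|0⟩`. -/
abbrev Ket : Type := A ⧸ ketNull

/-- The vacuum `⟨0|`. -/
def bra0 : Bra := braNull.mkQ 1

theorem braNull_mul (Y : A) : braNull ≤ braNull.comap (LinearMap.mulRight K Y) := by
  refine Submodule.span_le.mpr ?_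
  rintro _ ⟨n, hn, X, rfl⟩
  exact Submodule.subset_span ⟨n, hn, X * Y, by simp [mul_assoc]⟩

theorem ketNull_mul (Y : A) : ketNull ≤ ketNull.comap (LinearMap.mulLeft K Y) := by
  refine Submodule.span_le.mpr ?_
  rintro _ ⟨n, hn, X, rfl⟩
  exact Submodule.subset_span ⟨n, hn, Y * X, by simp [mul_assoc]⟩

/-- Right multiplication `⟨u| ↦ ⟨u|Y` on the dual Fock space. -/
def braMul (Y : A) : Bra →ₗ[K] Bra := braNull.mapQ braNull (LinearMap.mulRight K Y) (braNull_mul Y)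

/-- Left multiplication `|v⟩ ↦ Y|v⟩` on the Fock space. -/
def ketMul (Y : A) : Ket →ₗ[K] Ket := ketNull.mapQ ketNull (LinearMap.mulLeft K Y) (ketNull_mul Y)

/-- The functional `⟨u| ↦ ⟨u|0⟩` on the dual Fock space. -/
def braVac : Bra →ₗ[K] K := braNull.liftQ vev (by
  refine Submodule.span_le.mpr ?_
  rintro _ ⟨n, hn, X, rfl⟩
  exact vev_φ_mul n hn X)

/-- The functional `|v⟩ ↦ ⟨0|v⟩` on the Fock space. -/
def ketVac : Ket →ₗ[K] K := ketNull.liftQ vev (by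
  refine Submodule.span_le.mpr ?_
  rintro _ ⟨n, hn, X, rfl⟩
  exact vev_mul_φ n hn X)

/-- The involution `|v⟩ ↦ |v⟩*` from the Fock space to the dual Fock space. -/
def ketStar : Ket →ₗ[K] Bra := ketNull.mapQ braNull star (by
  refine Submodule.span_le.mpr ?_
  rintro _ ⟨n, hn, X, rfl⟩
  refine Submodule.subset_span ⟨n, hn, ((-1 : K) ^ n) • star X, ?_⟩
  rw [star_mul, star_φ, neg_neg, smul_mul_assoc, mul_smul_comm, neg_one_zpow_neg])

theorem ketStar_mk (X : A) : ketStar (ketNull.mkQ X) = braNull.mkQ (star X) := rfl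

/-- The even part `F*_even`. -/
def braEven : Submodule K Bra := (CliffordAlgebra.evenOdd Q 0).map braNull.mkQ

/-- The even part `F_even`. -/
def ketEven : Submodule K Ket := (CliffordAlgebra.evenOdd Q 0).map ketNull.mkQ

/-- The completion `Hom(F*_even, ℚ(β))` of `F_even`. -/
abbrev KetHatEven : Type := Module.Dual K braEven

theorem ketStar_injective : Function.Injective ketStar := by
  have hb : braNull ≤ ketNull.comap star := by
    refine Submodule.span_le.mpr ?_
    rintro _ ⟨n, hn, X, rfl⟩
    refine Submodule.subset_span ⟨n, hn, ((-1 : K) ^ n) • star X, ?_⟩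
    rw [star_mul, star_φ, smul_mul_assoc, mul_smul_comm]
  have : Function.LeftInverse (braNull.mapQ ketNull star hb) ketStar := by
    intro v
    obtain ⟨X, rfl⟩ := ketNull.mkQ_surjective v
    rw [ketStar_mk, Submodule.mkQ_apply, Submodule.mapQ_apply, star_star, Submodule.mkQ_apply]
  exact this.injective

theorem ketStar_ketMul (Y : A) (v : Ket) : ketStar (ketMul Y v) = braMul (star Y) (ketStar v) := by
  obtain ⟨X, rfl⟩ := ketNull.mkQ_surjective v
  rw [ketMul, Submodule.mkQ_apply, Submodule.mapQ_apply, ← Submodule.mkQ_apply,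
    ← Submodule.mkQ_apply, ketStar_mk, ketStar_mk, LinearMap.mulLeft_apply, star_mul]
  rfl

theorem star_even {X : A} (hX : X ∈ CliffordAlgebra.evenOdd Q 0) :
    star X ∈ CliffordAlgebra.evenOdd Q 0 := by
  rw [star, LinearMap.comp_apply, CliffordAlgebra.reverse_mem_evenOdd_iff]
  induction X, hX using CliffordAlgebra.even_induction with
  | algebraMap r =>
    simpa using SetLike.algebraMap_mem_graded (CliffordAlgebra.evenOdd Q) r
  | add x y hx hy ihx ihy => rw [map_add]; exact add_mem ihx ihy
  | ι_mul_ι_mul m₁ m₂ x hx ih =>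
    simp only [AlgHom.toLinearMap_apply, map_mul, CliffordAlgebra.map_apply_ι] at ih ⊢
    have := SetLike.mul_mem_graded (CliffordAlgebra.ι_mul_ι_mem_evenOdd_zero Q (starIso m₁)
      (starIso m₂)) ih
    simpa using this

/-- The involution restricted to even parts, `F_even → F*_even`. -/
def ketStarEven : ketEven →ₗ[K] braEven :=
  (ketStar ∘ₗ ketEven.subtype).codRestrict braEven (by
    rintro ⟨_, X, hX, rfl⟩
    exact ⟨star X, star_even hX, rfl⟩)

/-! ### Degree filtration, used to see that the infinite sums below are locally finite -/

/-- The product `φ_{m_1} ⋯ φ_{m_k}`. -/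
def word (w : List ℤ) : A := (w.map φ).prod

theorem word_move (N : ℕ) (IH : ∀ w : List ℤ, w.length < N → 0 < w.sum → word w ∈ braNull)
    (m : ℤ) (hm : 0 < m) (l : List ℤ) : ∀ t : List ℤ, l.length + 1 + t.length = N →
      0 < l.sum + m + t.sum → word l * φ m * word t ∈ braNull := by
  induction l using List.reverseRecOn with
  | nil =>
    intro t _ _
    exact Submodule.subset_span ⟨m, hm, word t, by simp [word]⟩
  | append_singleton l a ih =>
    intro t hN hs
    simp only [List.length_append, List.length_singleton, List.sum_append,
      List.sum_singleton] at hN hs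
    have h1 := ih (a :: t) (by simp only [List.length_cons]; omega)
      (by simp only [List.sum_cons]; omega)
    have e : word (l ++ [a]) * φ m * word t =
        (if a + m = 0 then 2 * (-1 : K) ^ a else 0) • word (l ++ t) -
          word l * φ m * word (a :: t) := by
      have h := φ_anticomm a m
      have h' : φ a * φ m = algebraMap K A (if a + m = 0 then 2 * (-1) ^ a else 0) - φ m * φ a :=
        eq_sub_of_add_eq h
      have : word (l ++ [a]) * φ m * word t = word l * (φ a * φ m) * word t := by
        simp [word, mul_assoc]
      rw [this, h', mul_sub, sub_mul, Algebra.smul_def, ← Algebra.commutes]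
      simp only [word, List.map_append, List.prod_append, List.map_cons, List.prod_cons, mul_assoc]
    rw [e]
    refine sub_mem ?_ h1
    split_ifs with h0
    · exact Submodule.smul_mem _ _ (IH _ (by simp only [List.length_append]; omega)
        (by simp only [List.sum_append]; omega))
    · simp

theorem word_mem_braNull (w : List ℤ) (hw : 0 < w.sum) : word w ∈ braNull := by
  induction hN : w.length using Nat.strong_induction_on generalizing w with
  | _ N ih =>
    obtain ⟨m, hmw, hm⟩ : ∃ m ∈ w, 0 < m := by
      by_contra! h
      have := List.sum_le_card_nsmul w 0 h
      simp at this
      omega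
    obtain ⟨l, t, rfl⟩ := List.append_of_mem hmw
    have := word_move N (fun w' h1 h2 => ih _ h1 w' h2 rfl) m hm l t
      (by simp only [List.length_append, List.length_cons] at hN; omega)
      (by simp only [List.sum_append, List.sum_cons] at hw; omega)
    simpa [word, mul_assoc] using this

/-- The part of `F*` of degree at most `d`, where `⟨0|φ_{m_1}⋯φ_{m_k}` has degree
`-(m_1+⋯+m_k)`. -/
def braFil (d : ℤ) : Submodule K Bra :=
  Submodule.span K {u | ∃ w : List ℤ, -d ≤ w.sum ∧ u = braNull.mkQ (word w)}

theorem braFil_neg {d : ℤ} (hd : d < 0) : braFil d = ⊥ := by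
  rw [eq_bot_iff]
  refine Submodule.span_le.mpr ?_
  rintro _ ⟨w, hw, rfl⟩
  have := word_mem_braNull w (by omega)
  simpa using this

theorem braFil_mono {d e : ℤ} (h : d ≤ e) : braFil d ≤ braFil e := by
  refine Submodule.span_mono ?_
  rintro _ ⟨w, hw, rfl⟩
  exact ⟨w, by omega, rfl⟩

theorem braFil_φ (k : ℤ) {d : ℤ} {u : Bra} (hu : u ∈ braFil d) :
    braMul (φ k) u ∈ braFil (d - k) := by
  suffices h : braFil d ≤ (braFil (d - k)).comap (braMul (φ k)) from h hu
  refine Submodule.span_le.mpr ?_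
  rintro _ ⟨w, hw, rfl⟩
  exact Submodule.subset_span ⟨w ++ [k], by simp; omega, by simp [braMul, word]⟩

theorem braMul_mul (X Y : A) (u : Bra) : braMul (X * Y) u = braMul Y (braMul X u) := by
  obtain ⟨Z, rfl⟩ := braNull.mkQ_surjective u
  simp [braMul, mul_assoc]

theorem exists_braFil (u : Bra) : ∃ d : ℕ, u ∈ braFil d := by
  obtain ⟨X, rfl⟩ := braNull.mkQ_surjective u
  induction X using CliffordAlgebra.right_induction with
  | algebraMap r =>
    refine ⟨0, ?_⟩
    rw [Algebra.algebraMap_eq_smul_one, map_smul]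
    exact Submodule.smul_mem _ _ (Submodule.subset_span ⟨[], by simp, by simp [word]⟩)
  | add x y hx hy =>
    obtain ⟨d, hd⟩ := hx
    obtain ⟨e, he⟩ := hy
    refine ⟨max d e, ?_⟩
    rw [map_add]
    exact add_mem (braFil_mono (by simp) hd) (braFil_mono (by simp) he)
  | mul_ι v x hx =>
    obtain ⟨d, hd⟩ := hx
    induction v using Finsupp.induction_linear with
    | zero => exact ⟨0, by simp⟩
    | add f g hf hg =>
      obtain ⟨a, ha⟩ := hf
      obtain ⟨b, hb⟩ := hg
      refine ⟨max a b, ?_⟩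
      rw [map_add, mul_add, map_add]
      exact add_mem (braFil_mono (by simp) ha) (braFil_mono (by simp) hb)
    | single k a =>
      refine ⟨(d - k).toNat, ?_⟩
      have h := Submodule.smul_mem _ a (braFil_φ k hd)
      have e : braNull.mkQ (x * CliffordAlgebra.ι Q (Finsupp.single k a)) =
          a • braMul (φ k) (braNull.mkQ x) := by
        have : Finsupp.single k a = a • Finsupp.single k (1 : K) := by simp
        rw [this, map_smul, mul_smul_comm, map_smul]
        simp [braMul, φ]
      rw [e]
      exact braFil_mono (Int.self_le_toNat _) h

/-- The corresponding filtration of `F`. -/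
def ketFil (d : ℤ) : Submodule K Ket := (braFil d).comap ketStar

theorem ketFil_neg {d : ℤ} (hd : d < 0) : ketFil d = ⊥ := by
  rw [ketFil, braFil_neg hd, Submodule.comap_bot]
  exact LinearMap.ker_eq_bot.mpr ketStar_injective

theorem ketFil_φ (k : ℤ) {d : ℤ} {v : Ket} (hv : v ∈ ketFil d) :
    ketMul (φ k) v ∈ ketFil (d + k) := by
  rw [ketFil, Submodule.mem_comap, ketStar_ketMul, star_φ]
  have e : braMul ((-1 : K) ^ k • φ (-k)) (ketStar v) =
      (-1 : K) ^ k • braMul (φ (-k)) (ketStar v) := by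
    obtain ⟨Z, hZ⟩ := braNull.mkQ_surjective (ketStar v)
    rw [← hZ]; simp [braMul]
  rw [e]
  have := braFil_φ (-k) (u := ketStar v) hv
  rw [sub_neg_eq_add] at this
  exact Submodule.smul_mem _ _ this

theorem ketMul_mul (X Y : A) (v : Ket) : ketMul (X * Y) v = ketMul X (ketMul Y v) := by
  obtain ⟨Z, rfl⟩ := ketNull.mkQ_surjective v
  simp [ketMul]

theorem exists_ketFil (v : Ket) : ∃ d : ℕ, v ∈ ketFil d := exists_braFil (ketStar v)

theorem φ_swap {m n : ℤ} (h : m + n ≠ 0) : φ m * φ n = -(φ n * φ m) := by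
  have := φ_anticomm m n
  rw [if_neg h, map_zero] at this
  exact eq_neg_of_add_eq_zero_left this

/-! ### Locally finite sums of operators -/

/-- The sum of a locally finite family of operators. -/
def lfSum {ι M : Type} [AddCommGroup M] [Module K M] (f : ι → M →ₗ[K] M)
    (hf : ∀ u, {i | f i u ≠ 0}.Finite) : M →ₗ[K] M where
  toFun u := ∑ᶠ i, f i u
  map_add' u v := by
    simp only [map_add]
    exact finsum_add_distrib (hf u) (hf v)
  map_smul' c u := by
    simp only [map_smul, RingHom.id_apply]
    exact (smul_finsum' c (hf u)).symm

theorem lfSum_mem {ι M : Type} [AddCommGroup M] [Module K M] {f : ι → M →ₗ[K] M}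
    (hf : ∀ u, {i | f i u ≠ 0}.Finite) (S : Submodule K M) {u : M} (h : ∀ i, f i u ∈ S) :
    lfSum f hf u ∈ S :=
  finsum_induction (· ∈ S) S.zero_mem (fun _ _ => S.add_mem) h

theorem smul_ne_zero_subset {ι M : Type} [AddCommGroup M] [Module K M] (c : ι → K)
    (f : ι → M →ₗ[K] M) (u : M) : {i | (c i • f i) u ≠ 0} ⊆ {i | f i u ≠ 0} := by
  intro i hi h
  exact hi (by rw [LinearMap.smul_apply, h, smul_zero])

theorem braFil_eq_zero {d : ℤ} {u : Bra} (hu : u ∈ braFil d) (hd : d < 0) : u = 0 := by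
  rw [braFil_neg hd] at hu; simpa using hu

theorem ketFil_eq_zero {d : ℤ} {v : Ket} (hv : v ∈ ketFil d) (hd : d < 0) : v = 0 := by
  rw [ketFil_neg hd] at hv; simpa using hv

/-! ### Currents -/

theorem braCurrent_finite {m : ℤ} (hm : Odd m) (u : Bra) :
    {i : ℤ | (((1 / 4 : K) * (-1) ^ i) • braMul (φ (-i - m) * φ i)) u ≠ 0}.Finite := by
  have hm0 : m ≠ 0 := by rintro rfl; simp at hm
  obtain ⟨d, hd⟩ := exists_braFil u
  refine ((Set.finite_Icc (-m - d) (d : ℤ)).subset ?_).subset (smul_ne_zero_subset _ _ u)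
  intro i hi
  rw [Set.mem_ofPred_eq] at hi
  rw [Set.mem_Icc]
  by_contra hc
  apply hi
  by_cases h : i ≤ d
  · have h2 : i < -m - d := by
      by_contra h3
      exact hc ⟨by omega, h⟩
    rw [braMul_mul, braFil_eq_zero (braFil_φ (-i - m) hd) (by omega), map_zero]
  · have e : braMul (-(φ i * φ (-i - m))) u = -braMul (φ i * φ (-i - m)) u := by
      obtain ⟨Z, rfl⟩ := braNull.mkQ_surjective u
      simp [braMul, mul_assoc]
    rw [φ_swap (by omega), e, braMul_mul, braFil_eq_zero (braFil_φ i hd) (by omega), map_zero,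
      neg_zero]

theorem ketCurrent_finite {m : ℤ} (hm : Odd m) (v : Ket) :
    {i : ℤ | (((1 / 4 : K) * (-1) ^ i) • ketMul (φ (-i - m) * φ i)) v ≠ 0}.Finite := by
  have hm0 : m ≠ 0 := by rintro rfl; simp at hm
  obtain ⟨d, hd⟩ := exists_ketFil v
  refine ((Set.finite_Icc (-d : ℤ) (d - m : ℤ)).subset ?_).subset (smul_ne_zero_subset _ _ v)
  intro i hi
  rw [Set.mem_ofPred_eq] at hi
  rw [Set.mem_Icc]
  by_contra hc
  apply hi
  by_cases h : -(d : ℤ) ≤ i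
  · have h2 : d - m < i := by
      by_contra h3
      exact hc ⟨h, by omega⟩
    have e : ketMul (-(φ i * φ (-i - m))) v = -ketMul (φ i * φ (-i - m)) v := by
      obtain ⟨Z, rfl⟩ := ketNull.mkQ_surjective v
      simp [ketMul, mul_assoc]
    rw [φ_swap (by omega), e, ketMul_mul, ketFil_eq_zero (ketFil_φ (-i - m) hd) (by omega),
      map_zero, neg_zero]
  · rw [ketMul_mul, ketFil_eq_zero (ketFil_φ i hd) (by omega), map_zero]

open Classical in
/-- The current operator `b_m = ¼ ∑_i (-1)^i φ_{-i-m} φ_i` (`m` odd), acting on `F*` from the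
right. It is not used for even `m`. -/
def braCurrent (m : ℤ) : Bra →ₗ[K] Bra :=
  if hm : Odd m then
    lfSum (fun i : ℤ => ((1 / 4 : K) * (-1) ^ i) • braMul (φ (-i - m) * φ i))
      (braCurrent_finite hm)
  else 0

open Classical in
/-- The current operator `b_m` (`m` odd), acting on `F` from the left.
It is not used for even `m`. -/
def ketCurrent (m : ℤ) : Ket →ₗ[K] Ket :=
  if hm : Odd m then
    lfSum (fun i : ℤ => ((1 / 4 : K) * (-1) ^ i) • ketMul (φ (-i - m) * φ i))
      (ketCurrent_finite hm)
  else 0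

theorem braFil_current (m : ℤ) {d : ℤ} {u : Bra} (hu : u ∈ braFil d) :
    braCurrent m u ∈ braFil (d + m) := by
  unfold braCurrent
  split_ifs with hm
  · refine lfSum_mem _ _ fun i => Submodule.smul_mem _ _ ?_
    rw [braMul_mul]
    have := braFil_φ i (braFil_φ (-i - m) hu)
    rwa [show d - (-i - m) - i = d + m by ring] at this
  · simp

theorem ketFil_current (m : ℤ) {d : ℤ} {v : Ket} (hv : v ∈ ketFil d) :
    ketCurrent m v ∈ ketFil (d - m) := by
  unfold ketCurrent
  split_ifs with hm
  · refine lfSum_mem _ _ fun i => Submodule.smul_mem _ _ ?_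
    rw [ketMul_mul]
    have := ketFil_φ (-i - m) (ketFil_φ i hv)
    rwa [show d + i + (-i - m) = d - m by ring] at this
  · simp

theorem braEven_current (m : ℤ) {u : Bra} (hu : u ∈ braEven) : braCurrent m u ∈ braEven := by
  unfold braCurrent
  split_ifs with hm
  · refine lfSum_mem _ _ fun i => Submodule.smul_mem _ _ ?_
    obtain ⟨X, hX, rfl⟩ := hu
    refine ⟨X * (φ (-i - m) * φ i), ?_, rfl⟩
    have := SetLike.mul_mem_graded hX (CliffordAlgebra.ι_mul_ι_mem_evenOdd_zero Q
      (Finsupp.single (-i - m) 1) (Finsupp.single i 1))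
    rwa [add_zero] at this
  · simp

/-- The `β`-deformed current `b_m^{(β)}` for `m > 0`, acting on `F*` from the right:
the polynomial `((X - β/2)^m - (-X - β/2)^m) / 2` with `X^k` replaced by `b_k`. -/
def braCurrentBeta (m : ℕ) : Bra →ₗ[K] Bra :=
  ∑ k ∈ Finset.range (m + 1),
    (Polynomial.C (1 / 2 : K) * ((Polynomial.X - Polynomial.C (β / 2)) ^ m -
      (-Polynomial.X - Polynomial.C (β / 2)) ^ m)).coeff k • braCurrent k

theorem braEven_currentBeta (m : ℕ) {u : Bra} (hu : u ∈ braEven) :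
    braCurrentBeta m u ∈ braEven := by
  rw [braCurrentBeta, LinearMap.sum_apply]
  exact Submodule.sum_mem _ fun k _ => Submodule.smul_mem _ _ (braEven_current k hu)

/-- For `m > 0`, the expansion of `((X - β/2)^{-m} - (-X - β/2)^{-m}) / 2` as a power series in
`Y = X⁻¹`; here `(X - β/2)⁻¹ = Y / (1 - βY/2)` and `(-X - β/2)⁻¹ = -Y / (1 + βY/2)`. -/
def currentSeries (m : ℕ) : PowerSeries K :=
  PowerSeries.C (1 / 2 : K) *
    ((PowerSeries.X * (1 - PowerSeries.C (β / 2) * PowerSeries.X)⁻¹) ^ m -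
      (-PowerSeries.X * (1 + PowerSeries.C (β / 2) * PowerSeries.X)⁻¹) ^ m)

theorem ketCurrentBracket_finite (m : ℕ) (v : Ket) :
    {k : ℕ | (PowerSeries.coeff k (currentSeries m) • ketCurrent k) v ≠ 0}.Finite := by
  obtain ⟨d, hd⟩ := exists_ketFil v
  refine ((Set.finite_Iic d).subset ?_).subset
    (smul_ne_zero_subset _ (fun k : ℕ => ketCurrent (k : ℤ)) v)
  intro k hk
  by_contra hc
  rw [Set.mem_Iic] at hc
  exact hk (ketFil_eq_zero (ketFil_current k hd) (by omega))

/-- The `β`-deformed current `b_m^{[β]} = (b_{-m}^{(β)})*` for `m > 0`, acting on `F` from the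
left: the series `currentSeries m` with `Y^k` replaced by `(b_{-k})* = b_k`. -/
def ketCurrentBracket (m : ℕ) : Ket →ₗ[K] Ket :=
  lfSum (fun k : ℕ => PowerSeries.coeff k (currentSeries m) • ketCurrent k)
    (ketCurrentBracket_finite m)

/-! ### `β`-deformed fermions and `e^Θ`, acting on `F*` from the right -/

theorem braPhi_finite (n : ℕ) (u : Bra) :
    {k : ℕ | (((Polynomial.X + Polynomial.C (β / 2)) ^ k).coeff n • braMul (φ k)) u ≠ 0}.Finite := by
  obtain ⟨d, hd⟩ := exists_braFil u
  refine ((Set.finite_Iic d).subset ?_).subset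
    (smul_ne_zero_subset _ (fun k : ℕ => braMul (φ (k : ℤ))) u)
  intro k hk
  by_contra hc
  rw [Set.mem_Iic] at hc
  exact hk (braFil_eq_zero (braFil_φ k hd) (by omega))

/-- `φ_n^{(β)}` for `n ≥ 0`: the coefficient of `z^n` in `∑_{k ≥ 0} φ_k (z + β/2)^k`. -/
def braPhi (n : ℕ) : Bra →ₗ[K] Bra :=
  lfSum (fun k : ℕ => ((Polynomial.X + Polynomial.C (β / 2)) ^ k).coeff n • braMul (φ k))
    (braPhi_finite n)

theorem braFil_braPhi (n : ℕ) {d : ℤ} {u : Bra} (hu : u ∈ braFil d) :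
    braPhi n u ∈ braFil (d - n) := by
  refine lfSum_mem _ _ fun k => ?_
  by_cases h : n ≤ k
  · exact Submodule.smul_mem _ _ (braFil_mono (by omega) (braFil_φ k hu))
  · have : ((Polynomial.X + Polynomial.C (β / 2)) ^ k).coeff n = 0 := by
      apply Polynomial.coeff_eq_zero_of_natDegree_lt
      rw [Polynomial.natDegree_pow, Polynomial.natDegree_X_add_C]
      omega
    rw [this]; simp

theorem braPhiHalf_finite (n : ℕ) (u : Bra) :
    {k : ℕ | (PowerSeries.coeff k (PowerSeries.C 2 + PowerSeries.C β * PowerSeries.X)⁻¹ •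
      braPhi (n + k)) u ≠ 0}.Finite := by
  obtain ⟨d, hd⟩ := exists_braFil u
  refine ((Set.finite_Iic d).subset ?_).subset
    (smul_ne_zero_subset _ (fun k : ℕ => braPhi (n + k)) u)
  intro k hk
  by_contra hc
  rw [Set.mem_Iic] at hc
  exact hk (braFil_eq_zero (braFil_braPhi (n + k) hd) (by push_cast; omega))

/-- `Φ_n^{(β)}` for `n ≥ 0`: the coefficient of `z^n` in `(2 + β z⁻¹)⁻¹ φ^{(β)}(z)`, where
`(2 + β z⁻¹)⁻¹` is expanded in powers of `z⁻¹`. -/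
def braPhiHalf (n : ℕ) : Bra →ₗ[K] Bra :=
  lfSum (fun k : ℕ => PowerSeries.coeff k (PowerSeries.C 2 + PowerSeries.C β * PowerSeries.X)⁻¹ •
    braPhi (n + k)) (braPhiHalf_finite n)

theorem braTheta_finite (u : Bra) :
    {j : ℕ | ((2 * (β / 2) ^ (2 * j + 1) / ((2 * j + 1 : ℕ) : K)) •
      braCurrent (-((2 * j + 1 : ℕ) : ℤ))) u ≠ 0}.Finite := by
  obtain ⟨d, hd⟩ := exists_braFil u
  refine ((Set.finite_Iic d).subset ?_).subset
    (smul_ne_zero_subset _ (fun j : ℕ => braCurrent (-((2 * j + 1 : ℕ) : ℤ))) u)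
  intro k hk
  by_contra hc
  rw [Set.mem_Iic] at hc
  exact hk (braFil_eq_zero (braFil_current _ hd) (by push_cast; omega))

/-- `Θ = 2 ∑_{n = 1,3,5,…} (β/2)^n b_{-n} / n`. -/
def braTheta : Bra →ₗ[K] Bra :=
  lfSum (fun j : ℕ => (2 * (β / 2) ^ (2 * j + 1) / ((2 * j + 1 : ℕ) : K)) •
    braCurrent (-((2 * j + 1 : ℕ) : ℤ))) braTheta_finite

theorem braFil_theta_pow (k : ℕ) {d : ℤ} {u : Bra} (hu : u ∈ braFil d) :
    (braTheta ^ k) u ∈ braFil (d - k) := by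
  induction k with
  | zero => simpa using hu
  | succ k ih =>
    rw [pow_succ', Module.End.mul_apply]
    refine lfSum_mem _ _ fun j => Submodule.smul_mem _ _ ?_
    exact braFil_mono (by push_cast; omega) (braFil_current _ ih)

theorem braExpTheta_finite (u : Bra) :
    {k : ℕ | (((k.factorial : K)⁻¹) • braTheta ^ k) u ≠ 0}.Finite := by
  obtain ⟨d, hd⟩ := exists_braFil u
  refine ((Set.finite_Iic d).subset ?_).subset (smul_ne_zero_subset _ (fun k => braTheta ^ k) u)
  intro k hk
  by_contra hc
  rw [Set.mem_Iic] at hc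
  exact hk (braFil_eq_zero (braFil_theta_pow k hd) (by omega))

/-- `e^Θ = ∑_k Θ^k / k!`. -/
def braExpTheta : Bra →ₗ[K] Bra :=
  lfSum (fun k : ℕ => ((k.factorial : K)⁻¹) • braTheta ^ k) braExpTheta_finite

/-- `⟨u| ↦ ⟨u| Φ_{l_1}^{(β)} e^Θ ⋯ Φ_{l_r}^{(β)} e^Θ`. -/
def braProd : List ℕ → (Bra →ₗ[K] Bra)
  | [] => LinearMap.id
  | n :: l => braProd l ∘ₗ braExpTheta ∘ₗ braPhiHalf n

/-- The vector `|λ⟩_P`, as a functional on `F*_even`: it is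
`Φ_{λ_1} e^Θ ⋯ Φ_{λ_r} e^Θ |0⟩` for even `r` and
`Φ_{λ_1} e^Θ ⋯ Φ_{λ_r} e^Θ φ_0^{(β)} e^Θ |0⟩` for odd `r`. -/
def ketP (l : List ℕ) : KetHatEven :=
  (if Even l.length then braVac ∘ₗ braProd l
    else braVac ∘ₗ braExpTheta ∘ₗ braPhi 0 ∘ₗ braProd l) ∘ₗ braEven.subtype

/-! ### Power sums and Hamiltonians

Power series in the variables `x_0, x_1, x_2, …` are elements of `MvPowerSeries ℕ K`. -/

open Classical in
/-- The power sum `p_n(x) = ∑_i x_i^n` for `n ≥ 1`. -/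
def powerSum (n : ℕ) : MvPowerSeries ℕ K := fun d => if ∃ i, d = Finsupp.single i n then 1 else 0

/-- For a family of operators `B_n` on `M`, the operator `2 ∑_{n ≥ 1} (p_n(x) / n) B_n` on formal
power series in `x` with coefficients in `M`, given by their coefficients.
(The coefficient of `x^a` in `p_n` vanishes if `n` is not the degree of `a`.) -/
def hamiltonian {M : Type} [AddCommGroup M] [Module K M] (B : ℕ → M →ₗ[K] M)
    (U : (ℕ →₀ ℕ) → M) : (ℕ →₀ ℕ) → M := fun d =>
  ∑ a ∈ Finset.HasAntidiagonal.antidiagonal d, ∑ n ∈ Finset.Icc 1 a.1.degree,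
    (2 / (n : K) * MvPowerSeries.coeff a.1 (powerSum n)) • B n (U a.2)

open Classical in
/-- The exponential of `hamiltonian B` applied to the constant series `u`.
(The `k`-th power of the Hamiltonian contributes in degrees at least `k` only.) -/
def expHamiltonian {M : Type} [AddCommGroup M] [Module K M] (B : ℕ → M →ₗ[K] M) (u : M) :
    (ℕ →₀ ℕ) → M := fun d =>
  ∑ k ∈ Finset.range (d.degree + 1),
    ((k.factorial : K)⁻¹) • (hamiltonian B)^[k] (fun e => if e = 0 then u else 0) d

theorem expHamiltonian_mem {M : Type} [AddCommGroup M] [Module K M] {B : ℕ → M →ₗ[K] M}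
    (S : Submodule K M) (hB : ∀ n, ∀ u ∈ S, B n u ∈ S) {u : M} (hu : u ∈ S) (d : ℕ →₀ ℕ) :
    expHamiltonian B u d ∈ S := by
  classical
  refine Submodule.sum_mem _ fun k hk => Submodule.smul_mem _ _ ?_
  clear hk
  induction k generalizing d with
  | zero =>
    simp only [Function.iterate_zero, id]
    split_ifs
    · exact hu
    · exact S.zero_mem
  | succ k ih =>
    rw [Function.iterate_succ_apply']
    exact Submodule.sum_mem _ fun a _ => Submodule.sum_mem _ fun n _ =>
      Submodule.smul_mem _ _ (hB n _ (ih a.2))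

theorem bra0_even : bra0 ∈ braEven := ⟨1, SetLike.one_mem_graded _, rfl⟩

/-- The coefficient of `x^d` in `⟨0| exp H^{(β)}(x)`, where
`H^{(β)}(x) = 2 ∑_{n ≥ 1} (p_n(x) / n) b_n^{(β)}`. -/
def braExpH (d : ℕ →₀ ℕ) : braEven :=
  ⟨expHamiltonian braCurrentBeta bra0 d,
    expHamiltonian_mem braEven (fun n _ hu => braEven_currentBeta n hu) bra0_even d⟩

/-- `⟨0| exp H^{(β)}(x) |v⟩` for `v` in the completed even Fock space. -/
def expectH (v : KetHatEven) : MvPowerSeries ℕ K := fun d => v (braExpH d)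

/-- `χ(|v⟩) = ⟨0| exp H^{[β]}(x) |v⟩`, where
`H^{[β]}(x) = 2 ∑_{n ≥ 1} (p_n(x) / n) b_n^{[β]}`. -/
def χ (v : ketEven) : MvPowerSeries ℕ K := fun d =>
  ketVac (expHamiltonian ketCurrentBracket (v : Ket) d)

/-! ### The algebras of symmetric functions and their pairing -/

/-- Odd natural numbers. -/
abbrev OddNat : Type := {n : ℕ // Odd n}

/-- `p_n^{(β)}(x) = ∑_{i ≥ 0} binom(-n, i) (β/2)^i p_{n+i}(x)` for `n ≥ 1`.
(In each degree only finitely many terms contribute.) -/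
def powerSumBeta (n : ℕ) : MvPowerSeries ℕ K := fun d : ℕ →₀ ℕ =>
  ∑ i ∈ Finset.range (d.degree + 1),
    ((Ring.choose (-(n : ℤ)) i : ℤ) : K) * (β / 2) ^ i * MvPowerSeries.coeff d (powerSum (n + i))

/-- `p_n^{[β]}(x) = ∑_{i = 1}^n binom(n, i) (β/2)^{n-i} p_i(x)`, that is,
`p_n(x + β/2) - p_n(β/2)`. -/
def powerSumBracket (n : ℕ) : MvPowerSeries ℕ K :=
  ∑ i ∈ Finset.Icc 1 n, ((n.choose i : K) * (β / 2) ^ (n - i)) • powerSum i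

theorem powerSumBeta_coeff_eq_zero {n : ℕ} {d : ℕ →₀ ℕ} (h : d.degree < n) :
    MvPowerSeries.coeff d (powerSumBeta n) = 0 := by
  change (∑ i ∈ Finset.range (d.degree + 1), ((Ring.choose (-(n : ℤ)) i : ℤ) : K) *
    (β / 2) ^ i * MvPowerSeries.coeff d (powerSum (n + i))) = 0
  refine Finset.sum_eq_zero fun i _ => ?_
  have : MvPowerSeries.coeff d (powerSum (n + i)) = 0 := by
    refine if_neg ?_
    rintro ⟨j, rfl⟩
    simp at h
  rw [this, mul_zero]

theorem powerSumBeta_hasSubst :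
    MvPowerSeries.HasSubst (fun n : OddNat => powerSumBeta n) where
  const_coeff n := by
    have h : MvPowerSeries.coeff 0 (powerSumBeta n) = 0 :=
      powerSumBeta_coeff_eq_zero (by simpa using n.2.pos)
    rw [← MvPowerSeries.coeff_zero_eq_constantCoeff_apply, h]
    exact IsNilpotent.zero
  coeff_zero d := by
    refine Set.Finite.subset ((Set.finite_Iic d.degree).preimage
      (f := (Subtype.val : OddNat → ℕ)) Subtype.val_injective.injOn) ?_
    intro n hn
    by_contra hc
    simp only [Set.mem_preimage, Set.mem_Iic, not_le] at hc
    exact hn (powerSumBeta_coeff_eq_zero hc)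

/-- The evaluation of a formal power series in symbols indexed by the odd numbers at
`p_1^{(β)}(x), p_3^{(β)}(x), …`. -/
def evalBeta : MvPowerSeries OddNat K →ₐ[K] MvPowerSeries ℕ K :=
  MvPowerSeries.substAlgHom powerSumBeta_hasSubst

/-- The evaluation of a polynomial in symbols indexed by the odd numbers at
`p_1^{[β]}(x), p_3^{[β]}(x), …`; its range is `gΓ = ℚ(β)[p_1^{[β]}, p_3^{[β]}, …]`. -/
def evalBracket : MvPolynomial OddNat K →ₐ[K] MvPowerSeries ℕ K :=
  MvPolynomial.aeval fun n : OddNat => powerSumBracket n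

/-- The completed algebra `ℚ(β)[[p_1^{(β)}, p_3^{(β)}, …]]`. -/
def GΓhat : Subalgebra K (MvPowerSeries ℕ K) := evalBeta.range

/-- The pairing with `⟨p_λ^{(β)}, p_μ^{[β]}⟩ = 2^{-ℓ(λ)} z_λ δ_{λ,μ}` for odd partitions `λ, μ`,
in terms of the coefficients of the monomials `p_λ`; an odd partition is given by the
multiplicities `m n` of its parts `n`, and `z = ∏ n^{m n} (m n)!`. -/
def pairing (f : MvPowerSeries OddNat K) (g : MvPolynomial OddNat K) : K :=
  ∑ m ∈ g.support, MvPowerSeries.coeff m f * MvPolynomial.coeff m g *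
    ((2 : K)⁻¹ ^ m.degree * m.prod fun n e => ((n : ℕ) : K) ^ e * (e.factorial : K))

/-- `F` is the element `[v] ∈ GΓhat` attached to `v` in the completed even Fock space:
`⟨F, χ(|w⟩)⟩ = v(|w⟩*)` for all `|w⟩ ∈ F_even` (which requires `χ(|w⟩) ∈ gΓ`). -/
def IsOmega (v : KetHatEven) (F : MvPowerSeries ℕ K) : Prop :=
  ∃ f, evalBeta f = F ∧
    ∀ w : ketEven, ∃ g, evalBracket g = χ w ∧ pairing f g = v (ketStarEven w)

/-- The `β`-deformed boson-fermion correspondence `Ω(v)`. -/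
def Ω (v : KetHatEven) : MvPowerSeries ℕ K := Classical.epsilon (IsOmega v)

/-! ### The `K`-theoretic `P`-function -/

/-- The field of rational functions `ℚ(β)(x_1, …, x_n)`. -/
abbrev RatFun (n : ℕ) : Type := FractionRing (MvPolynomial (Fin n) K)

/-- The variable `x_i`. -/
def var {n : ℕ} (i : Fin n) : RatFun n := algebraMap (MvPolynomial (Fin n) K) _ (MvPolynomial.X i)

/-- `x ⊕ y = x + y + β x y`. -/
def oplus {n : ℕ} (x y : RatFun n) : RatFun n := x + y + algebraMap K _ β * x * y

/-- `x ⊖ y = (x - y) / (1 + β y)`. -/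
def ominus {n : ℕ} (x y : RatFun n) : RatFun n := (x - y) / (1 + algebraMap K _ β * y)

/-- The `K`-theoretic `P`-function in `n ≥ r` variables, `r = ℓ(λ)`:
`1/(n-r)! ∑_{w ∈ S_n} w (∏_{i ≤ r} x_i^{λ_i} ∏_{i ≤ r, i < j ≤ n} (x_i ⊕ x_j) / (x_i ⊖ x_j))`. -/
def GPfin (l : List ℕ) (n : ℕ) : RatFun n :=
  ((n - l.length).factorial : RatFun n)⁻¹ * ∑ w : Equiv.Perm (Fin n),
    ∏ i : Fin n, if h : (i : ℕ) < l.length then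
      var (w i) ^ l[(i : ℕ)] *
        ∏ j ∈ Finset.Ioi i, oplus (var (w i)) (var (w j)) / ominus (var (w i)) (var (w j))
    else 1

/-- `G` is the `K`-theoretic `P`-function `GP_λ(x_1, x_2, …)` in infinitely many variables: for
every `n ≥ ℓ(λ)`, setting all variables but the first `n` to zero turns `G` into the polynomial
`GP_λ(x_1, …, x_n)`. -/
def IsGP (l : List ℕ) (G : MvPowerSeries ℕ K) : Prop :=
  ∀ n, l.length ≤ n → ∃ P : MvPolynomial (Fin n) K,
    algebraMap (MvPolynomial (Fin n) K) (RatFun n) P = GPfin l n ∧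
      ∀ d : Fin n →₀ ℕ, MvPowerSeries.coeff (d.mapDomain Fin.val) G = P.coeff d

/-- The `K`-theoretic `P`-function `GP_λ(x)`. -/
def GP (l : List ℕ) : MvPowerSeries ℕ K := Classical.epsilon (IsGP l)

end KFermion

end

/-! ### The Heisenberg algebra of odd currents acting on the dual Fock space. -/

noncomputable section

namespace KFermion

/-! ### Right multiplication on the dual Fock space -/

theorem braMul_mk (X Y : A) : braMul Y (braNull.mkQ X) = braNull.mkQ (X * Y) := rfl

theorem braMul_add (X Y : A) (u : Bra) : braMul (X + Y) u = braMul X u + braMul Y u := by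
  obtain ⟨Z, rfl⟩ := braNull.mkQ_surjective u
  simp only [braMul_mk, mul_add, map_add]

theorem braMul_smul (c : K) (X : A) (u : Bra) : braMul (c • X) u = c • braMul X u := by
  obtain ⟨Z, rfl⟩ := braNull.mkQ_surjective u
  simp only [braMul_mk, mul_smul_comm, map_smul]

theorem braMul_neg (X : A) (u : Bra) : braMul (-X) u = -braMul X u := by
  obtain ⟨Z, rfl⟩ := braNull.mkQ_surjective u
  simp only [braMul_mk, mul_neg, map_neg]

theorem braMul_algebraMap (c : K) (u : Bra) : braMul (algebraMap K A c) u = c • u := by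
  obtain ⟨Z, rfl⟩ := braNull.mkQ_surjective u
  rw [braMul_mk, ← Algebra.commutes, ← Algebra.smul_def, map_smul]

theorem braMul_φ_anticomm (m n : ℤ) (u : Bra) :
    braMul (φ n) (braMul (φ m) u) + braMul (φ m) (braMul (φ n) u) =
      (if m + n = 0 then 2 * (-1 : K) ^ m else 0) • u := by
  rw [← braMul_mul, ← braMul_mul, ← braMul_add, φ_anticomm, braMul_algebraMap]

theorem bra0_φ {n : ℤ} (hn : 0 < n) : braMul (φ n) bra0 = 0 := by
  rw [bra0, braMul_mk, one_mul, Submodule.mkQ_apply, Submodule.Quotient.mk_eq_zero]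
  exact Submodule.subset_span ⟨n, hn, 1, by simp⟩

theorem braVac_φ {n : ℤ} (hn : n < 0) (u : Bra) : braVac (braMul (φ n) u) = 0 := by
  obtain ⟨Z, rfl⟩ := braNull.mkQ_surjective u
  have := vev_mul_φ (-n) (by omega) Z
  rwa [neg_neg] at this

theorem φ_zero_sq : φ 0 * φ 0 = 1 := by
  have h := φ_anticomm 0 0
  simp only [add_zero, if_true, zpow_zero, mul_one] at h
  have h2 : (2 : K) • (φ 0 * φ 0) = (2 : K) • (1 : A) := by
    rw [two_smul, h, Algebra.smul_def, mul_one]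
  exact smul_right_injective _ (two_ne_zero (α := K)) h2

/-- The operator `⟨0|X ↦ ⟨0|φ_0 X` on the dual Fock space. -/
def braJ : Bra →ₗ[K] Bra := braNull.mapQ braNull (LinearMap.mulLeft K (φ 0)) (by
  refine Submodule.span_le.mpr ?_
  rintro _ ⟨n, hn, X, rfl⟩
  refine Submodule.subset_span ⟨n, hn, -(φ 0 * X), ?_⟩
  rw [LinearMap.mulLeft_apply, ← mul_assoc, φ_swap (by omega), mul_neg, neg_mul, mul_assoc])

theorem braJ_mk (X : A) : braJ (braNull.mkQ X) = braNull.mkQ (φ 0 * X) := rfl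

theorem braJ_braMul (Y : A) (u : Bra) : braJ (braMul Y u) = braMul Y (braJ u) := by
  obtain ⟨Z, rfl⟩ := braNull.mkQ_surjective u
  simp only [braMul_mk, braJ_mk, mul_assoc]

theorem braJ_braJ (u : Bra) : braJ (braJ u) = u := by
  obtain ⟨Z, rfl⟩ := braNull.mkQ_surjective u
  rw [braJ_mk, braJ_mk, ← mul_assoc, φ_zero_sq, one_mul]

/-! ### Locally finite sums -/

theorem lfSum_apply {ι M : Type} [AddCommGroup M] [Module K M] (f : ι → M →ₗ[K] M)
    (hf : ∀ u, {i | f i u ≠ 0}.Finite) (u : M) : lfSum f hf u = ∑ᶠ i, f i u := rfl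

theorem map_lfSum {ι M N : Type} [AddCommGroup M] [Module K M] [AddCommGroup N] [Module K N]
    (f : ι → M →ₗ[K] M) (hf : ∀ u, {i | f i u ≠ 0}.Finite) (g : M →ₗ[K] N) (u : M) :
    g (lfSum f hf u) = ∑ᶠ i, g (f i u) := by
  rw [lfSum_apply]
  exact AddMonoidHom.map_finsum g.toAddMonoidHom (hf u)

theorem lfSum_comm {ι M : Type} [AddCommGroup M] [Module K M]
    (f : ι → M →ₗ[K] M) (hf : ∀ u, {i | f i u ≠ 0}.Finite) (g : M →ₗ[K] M)
    (hg : ∀ i u, g (f i u) = f i (g u)) (u : M) : g (lfSum f hf u) = lfSum f hf (g u) := by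
  rw [map_lfSum, lfSum_apply]
  exact finsum_congr fun i => hg i u

theorem lfSum_eq_sum {ι M : Type} [AddCommGroup M] [Module K M]
    (f : ι → M →ₗ[K] M) (hf : ∀ u, {i | f i u ≠ 0}.Finite) (u : M) (s : Finset ι)
    (hs : ∀ i, i ∉ s → f i u = 0) : lfSum f hf u = ∑ i ∈ s, f i u := by
  rw [lfSum_apply]
  refine finsum_eq_sum_of_support_subset _ fun i hi => ?_
  by_contra hc
  exact hi (hs i hc)

/-! ### Commutation relations of the currents -/

theorem braCurrent_apply {m : ℤ} (hm : Odd m) (u : Bra) :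
    braCurrent m u = ∑ᶠ i : ℤ, ((1 / 4 : K) * (-1) ^ i) • braMul (φ i) (braMul (φ (-i - m)) u) := by
  rw [braCurrent, dif_pos hm, lfSum_apply]
  refine finsum_congr fun i => ?_
  rw [LinearMap.smul_apply, braMul_mul]

theorem braCurrent_finite' {m : ℤ} (hm : Odd m) (u : Bra) :
    (Function.support fun i : ℤ =>
      ((1 / 4 : K) * (-1) ^ i) • braMul (φ i) (braMul (φ (-i - m)) u)).Finite := by
  refine (braCurrent_finite hm u).subset ?_
  intro i hi
  rwa [Set.mem_ofPred_eq, LinearMap.smul_apply, braMul_mul]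

theorem braJ_current (m : ℤ) (u : Bra) : braJ (braCurrent m u) = braCurrent m (braJ u) := by
  unfold braCurrent
  split_ifs with hm
  · refine lfSum_comm _ _ _ (fun i v => ?_) u
    rw [LinearMap.smul_apply, LinearMap.smul_apply, map_smul, braJ_braMul]
  · simp

theorem neg_one_zpow_odd_sub {m : ℤ} (hm : Odd m) (n : ℤ) : (-1 : K) ^ (n - m) = -(-1) ^ n := by
  rw [zpow_sub₀ (neg_ne_zero.mpr one_ne_zero), hm.neg_one_zpow, div_neg, div_one]

/-- `[b_m, φ_n] = φ_{n-m}`. -/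
theorem braMul_φ_current {m : ℤ} (hm : Odd m) (n : ℤ) (u : Bra) :
    braMul (φ n) (braCurrent m u) = braCurrent m (braMul (φ n) u) + braMul (φ (n - m)) u := by
  classical
  rw [← sub_eq_iff_eq_add', braCurrent_apply hm, braCurrent_apply hm]
  have h1 : braMul (φ n) (∑ᶠ i : ℤ, ((1 / 4 : K) * (-1) ^ i) •
      braMul (φ i) (braMul (φ (-i - m)) u)) = ∑ᶠ i : ℤ, ((1 / 4 : K) * (-1) ^ i) •
      braMul (φ n) (braMul (φ i) (braMul (φ (-i - m)) u)) := by
    rw [← LinearMap.toAddMonoidHom_coe, AddMonoidHom.map_finsum _ (braCurrent_finite' hm u)]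
    exact finsum_congr fun i => by simp
  have hf1 : (Function.support fun i : ℤ => ((1 / 4 : K) * (-1) ^ i) •
      braMul (φ n) (braMul (φ i) (braMul (φ (-i - m)) u))).Finite := by
    refine (braCurrent_finite' hm u).subset fun i hi hc => hi ?_
    simp only at hc ⊢
    rw [← map_smul, hc, map_zero]
  rw [h1, ← finsum_sub_distrib hf1 (braCurrent_finite' hm _)]
  -- Commuting `φ_n` past the quadratic term leaves two contractions, one with each factor. They are
  -- nonzero only at `i = -n` and `i = n - m`, and each yields one half of `φ_{n-m}`.
  have key : ∀ i : ℤ, ((1 / 4 : K) * (-1) ^ i) • braMul (φ n) (braMul (φ i) (braMul (φ (-i - m)) u)) -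
      ((1 / 4 : K) * (-1) ^ i) • braMul (φ i) (braMul (φ (-i - m)) (braMul (φ n) u)) =
      (if i = -n then (1 / 2 : K) • braMul (φ (n - m)) u else 0) +
      (if i = n - m then (1 / 2 : K) • braMul (φ (n - m)) u else 0) := by
    intro i
    have e1 := braMul_φ_anticomm i n (braMul (φ (-i - m)) u)
    have e2 := braMul_φ_anticomm (-i - m) n u
    have e3 : braMul (φ n) (braMul (φ i) (braMul (φ (-i - m)) u)) -
        braMul (φ i) (braMul (φ (-i - m)) (braMul (φ n) u)) =
        (if i + n = 0 then 2 * (-1 : K) ^ i else 0) • braMul (φ (-i - m)) u -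
        (if -i - m + n = 0 then 2 * (-1 : K) ^ (-i - m) else 0) • braMul (φ i) u := by
      rw [← e1, ← map_smul, ← e2, map_add]; abel
    rw [← smul_sub, e3, smul_sub, smul_smul, smul_smul]
    have hs := neg_one_zpow_sq i
    have hs2 : (-1 : K) ^ (-i - m) = -(-1) ^ i := by
      rw [neg_one_zpow_odd_sub hm, neg_one_zpow_neg]
    rw [hs2, sub_eq_add_neg, ← neg_smul]
    congr 1
    · by_cases h : i = -n
      · subst h
        rw [if_pos rfl, if_pos (by omega), neg_neg]
        congr 1
        linear_combination (1 / 2 : K) * hs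
      · rw [if_neg h, if_neg (by omega), mul_zero, zero_smul]
    · by_cases h : i = n - m
      · subst h
        rw [if_pos rfl, if_pos (by omega)]
        congr 1
        linear_combination (1 / 2 : K) * hs
      · rw [if_neg h, if_neg (by omega), mul_zero, neg_zero, zero_smul]
  rw [finsum_congr key, finsum_add_distrib, finsum_eq_single _ (-n), finsum_eq_single _ (n - m),
    if_pos rfl, if_pos rfl, ← add_smul]
  · norm_num
  · intro i hi; rw [if_neg hi]
  · intro i hi; rw [if_neg hi]
  · refine (Set.finite_singleton (-n)).subset fun i hi => ?_
    by_contra hc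
    exact hi (if_neg hc)
  · refine (Set.finite_singleton (n - m)).subset fun i hi => ?_
    by_contra hc
    exact hi (if_neg hc)

theorem bra0_mem_braFil : bra0 ∈ braFil 0 :=
  Submodule.subset_span ⟨[], by simp, by simp [word, bra0]⟩

theorem bra0_current {m : ℤ} (hm : m < 0) : braCurrent m bra0 = 0 :=
  braFil_eq_zero (braFil_current m bra0_mem_braFil) (by omega)

/-- In every summand of `b_m` with `m > 0` at least one of the two modes is negative, and the two
modes anticommute, so the negative one can be placed last, where `ℓ` kills it. The functional is
kept general because the argument is used both for `braVac` and for its twist by the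
anti-involution. -/
theorem vac_current {ℓ : Module.Dual K Bra} (hℓ : ∀ n : ℤ, n < 0 → ∀ u, ℓ (braMul (φ n) u) = 0)
    {m : ℤ} (hm : 0 < m) (u : Bra) : ℓ (braCurrent m u) = 0 := by
  unfold braCurrent
  split_ifs with ho
  · rw [map_lfSum]
    refine finsum_eq_zero_of_forall_eq_zero fun i => ?_
    rw [LinearMap.smul_apply, map_smul]
    have : ℓ (braMul (φ (-i - m) * φ i) u) = 0 := by
      by_cases hi : i < 0
      · rw [braMul_mul, hℓ i hi]
      · rw [φ_swap (by omega), braMul_neg, braMul_mul, map_neg, hℓ _ (by omega), neg_zero]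
    rw [this, smul_zero]
  · simp

theorem braVac_current {m : ℤ} (hm : 0 < m) (u : Bra) : braVac (braCurrent m u) = 0 :=
  vac_current (fun _ => braVac_φ) hm u

/-- Operators on the dual Fock space commuting with the action of the algebra are determined by
their value at the vacuum. -/
theorem eq_of_comm {T T' : Bra →ₗ[K] Bra}
    (hT : ∀ n u, T (braMul (φ n) u) = braMul (φ n) (T u))
    (hT' : ∀ n u, T' (braMul (φ n) u) = braMul (φ n) (T' u)) (h0 : T bra0 = T' bra0) : T = T' := by
  ext1
  ext X
  simp only [LinearMap.comp_apply]
  induction X using CliffordAlgebra.right_induction with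
  | algebraMap r =>
    rw [Algebra.algebraMap_eq_smul_one, map_smul, map_smul, map_smul]
    exact congrArg _ h0
  | add x y hx hy => simp only [map_add, hx, hy]
  | mul_ι v x hx =>
    induction v using Finsupp.induction_linear with
    | zero => simp
    | add f g hf hg => simp only [map_add, mul_add, hf, hg]
    | single k a =>
      have e : braNull.mkQ (x * CliffordAlgebra.ι Q (Finsupp.single k a)) =
          a • braMul (φ k) (braNull.mkQ x) := by
        have : Finsupp.single k a = a • Finsupp.single k (1 : K) := by simp
        rw [this, map_smul, mul_smul_comm, map_smul]
        rfl
      rw [e, map_smul, map_smul, hT, hT', hx]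

theorem braCurrent_mul_φ {m : ℤ} (hm : Odd m) (n : ℤ) (u : Bra) :
    braCurrent m (braMul (φ n) u) = braMul (φ n) (braCurrent m u) - braMul (φ (n - m)) u := by
  rw [braMul_φ_current hm, add_sub_cancel_right]

/-- The currents act on the modes by index shifts, which commute. The commutator of two currents is
therefore central with respect to the fermions and is determined by its value on the vacuum. -/
theorem commutator_φ {m n : ℤ} (hm : Odd m) (hn : Odd n) (k : ℤ) (u : Bra) :
    (braCurrent n ∘ₗ braCurrent m - braCurrent m ∘ₗ braCurrent n) (braMul (φ k) u) =
      braMul (φ k) ((braCurrent n ∘ₗ braCurrent m - braCurrent m ∘ₗ braCurrent n) u) := by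
  simp only [LinearMap.sub_apply, LinearMap.comp_apply, braCurrent_mul_φ hm, braCurrent_mul_φ hn,
    map_sub]
  rw [show k - m - n = k - n - m by ring]
  abel

theorem braMul_pair_finite {p : ℤ} (hp : p ≠ 0) (u : Bra) :
    (Function.support fun i : ℤ =>
      ((1 / 4 : K) * (-1) ^ i) • braMul (φ i) (braMul (φ (-i - p)) u)).Finite := by
  obtain ⟨d, hd⟩ := exists_braFil u
  refine (Set.finite_Icc (-p - d) (d : ℤ)).subset fun i hi => ?_
  by_contra hc
  apply hi
  rw [Set.mem_Icc, not_and_or, not_le, not_le] at hc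
  rcases hc with h | h
  · simp only [braFil_eq_zero (braFil_φ (-i - p) hd) (by omega), map_zero, smul_zero]
  · have e := braMul_φ_anticomm i (-i - p) u
    rw [if_neg (by omega), zero_smul, braFil_eq_zero (braFil_φ i hd) (by omega), map_zero,
      zero_add] at e
    simp only [e, smul_zero]

/-- The commutator of two currents as a sum of differences. -/
theorem commutator_eq_finsum {m n : ℤ} (hm : Odd m) (hn : Odd n) (u : Bra) :
    (braCurrent n ∘ₗ braCurrent m - braCurrent m ∘ₗ braCurrent n) u =
      ∑ᶠ i : ℤ, (((1 / 4 : K) * (-1) ^ i) • braMul (φ i) (braMul (φ (-i - (m + n))) u) -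
        ((1 / 4 : K) * (-1) ^ (i - m)) •
          braMul (φ (i - m)) (braMul (φ (-(i - m) - (m + n))) u)) := by
  rw [LinearMap.sub_apply, LinearMap.comp_apply, LinearMap.comp_apply]
  rw [braCurrent_apply hn (braCurrent m u)]
  have h1 : braCurrent m (braCurrent n u) = ∑ᶠ i : ℤ, braCurrent m (((1 / 4 : K) * (-1) ^ i) •
      braMul (φ i) (braMul (φ (-i - n)) u)) := by
    rw [braCurrent_apply hn u, ← LinearMap.toAddMonoidHom_coe,
      AddMonoidHom.map_finsum _ (braCurrent_finite' hn u)]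
  have hf1 : (Function.support fun i : ℤ => braCurrent m (((1 / 4 : K) * (-1) ^ i) •
      braMul (φ i) (braMul (φ (-i - n)) u))).Finite := by
    refine (braCurrent_finite' hn u).subset fun i hi hc => hi ?_
    simp only at hc ⊢
    rw [hc, map_zero]
  rw [h1, ← finsum_sub_distrib (braCurrent_finite' hn _) hf1]
  refine finsum_congr fun i => ?_
  rw [map_smul, braMul_φ_current hm, map_add, braMul_φ_current hm, neg_one_zpow_odd_sub hm,
    show -i - n - m = -i - (m + n) by ring, show -(i - m) - (m + n) = -i - n by ring]
  simp only [smul_add, mul_neg, neg_smul, sub_neg_eq_add]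
  abel

/-- The commutator is a sum of differences of one family at `i` and at `i - m`. When `m + n ≠ 0` the
family is locally finite by itself, so the two halves may be summed separately and cancel after a
shift of the index. When `m + n = 0` this separation fails, which is the origin of the central term.
-/
theorem braCurrent_comm {m n : ℤ} (hm : Odd m) (hn : Odd n) (h : m + n ≠ 0) (u : Bra) :
    braCurrent n (braCurrent m u) = braCurrent m (braCurrent n u) := by
  refine sub_eq_zero.mp ((commutator_eq_finsum hm hn u).trans ?_)
  have hf := braMul_pair_finite h u
  have hf2 : (Function.support fun i : ℤ => ((1 / 4 : K) * (-1) ^ (i - m)) •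
      braMul (φ (i - m)) (braMul (φ (-(i - m) - (m + n))) u)).Finite :=
    hf.preimage (f := fun i : ℤ => i - m) (sub_left_injective.injOn)
  rw [finsum_sub_distrib hf hf2, sub_eq_zero]
  exact (finsum_comp_equiv (Equiv.subRight m) (f := fun i : ℤ => ((1 / 4 : K) * (-1) ^ i) •
      braMul (φ i) (braMul (φ (-i - (m + n))) u))).symm

theorem bra0_φ_neg_φ (i : ℤ) : ((1 / 4 : K) * (-1) ^ i) • braMul (φ i) (braMul (φ (-i)) bra0) =
    (if i < 0 then (0 : K) else if i = 0 then 1 / 4 else 1 / 2) • bra0 := by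
  rcases lt_trichotomy i 0 with h | h | h
  · rw [if_pos h, bra0_φ (by omega), map_zero, smul_zero, zero_smul]
  · subst h
    rw [if_neg (lt_irrefl _), if_pos rfl, neg_zero, ← braMul_mul, φ_zero_sq, ← map_one
      (algebraMap K A), braMul_algebraMap]
    simp
  · rw [if_neg (by omega), if_neg (by omega)]
    have e := braMul_φ_anticomm (-i) i bra0
    rw [if_pos (by omega), bra0_φ h, map_zero, add_zero, neg_one_zpow_neg] at e
    rw [e, smul_smul]
    congr 1
    linear_combination (1 / 2 : K) * neg_one_zpow_sq i

/-- `[b_k, b_{-k}] = k / 2`. -/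
theorem braCurrent_heisenberg {k : ℕ} (hk : Odd k) (u : Bra) :
    braCurrent (-(k : ℤ)) (braCurrent k u) =
      braCurrent k (braCurrent (-(k : ℤ)) u) + ((k : K) / 2) • u := by
  have ho : Odd (k : ℤ) := by exact_mod_cast hk
  have key : braCurrent (-(k : ℤ)) ∘ₗ braCurrent k - braCurrent k ∘ₗ braCurrent (-(k : ℤ)) =
      ((k : K) / 2) • LinearMap.id := by
    refine eq_of_comm (commutator_φ ho ho.neg) (fun n u => by simp) ?_
    rw [commutator_eq_finsum ho ho.neg]
    have e : ∀ i : ℤ, (((1 / 4 : K) * (-1) ^ i) •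
        braMul (φ i) (braMul (φ (-i - (k + -(k : ℤ)))) bra0) -
        ((1 / 4 : K) * (-1) ^ (i - k)) •
          braMul (φ (i - k)) (braMul (φ (-(i - k) - (k + -(k : ℤ)))) bra0)) =
        ((if i < 0 then (0 : K) else if i = 0 then 1 / 4 else 1 / 2) -
          (if i - k < 0 then (0 : K) else if i - k = 0 then 1 / 4 else 1 / 2)) • bra0 := by
      intro i
      rw [add_neg_cancel, sub_zero, sub_zero, bra0_φ_neg_φ, bra0_φ_neg_φ, sub_smul]
    rw [finsum_congr e, finsum_eq_sum_of_support_subset (s := (Finset.range (k + 1)).map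
      ⟨fun n : ℕ => (n : ℤ), Nat.cast_injective⟩)]
    · rw [Finset.sum_map, ← Finset.sum_smul]
      congr 1
      -- The surviving coefficients are `1/4` at `i = 0`, `1/2` at the `p = k - 1` interior indices
      -- and `1/4` at `i = k`, in total `k/2`.
      obtain ⟨p, rfl⟩ : ∃ p, k = p + 1 := ⟨k - 1, by have := hk.pos; omega⟩
      rw [Finset.sum_range_succ, Finset.sum_range_succ']
      have h1 : ∀ i ∈ Finset.range p, (((if ((i + 1 : ℕ) : ℤ) < 0 then (0 : K) else
          if ((i + 1 : ℕ) : ℤ) = 0 then 1 / 4 else 1 / 2) -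
          (if ((i + 1 : ℕ) : ℤ) - (p + 1 : ℕ) < 0 then (0 : K) else
            if ((i + 1 : ℕ) : ℤ) - (p + 1 : ℕ) = 0 then 1 / 4 else 1 / 2))) = 1 / 2 := by
        intro i hi
        rw [Finset.mem_range] at hi
        rw [if_neg (by omega), if_neg (by omega), if_pos (by push_cast; omega), sub_zero]
      simp only [Function.Embedding.coeFn_mk]
      rw [Finset.sum_congr rfl h1, if_neg (by omega), if_pos (by simp), if_pos (by push_cast; omega),
        if_neg (by omega), if_neg (by omega), if_neg (by omega), if_pos (by omega)]
      simp only [Finset.sum_const, Finset.card_range, nsmul_eq_mul]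
      push_cast
      ring
    · intro i hi
      by_contra hc
      simp only [Finset.coe_map, Function.Embedding.coeFn_mk, Finset.coe_range, Set.mem_image,
        Set.mem_Iio, not_exists, not_and] at hc
      apply hi
      simp only
      by_cases h0 : i < 0
      · rw [if_pos h0, if_pos (by omega), sub_zero, zero_smul]
      · have := hc i.toNat
        rw [if_neg h0, if_neg (by omega), if_neg (by omega), if_neg (by omega), sub_self,
          zero_smul]
  have := LinearMap.congr_fun key u
  rw [LinearMap.sub_apply, LinearMap.comp_apply, LinearMap.comp_apply, LinearMap.smul_apply,
    LinearMap.id_apply, sub_eq_iff_eq_add'] at this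
  exact this

theorem braVac_bra0 : braVac bra0 = 1 := vev_one

/-! ### Polynomials in the currents -/

open scoped IsMulCommutative in
/-- A commuting family in an algebra extends to a homomorphism from the polynomial algebra. -/
theorem exists_algHom_of_commute {ι E : Type} [Ring E] [Algebra K E] (x : ι → E)
    (hx : ∀ i j, x i * x j = x j * x i) :
    ∃ ρ : MvPolynomial ι K →ₐ[K] E, ∀ i, ρ (MvPolynomial.X i) = x i := by
  have := Algebra.isMulCommutative_adjoin K (s := Set.range x) (by
    rintro _ ⟨i, rfl⟩ _ ⟨j, rfl⟩
    exact hx i j)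
  refine ⟨(Algebra.adjoin K (Set.range x)).val.comp (MvPolynomial.aeval fun i =>
    (⟨x i, Algebra.subset_adjoin ⟨i, rfl⟩⟩ : Algebra.adjoin K (Set.range x))), fun i => ?_⟩
  simp

theorem oddNat_cast (j : OddNat) : Odd ((j : ℕ) : ℤ) := by exact_mod_cast j.2

theorem creation_comm (i j : OddNat) :
    (braCurrent ((i : ℕ) : ℤ) : Module.End K Bra) * braCurrent ((j : ℕ) : ℤ) =
      braCurrent ((j : ℕ) : ℤ) * braCurrent ((i : ℕ) : ℤ) :=
  LinearMap.ext fun u => braCurrent_comm (oddNat_cast j) (oddNat_cast i)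
    (by have := i.2.pos; omega) u

theorem annihilation_comm (i j : OddNat) :
    (braCurrent (-((i : ℕ) : ℤ)) : Module.End K Bra) * braCurrent (-((j : ℕ) : ℤ)) =
      braCurrent (-((j : ℕ) : ℤ)) * braCurrent (-((i : ℕ) : ℤ)) :=
  LinearMap.ext fun u => braCurrent_comm (oddNat_cast j).neg (oddNat_cast i).neg
    (by have := i.2.pos; omega) u

/-- Polynomials in the creation operators `b_j`, `j > 0`, of the dual Fock space. -/
def creation : MvPolynomial OddNat K →ₐ[K] Module.End K Bra :=
  (exists_algHom_of_commute _ creation_comm).choose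

theorem creation_X (j : OddNat) : creation (MvPolynomial.X j) = braCurrent ((j : ℕ) : ℤ) :=
  (exists_algHom_of_commute _ creation_comm).choose_spec j

/-- Polynomials in the annihilation operators `b_{-j}`, `j > 0`, of the dual Fock space. -/
def annihilation : MvPolynomial OddNat K →ₐ[K] Module.End K Bra :=
  (exists_algHom_of_commute _ annihilation_comm).choose

theorem annihilation_X (j : OddNat) :
    annihilation (MvPolynomial.X j) = braCurrent (-((j : ℕ) : ℤ)) :=
  (exists_algHom_of_commute _ annihilation_comm).choose_spec j

/-- By the Heisenberg relation, and because `b_{-j}` kills the vacuum, `b_{-j}` acts on polynomials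
in the creation operators as `(j/2) ∂/∂b_j`. -/
theorem annihilation_creation (j : OddNat) (p : MvPolynomial OddNat K) :
    braCurrent (-((j : ℕ) : ℤ)) (creation p bra0) =
      (((j : ℕ) : K) / 2) • creation (MvPolynomial.pderiv j p) bra0 := by
  classical
  induction p using MvPolynomial.induction_on with
  | C a =>
    rw [MvPolynomial.pderiv_C, ← MvPolynomial.algebraMap_eq, AlgHom.commutes,
      Module.algebraMap_end_apply, map_smul, bra0_current (by have := j.2.pos; omega)]
    simp
  | add p q hp hq => simp only [map_add, LinearMap.add_apply, hp, hq, smul_add]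
  | mul_X p i hp =>
    rw [Derivation.leibniz, MvPolynomial.pderiv_X, mul_comm p, map_mul, Module.End.mul_apply,
      creation_X, smul_eq_mul, smul_eq_mul, map_add, LinearMap.add_apply, map_mul, map_mul,
      Module.End.mul_apply, Module.End.mul_apply, creation_X]
    by_cases hij : j = i
    · subst hij
      rw [braCurrent_heisenberg j.2, hp, map_smul, Pi.single_eq_same, map_one,
        Module.End.one_apply, smul_add, add_comm]
    · rw [braCurrent_comm (oddNat_cast i) (oddNat_cast j).neg
        (by intro h; exact hij (Subtype.ext (by omega))), hp, map_smul,
        Pi.single_eq_of_ne (Ne.symm hij)]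
      simp

/-! ### Orthogonality -/

/-- Induction on multisets of odd numbers. -/
theorem multiset_induction {ι : Type} {P : (ι →₀ ℕ) → Prop} (h0 : P 0)
    (hs : ∀ M j, P M → P (M + Finsupp.single j 1)) (M : ι →₀ ℕ) : P M := by
  classical
  induction hd : M.degree generalizing M with
  | zero => rwa [(Finsupp.degree_eq_zero_iff M).mp hd]
  | succ n ih =>
    obtain ⟨j, hj⟩ : ∃ j, M j ≠ 0 := by
      by_contra! hc
      have : M = 0 := Finsupp.ext hc
      rw [this, map_zero] at hd
      omega
    have e : M = (M - Finsupp.single j 1) + Finsupp.single j 1 := by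
      ext i
      by_cases hi : j = i
      · subst hi; simp; omega
      · simp [hi]
    rw [e]
    refine hs _ _ (ih _ ?_)
    have h2 := congrArg Finsupp.degree e
    rw [map_add, Finsupp.degree_single, hd] at h2
    omega

/-- The weight `∏_j (2/j)^{m_j} / m_j!` of a monomial in the exponential of
`2 ∑_j p_j b_j / j`. -/
def expWeight (M : OddNat →₀ ℕ) : K := M.prod fun j e => (2 / ((j : ℕ) : K)) ^ e / (e.factorial : K)

theorem oddNat_cast_ne_zero (j : OddNat) : ((j : ℕ) : K) ≠ 0 := Nat.cast_ne_zero.mpr j.2.pos.ne'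

theorem expWeight_ne_zero (M : OddNat →₀ ℕ) : expWeight M ≠ 0 := by
  refine Finset.prod_ne_zero_iff.mpr fun j _ => ?_
  exact div_ne_zero (pow_ne_zero _ (div_ne_zero two_ne_zero (oddNat_cast_ne_zero j)))
    (Nat.cast_ne_zero.mpr (Nat.factorial_ne_zero _))

theorem expWeight_zero : expWeight 0 = 1 := Finsupp.prod_zero_index

theorem expWeight_add_single (M : OddNat →₀ ℕ) (j : OddNat) :
    expWeight (M + Finsupp.single j 1) * (M j + 1) = expWeight M * (2 / ((j : ℕ) : K)) := by
  classical
  have h : ∀ N : OddNat →₀ ℕ, N.support ⊆ insert j M.support →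
      expWeight N = (2 / ((j : ℕ) : K)) ^ N j / ((N j).factorial : K) *
        ∏ i ∈ M.support.erase j, (2 / ((i : ℕ) : K)) ^ N i / ((N i).factorial : K) := by
    intro N hN
    rw [expWeight, Finsupp.prod_of_support_subset _ hN _ (by simp),
      ← Finset.mul_prod_erase _ _ (Finset.mem_insert_self j _), Finset.erase_insert_eq_erase]
  rw [h M (Finset.subset_insert _ _), h (M + Finsupp.single j 1)]
  · have e : ∏ i ∈ M.support.erase j, (2 / ((i : ℕ) : K)) ^ (M + Finsupp.single j 1 : OddNat →₀ ℕ) i /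
        (((M + Finsupp.single j 1 : OddNat →₀ ℕ) i).factorial : K) =
        ∏ i ∈ M.support.erase j, (2 / ((i : ℕ) : K)) ^ M i / ((M i).factorial : K) := by
      refine Finset.prod_congr rfl fun i hi => ?_
      rw [Finsupp.add_apply, Finsupp.single_eq_of_ne (Finset.ne_of_mem_erase hi), add_zero]
    rw [e, Finsupp.add_apply, Finsupp.single_eq_same, Nat.factorial_succ, pow_succ]
    have h1 : ((M j).factorial : K) ≠ 0 := Nat.cast_ne_zero.mpr (Nat.factorial_ne_zero _)
    have h2 : (M j + 1 : K) ≠ 0 := by exact_mod_cast Nat.succ_ne_zero (M j)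
    push_cast
    field_simp
  · intro i hi
    rw [Finsupp.mem_support_iff, Finsupp.add_apply] at hi
    rw [Finset.mem_insert, Finsupp.mem_support_iff]
    by_contra! hc
    rw [Finsupp.single_eq_of_ne hc.1, hc.2] at hi
    exact hi rfl

theorem vac_creation {ℓ : Module.Dual K Bra} (hℓ : ∀ n : ℤ, n < 0 → ∀ u, ℓ (braMul (φ n) u) = 0)
    (h1 : ℓ bra0 = 1) (p : MvPolynomial OddNat K) :
    ℓ (creation p bra0) = MvPolynomial.coeff 0 p := by
  induction p using MvPolynomial.induction_on with
  | C a =>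
    rw [← MvPolynomial.algebraMap_eq, AlgHom.commutes, Module.algebraMap_end_apply, map_smul,
      h1, MvPolynomial.algebraMap_eq, MvPolynomial.coeff_zero_C, smul_eq_mul, mul_one]
  | add p q hp hq => simp only [map_add, LinearMap.add_apply, hp, hq, MvPolynomial.coeff_add]
  | mul_X p i hp =>
    rw [mul_comm, map_mul, Module.End.mul_apply, creation_X, vac_current hℓ
      (by have := i.2.pos; omega), mul_comm, MvPolynomial.coeff_mul_X']
    simp

theorem braVac_creation (p : MvPolynomial OddNat K) :
    braVac (creation p bra0) = MvPolynomial.coeff 0 p :=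
  vac_creation (fun _ => braVac_φ) braVac_bra0 p

/-- The monomials in the creation operators are dual to those in the annihilation operators. -/
theorem braVac_annihilation_creation (M : OddNat →₀ ℕ) (p : MvPolynomial OddNat K) :
    expWeight M * braVac (annihilation (MvPolynomial.monomial M 1) (creation p bra0)) =
      MvPolynomial.coeff M p := by
  classical
  induction M using multiset_induction generalizing p with
  | h0 =>
    have : MvPolynomial.monomial (0 : OddNat →₀ ℕ) (1 : K) = 1 := rfl
    rw [this, map_one, Module.End.one_apply, braVac_creation, expWeight_zero, one_mul]
  | hs M j ih =>
    have e : MvPolynomial.monomial (M + Finsupp.single j 1) (1 : K) =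
        MvPolynomial.monomial M 1 * MvPolynomial.X j := by
      rw [MvPolynomial.X, MvPolynomial.monomial_mul, one_mul]
    have hj := oddNat_cast_ne_zero j
    have h2 : (M j + 1 : K) ≠ 0 := by exact_mod_cast Nat.succ_ne_zero (M j)
    have h3 := expWeight_add_single M j
    rw [e, map_mul, Module.End.mul_apply, annihilation_X, annihilation_creation, map_smul, map_smul,
      smul_eq_mul]
    have h4 := ih (MvPolynomial.pderiv j p)
    rw [MvPolynomial.coeff_pderiv] at h4
    have h5 : expWeight M = expWeight (M + Finsupp.single j 1) * (M j + 1) * (((j : ℕ) : K) / 2) := by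
      rw [h3]; field_simp
    rw [h5] at h4
    apply mul_right_cancel₀ h2
    linear_combination h4

end KFermion

end

/-! ### Bosonization of the even dual Fock space by counting partitions. -/

noncomputable section

namespace KFermion

/-! ### Reordering of words -/

/-- The span of the words that are shorter than `n`, have the parity of `n` and sum `s`. -/
def shortWords (n : ℕ) (s : ℤ) : Submodule K A :=
  Submodule.span K {X | ∃ w : List ℤ, w.length < n ∧ w.length % 2 = n % 2 ∧ w.sum = s ∧ X = word w}

theorem word_cons (a : ℤ) (l : List ℤ) : word (a :: l) = φ a * word l := by simp [word]

theorem φ_mul_shortWords (a : ℤ) {n : ℕ} {s : ℤ} {X : A} (hX : X ∈ shortWords n s) :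
    φ a * X ∈ shortWords (n + 1) (a + s) := by
  suffices h : shortWords n s ≤ (shortWords (n + 1) (a + s)).comap (LinearMap.mulLeft K (φ a)) from
    h hX
  refine Submodule.span_le.mpr ?_
  rintro _ ⟨w, h1, h2, h3, rfl⟩
  exact Submodule.subset_span ⟨a :: w, by simp; omega, by simp; omega, by simp [h3],
    (word_cons a w).symm⟩

/-- An adjacent transposition changes the sign and creates a contraction, which is two letters
shorter and has the same sum. Only spans matter later, so the sign `ε` is left unspecified. -/
theorem word_perm {w w' : List ℤ} (h : w.Perm w') :
    ∃ ε : K, word w - ε • word w' ∈ shortWords w.length w.sum := by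
  induction h with
  | nil => exact ⟨1, by simp⟩
  | cons a _ ih =>
    obtain ⟨ε, hε⟩ := ih
    refine ⟨ε, ?_⟩
    rw [word_cons, word_cons, ← mul_smul_comm, ← mul_sub, List.length_cons, List.sum_cons]
    exact φ_mul_shortWords a hε
  | swap a b l =>
    refine ⟨-1, ?_⟩
    have e : word (b :: a :: l) - (-1 : K) • word (a :: b :: l) =
        (if b + a = 0 then 2 * (-1 : K) ^ b else 0) • word l := by
      rw [neg_smul, one_smul, sub_neg_eq_add, word_cons, word_cons, word_cons, word_cons,
        ← mul_assoc, ← mul_assoc, ← add_mul, φ_anticomm, Algebra.smul_def]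
    rw [e]
    split_ifs with h0
    · exact Submodule.smul_mem _ _ (Submodule.subset_span ⟨l, by simp, by simp; omega,
        by simp only [List.sum_cons]; omega, rfl⟩)
    · simp
  | trans h1 _ ih1 ih2 =>
    obtain ⟨ε, hε⟩ := ih1
    obtain ⟨δ, hδ⟩ := ih2
    refine ⟨ε * δ, ?_⟩
    rw [← h1.length_eq, ← h1.sum_eq] at hδ
    have := add_mem hε (Submodule.smul_mem _ ε hδ)
    rwa [smul_sub, smul_smul, sub_add_sub_cancel] at this

/-- The homogeneous component of degree `d` of the even dual Fock space. -/
def braDeg (d : ℕ) : Submodule K Bra :=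
  Submodule.span K {u | ∃ w : List ℤ, Even w.length ∧ w.sum = -d ∧ u = braNull.mkQ (word w)}

/-- The word `⟨0|φ_{-λ_1} ⋯ φ_{-λ_r}`, with an additional `φ_0` if `r` is odd. -/
def partitionWord {d : ℕ} (p : d.Partition) : List ℤ :=
  p.parts.toList.map (fun n : ℕ => -(n : ℤ)) ++ if Even p.parts.card then [] else [0]

theorem exists_perm_partitionWord {d : ℕ} (w : List ℤ) (hw : w.Nodup) (hn : ∀ a ∈ w, a ≤ 0)
    (he : Even w.length) (hs : w.sum = -d) :
    ∃ p ∈ Nat.Partition.distincts d, w.Perm (partitionWord p) := by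
  set v : List ℤ := w.filter (· ≠ 0) with hv
  have hw0 : w.Perm (v ++ w.filter (· = 0)) := by
    have := List.filter_append_perm (fun a : ℤ => decide (a ≠ 0)) w
    simpa [hv] using this.symm
  -- Without repetitions the letter `0` occurs at most once. Since the total length is even, its
  -- presence is dictated by the parity of the number of nonzero letters.
  have hz : w.filter (· = 0) = [] ∨ w.filter (· = 0) = [0] := by
    have h1 : w.filter (· = 0) = List.replicate (w.count 0) 0 := by
      rw [← List.filter_beq]
      rfl
    have h2 := List.nodup_iff_count_le_one.mp hw 0
    rw [h1]
    interval_cases w.count 0 <;> simp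
  have hvs : v.sum = -d := by
    have := hw0.sum_eq
    rw [List.sum_append, hs] at this
    rcases hz with h | h <;> simp [h] at this <;> omega
  have hback : ∀ l : List ℤ, (∀ a ∈ l, a ≤ 0) →
      (l.map fun a => (-a).toNat).map (fun n : ℕ => -(n : ℤ)) = l := by
    intro l hl
    rw [List.map_map]
    conv_rhs => rw [← List.map_id l]
    refine List.map_congr_left fun a ha => ?_
    have := hl a ha
    simp only [Function.comp_apply, id]
    omega
  have hvn : ∀ a ∈ v, a ≤ 0 := fun a ha => hn a (List.mem_of_mem_filter ha)
  refine ⟨⟨((v.map fun a => (-a).toNat : List ℕ) : Multiset ℕ), ?_, ?_⟩, ?_, ?_⟩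
  · intro i hi
    simp only [Multiset.mem_coe, List.mem_map] at hi
    obtain ⟨a, ha, rfl⟩ := hi
    have h1 := hvn a ha
    have h2 : a ≠ 0 := by simpa using (List.mem_filter.mp ha).2
    omega
  · rw [Multiset.sum_coe]
    have h1 := congrArg List.sum (hback v hvn)
    rw [hvs] at h1
    have h2 : ∀ l : List ℕ, (l.map (fun n : ℕ => -(n : ℤ))).sum = -((l.sum : ℕ) : ℤ) := by
      intro l
      induction l with
      | nil => simp
      | cons a l ih => simp only [List.map_cons, List.sum_cons, ih]; push_cast; ring
    rw [h2] at h1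
    omega
  · rw [Nat.Partition.distincts, Finset.mem_filter]
    refine ⟨Finset.mem_univ _, ?_⟩
    rw [Multiset.coe_nodup]
    apply List.Nodup.of_map (fun n : ℕ => -(n : ℤ))
    rw [hback v hvn]
    exact hw.filter _
  · rw [partitionWord]
    refine hw0.trans (List.Perm.append ?_ ?_)
    · have h1 : (v.map fun a => (-a).toNat).Perm
          (((v.map fun a => (-a).toNat : List ℕ) : Multiset ℕ)).toList :=
        Multiset.coe_eq_coe.mp (Multiset.coe_toList _).symm
      have h2 := h1.map (fun n : ℕ => -(n : ℤ))
      rwa [hback v hvn] at h2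
    · have hl := hw0.length_eq
      rw [List.length_append] at hl
      simp only [Multiset.coe_card, List.length_map]
      rcases hz with h | h
      · rw [h] at hl ⊢
        rw [if_pos]
        rw [hl] at he
        simpa using he
      · rw [h] at hl ⊢
        rw [if_neg]
        rw [hl] at he
        simp only [List.length_singleton] at he
        rw [Nat.not_even_iff_odd]
        rcases Nat.even_or_odd v.length with h' | h'
        · exact absurd he (by rw [Nat.not_even_iff_odd]; exact h'.add_one)
        · exact h'

/-- Induction on the length, reordering modulo shorter words. A positive letter moved to the front
annihilates the vacuum. A repeated letter brought together squares to `0`, or to `1` if it is `φ_0`,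
which shortens the word. What remains has distinct nonpositive letters, that is, a strict partition
with `φ_0` added when parity demands it. -/
theorem word_mem_partition_span {d : ℕ} (w : List ℤ) (he : Even w.length) (hs : w.sum = -d) :
    braNull.mkQ (word w) ∈ Submodule.span K (Set.range
      fun p : Nat.Partition.distincts d => braNull.mkQ (word (partitionWord p.1))) := by
  set V := Submodule.span K (Set.range
      fun p : Nat.Partition.distincts d => braNull.mkQ (word (partitionWord p.1))) with hV
  induction hN : w.length using Nat.strong_induction_on generalizing w with
  | _ N ih =>
    have hshort : shortWords w.length w.sum ≤ V.comap braNull.mkQ := by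
      refine Submodule.span_le.mpr ?_
      rintro _ ⟨v, h1, h2, h3, rfl⟩
      refine ih v.length (by omega) v ?_ (by rw [h3, hs]) rfl
      rw [Nat.even_iff] at he ⊢
      omega
    have hred : ∀ w' : List ℤ, w.Perm w' → braNull.mkQ (word w') ∈ V →
        braNull.mkQ (word w) ∈ V := by
      intro w' hp h'
      obtain ⟨ε, hε⟩ := word_perm hp
      have h1 : braNull.mkQ (word w - ε • word w') ∈ V := hshort hε
      have := add_mem h1 (Submodule.smul_mem _ ε h')
      rwa [map_sub, map_smul, sub_add_cancel] at this
    by_cases hpos : ∃ m ∈ w, 0 < m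
    · obtain ⟨m, hm, hm0⟩ := hpos
      refine hred _ (List.perm_cons_erase hm) ?_
      have : braNull.mkQ (word (m :: w.erase m)) = 0 := by
        rw [Submodule.mkQ_apply, Submodule.Quotient.mk_eq_zero, word_cons]
        exact Submodule.subset_span ⟨m, hm0, _, rfl⟩
      rw [this]
      exact V.zero_mem
    · push Not at hpos
      by_cases hnd : w.Nodup
      · obtain ⟨p, hp, hperm⟩ := exists_perm_partitionWord w hnd hpos he hs
        exact hred _ hperm (Submodule.subset_span ⟨⟨p, hp⟩, rfl⟩)
      · obtain ⟨a, ha⟩ : ∃ a, 1 < w.count a := by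
          by_contra! hc
          exact hnd (List.nodup_iff_count_le_one.mpr hc)
        have h1 : a ∈ w := List.count_pos_iff.mp (by omega)
        have h2 : a ∈ w.erase a := List.count_pos_iff.mp (by rw [List.count_erase_self]; omega)
        have hp : w.Perm (a :: a :: (w.erase a).erase a) :=
          (List.perm_cons_erase h1).trans ((List.perm_cons_erase h2).cons a)
        refine hred _ hp ?_
        have hlen := hp.length_eq
        have hsum := hp.sum_eq
        simp only [List.length_cons, List.sum_cons] at hlen hsum
        rw [word_cons, word_cons, ← mul_assoc]
        by_cases ha0 : a = 0
        · subst ha0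
          rw [φ_zero_sq, one_mul]
          refine ih _ (by omega) _ ?_ (by omega) rfl
          rw [Nat.even_iff] at he ⊢
          omega
        · have : φ a * φ a = 0 := by
            have h3 : (2 : K) • (φ a * φ a) = 0 := by
              rw [two_smul, φ_anticomm, if_neg (by omega), map_zero]
            exact (smul_eq_zero.mp h3).resolve_left two_ne_zero
          rw [this, zero_mul, map_zero]
          exact V.zero_mem

/-! ### The currents generate the even dual Fock space from the vacuum -/

theorem braDeg_current {m d : ℕ} {u : Bra} (hu : u ∈ braDeg d) :
    braCurrent m u ∈ braDeg (m + d) := by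
  unfold braCurrent
  split_ifs with hm
  · refine lfSum_mem _ _ fun i => Submodule.smul_mem _ _ ?_
    suffices h : braDeg d ≤ (braDeg (m + d)).comap (braMul (φ (-i - m) * φ i)) from h hu
    refine Submodule.span_le.mpr ?_
    rintro _ ⟨w, h1, h2, rfl⟩
    refine Submodule.subset_span ⟨w ++ [-i - m, i], ?_, ?_, ?_⟩
    · simpa [Nat.even_add] using h1
    · simp only [List.sum_append, h2, List.sum_cons, List.sum_nil]; push_cast; ring
    · rw [braMul_mk]
      simp [word]
  · simp

theorem creation_mem_braDeg (s : Multiset OddNat) :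
    creation (MvPolynomial.monomial (Multiset.toFinsupp s) 1) bra0 ∈
      braDeg (s.map Subtype.val).sum := by
  induction s using Multiset.induction with
  | empty =>
    have : MvPolynomial.monomial (Multiset.toFinsupp (0 : Multiset OddNat)) (1 : K) = 1 := by
      rw [map_zero]; rfl
    rw [this, map_one, Module.End.one_apply]
    exact Submodule.subset_span ⟨[], by simp, by simp, by simp [word, bra0]⟩
  | cons j s ih =>
    have : MvPolynomial.monomial (Multiset.toFinsupp (j ::ₘ s)) (1 : K) =
        MvPolynomial.X j * MvPolynomial.monomial (Multiset.toFinsupp s) 1 := by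
      rw [← Multiset.singleton_add, map_add, Multiset.toFinsupp_singleton, MvPolynomial.X,
        MvPolynomial.monomial_mul, one_mul]
    rw [this, map_mul, Module.End.mul_apply, creation_X, Multiset.map_cons, Multiset.sum_cons]
    exact braDeg_current ih

/-- The functionals obtained from the monomials in the annihilation operators form, after rescaling
by `expWeight`, a dual system. -/
theorem linearIndependent_creation : LinearIndependent K
    fun M : OddNat →₀ ℕ => creation (MvPolynomial.monomial M 1) bra0 := by
  classical
  rw [linearIndependent_iff]
  intro l hl
  ext M
  have h := congrArg (fun u => expWeight M * braVac (annihilation (MvPolynomial.monomial M 1) u)) hl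
  simp only [Finsupp.linearCombination_apply, Finsupp.sum, map_sum, map_smul, map_zero,
    mul_zero, Finset.mul_sum, smul_eq_mul] at h
  rw [Finset.sum_congr rfl (fun N _ => by rw [mul_left_comm, braVac_annihilation_creation,
    MvPolynomial.coeff_monomial])] at h
  simpa using h

/-- A dimension count. The span `V` of the words of strict partitions of `d` has at most as many
generators as there are partitions of `d` into distinct parts. It contains the independent current
monomials indexed by partitions of `d` into odd parts. Euler's theorem makes the two numbers equal,
so the current monomials span `V`. -/
theorem braDeg_le_creation (d : ℕ) : braDeg d ≤ Submodule.span K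
    (Set.range fun M : OddNat →₀ ℕ => creation (MvPolynomial.monomial M 1) bra0) := by
  classical
  set V := Submodule.span K (Set.range
      fun p : Nat.Partition.distincts d => braNull.mkQ (word (partitionWord p.1))) with hV
  have hle : braDeg d ≤ V := by
    refine Submodule.span_le.mpr ?_
    rintro _ ⟨w, h1, h2, rfl⟩
    exact word_mem_partition_span w h1 h2
  have hodd : ∀ p : Nat.Partition.odds d, ∀ n ∈ p.1.parts, Odd n := by
    intro p n hn
    exact Nat.not_even_iff_odd.mp ((Finset.mem_filter.mp p.2).2 n hn)
  let ms : Nat.Partition.odds d → Multiset OddNat := fun p =>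
    p.1.parts.pmap (fun n h => (⟨n, h⟩ : OddNat)) (hodd p)
  have hms : ∀ p, (ms p).map Subtype.val = p.1.parts := by
    intro p
    rw [Multiset.map_pmap, Multiset.pmap_eq_map, Multiset.map_id']
  let c : Nat.Partition.odds d → Bra := fun p =>
    creation (MvPolynomial.monomial (Multiset.toFinsupp (ms p)) 1) bra0
  have hcV : ∀ p, c p ∈ V := by
    intro p
    have := creation_mem_braDeg (ms p)
    rw [hms, p.1.parts_sum] at this
    exact hle this
  have hci : LinearIndependent K c := by
    refine linearIndependent_creation.comp (fun p => Multiset.toFinsupp (ms p)) ?_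
    intro p q hpq
    have := congrArg (Multiset.map Subtype.val) (Multiset.toFinsupp.injective hpq)
    rw [hms, hms] at this
    exact Subtype.ext (Nat.Partition.ext this)
  have hfin : FiniteDimensional K V := FiniteDimensional.span_of_finite K (Set.finite_range _)
  have hspan : Submodule.span K (Set.range c) = V := by
    refine Submodule.eq_of_le_of_finrank_le (Submodule.span_le.mpr ?_) ?_
    · rintro _ ⟨p, rfl⟩
      exact hcV p
    · rw [finrank_span_eq_card hci]
      refine (finrank_range_le_card _).trans ?_
      rw [Fintype.card_coe, Fintype.card_coe, Nat.Partition.card_odds_eq_card_distincts]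
  refine hle.trans (hspan.symm.le.trans (Submodule.span_mono ?_))
  rintro _ ⟨p, rfl⟩
  exact ⟨_, rfl⟩

theorem evenOdd_le_words : CliffordAlgebra.evenOdd Q 0 ≤
    Submodule.span K {X | ∃ w : List ℤ, Even w.length ∧ X = word w} := by
  set W := Submodule.span K {X | ∃ w : List ℤ, Even w.length ∧ X = word w} with hW
  intro X hX
  induction X, hX using CliffordAlgebra.even_induction with
  | algebraMap r =>
    rw [Algebra.algebraMap_eq_smul_one]
    exact Submodule.smul_mem _ _ (Submodule.subset_span ⟨[], by simp, by simp [word]⟩)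
  | add x y hx hy ihx ihy => exact add_mem ihx ihy
  | ι_mul_ι_mul m₁ m₂ x hx ih =>
    induction m₁ using Finsupp.induction_linear with
    | zero => simp
    | add f g hf hg => simp only [map_add, add_mul]; exact add_mem hf hg
    | single a r =>
      induction m₂ using Finsupp.induction_linear with
      | zero => simp
      | add f g hf hg => simp only [map_add, add_mul, mul_add]; exact add_mem hf hg
      | single b s =>
        have ea : CliffordAlgebra.ι Q (Finsupp.single a r) = r • φ a := by
          rw [φ, ← map_smul, Finsupp.smul_single, smul_eq_mul, mul_one]
        have eb : CliffordAlgebra.ι Q (Finsupp.single b s) = s • φ b := by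
          rw [φ, ← map_smul, Finsupp.smul_single, smul_eq_mul, mul_one]
        rw [ea, eb, smul_mul_assoc, smul_mul_assoc, mul_smul_comm, smul_mul_assoc]
        refine Submodule.smul_mem _ _ (Submodule.smul_mem _ _ ?_)
        suffices h : W ≤ W.comap (LinearMap.mulLeft K (φ a * φ b)) from h ih
        refine Submodule.span_le.mpr ?_
        rintro _ ⟨w, h1, rfl⟩
        refine Submodule.subset_span ⟨a :: b :: w, ?_, ?_⟩
        · simpa [Nat.even_add] using h1
        · rw [LinearMap.mulLeft_apply, word_cons, word_cons, mul_assoc]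

theorem exists_creation {u : Bra} (hu : u ∈ braEven) : ∃ p, u = creation p bra0 := by
  set V := Submodule.span K
    (Set.range fun M : OddNat →₀ ℕ => creation (MvPolynomial.monomial M 1) bra0) with hV
  have h1 : u ∈ V := by
    obtain ⟨X, hX, rfl⟩ := hu
    suffices h : Submodule.span K {X | ∃ w : List ℤ, Even w.length ∧ X = word w} ≤
      V.comap braNull.mkQ from h (evenOdd_le_words hX)
    refine Submodule.span_le.mpr ?_
    rintro _ ⟨w, hw, rfl⟩
    by_cases hs : 0 < w.sum
    · have : braNull.mkQ (word w) = 0 := by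
        rw [Submodule.mkQ_apply, Submodule.Quotient.mk_eq_zero]
        exact word_mem_braNull w hs
      rw [SetLike.mem_coe, Submodule.mem_comap, this]
      exact V.zero_mem
    · exact braDeg_le_creation (-w.sum).toNat (Submodule.subset_span ⟨w, hw, by omega, rfl⟩)
  have h2 : V ≤ LinearMap.range
      (LinearMap.applyₗ (R := K) bra0 ∘ₗ creation.toLinearMap : MvPolynomial OddNat K →ₗ[K] Bra) := by
    refine Submodule.span_le.mpr ?_
    rintro _ ⟨M, rfl⟩
    exact ⟨_, rfl⟩
  obtain ⟨p, hp⟩ := h2 h1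
  exact ⟨p, hp.symm⟩

/-- The expansion of a vector of the even dual Fock space in terms of the currents. -/
theorem eq_sum_creation {u : Bra} (hu : u ∈ braEven) (T : Finset (OddNat →₀ ℕ))
    (hT : ∀ M, M ∉ T → braVac (annihilation (MvPolynomial.monomial M 1) u) = 0) :
    u = ∑ M ∈ T, (expWeight M * braVac (annihilation (MvPolynomial.monomial M 1) u)) •
      creation (MvPolynomial.monomial M 1) bra0 := by
  classical
  obtain ⟨p, rfl⟩ := exists_creation hu
  simp only [braVac_annihilation_creation]
  have hp : p = ∑ M ∈ T, MvPolynomial.coeff M p • MvPolynomial.monomial M (1 : K) := by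
    ext N
    rw [MvPolynomial.coeff_sum]
    simp only [MvPolynomial.coeff_smul, MvPolynomial.coeff_monomial, smul_eq_mul, mul_ite, mul_one,
      mul_zero]
    rw [Finset.sum_ite_eq' T N]
    split_ifs with h
    · rfl
    · rw [← braVac_annihilation_creation, hT N h, mul_zero]
  conv_lhs => rw [hp, map_sum, LinearMap.sum_apply]
  exact Finset.sum_congr rfl fun M _ => by rw [map_smul, LinearMap.smul_apply]

/-- The separation principle behind the Wick formula: an even vector is detected by the vacuum
values of its images under the annihilation operators. -/
theorem eq_zero_of_annihilation {u : Bra} (hu : u ∈ braEven)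
    (h : ∀ M, braVac (annihilation (MvPolynomial.monomial M 1) u) = 0) : u = 0 := by
  rw [eq_sum_creation hu ∅ fun M _ => h M, Finset.sum_empty]

end KFermion

end

/-! ### Expressing `e^H` through the odd currents and the deformed power sums. -/

noncomputable section

namespace KFermion

/-! ### The exponential of the Hamiltonian -/

variable {M : Type} [AddCommGroup M] [Module K M]

/-- The `k`-th power of `2 ∑_{j ∈ J} X_j b_j / j`, evaluated between `v` and `u`, where `b_j` is the
image of `X_j` under `ρ`. -/
def hamPoly (ρ : MvPolynomial OddNat K →ₐ[K] Module.End K M) (J : Finset OddNat) :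
    ℕ → Module.Dual K M → M → MvPolynomial OddNat K
  | 0, v, u => MvPolynomial.C (v u)
  | k + 1, v, u => ∑ j ∈ J, MvPolynomial.C (2 / ((j : ℕ) : K)) *
      (MvPolynomial.X j * hamPoly ρ J k (v ∘ₗ ρ (MvPolynomial.X j)) u)

theorem coeff_hamPoly (ρ : MvPolynomial OddNat K →ₐ[K] Module.End K M) (J : Finset OddNat) (k : ℕ)
    (v : Module.Dual K M) (u : M) (N : OddNat →₀ ℕ) :
    MvPolynomial.coeff N (hamPoly ρ J k v u) = if N.degree = k ∧ N.support ⊆ J then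
      (k.factorial : K) * (expWeight N * v (ρ (MvPolynomial.monomial N 1) u)) else 0 := by
  classical
  induction k generalizing v N with
  | zero =>
    rw [hamPoly, MvPolynomial.coeff_C]
    by_cases h : N = 0
    · subst h
      have : MvPolynomial.monomial (0 : OddNat →₀ ℕ) (1 : K) = 1 := rfl
      simp [expWeight_zero, this]
    · rw [if_neg (Ne.symm h), if_neg]
      rintro ⟨h1, -⟩
      exact h ((Finsupp.degree_eq_zero_iff N).mp h1)
  | succ k ih =>
    rw [hamPoly, MvPolynomial.coeff_sum]
    -- The choice of `X_j` as outermost factor contributes `N_j` times `k!` times the common value,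
    -- by the recursion of `expWeight`. Summing over `j`, with `∑ N_j = k + 1`, produces `(k+1)!`.
    have key : ∀ j ∈ J, MvPolynomial.coeff N (MvPolynomial.C (2 / ((j : ℕ) : K)) *
        (MvPolynomial.X j * hamPoly ρ J k (v ∘ₗ ρ (MvPolynomial.X j)) u)) =
        if N.degree = k + 1 ∧ N.support ⊆ J then
          (N j : K) * ((k.factorial : K) * (expWeight N * v (ρ (MvPolynomial.monomial N 1) u)))
        else 0 := by
      intro j hj
      rw [MvPolynomial.coeff_C_mul, MvPolynomial.coeff_X_mul']
      split_ifs with h1 h2 h2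
      · obtain ⟨N', rfl⟩ : ∃ N', N = N' + Finsupp.single j 1 := by
          refine ⟨N - Finsupp.single j 1, ?_⟩
          rw [Finsupp.mem_support_iff] at h1
          ext i
          by_cases hi : j = i
          · subst hi; simp; omega
          · simp [hi]
        have hsub : N'.support ⊆ J := by
          intro i hi
          apply h2.2
          rw [Finsupp.mem_support_iff] at hi ⊢
          simp only [Finsupp.add_apply]
          omega
        have hdeg : N'.degree = k := by
          have := h2.1
          rw [map_add, Finsupp.degree_single] at this
          omega
        rw [add_tsub_cancel_right, ih, if_pos ⟨hdeg, hsub⟩, LinearMap.comp_apply,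
          ← Module.End.mul_apply, ← map_mul, MvPolynomial.X, MvPolynomial.monomial_mul, one_mul,
          add_comm (Finsupp.single j 1)]
        have h3 := expWeight_add_single N' j
        rw [Finsupp.add_apply, Finsupp.single_eq_same]
        push_cast
        linear_combination -(k.factorial : K) *
          v (ρ (MvPolynomial.monomial (N' + Finsupp.single j 1) 1) u) * h3
      · rw [ih, if_neg, mul_zero]
        rintro ⟨h3, h4⟩
        apply h2
        rw [Finsupp.mem_support_iff] at h1
        have e : N = N - Finsupp.single j 1 + Finsupp.single j 1 := by
          ext i
          by_cases hi : j = i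
          · subst hi; simp; omega
          · simp [hi]
        constructor
        · rw [e, map_add, Finsupp.degree_single, h3]
        · intro i hi
          by_cases hij : j = i
          · rwa [← hij]
          · apply h4
            rw [Finsupp.mem_support_iff] at hi ⊢
            simpa [hij] using hi
      · rw [Finsupp.notMem_support_iff] at h1
        rw [h1]; simp
      · simp
    rw [Finset.sum_congr rfl key]
    split_ifs with h
    · rw [← Finset.sum_mul, ← Nat.cast_sum]
      have : ∑ j ∈ J, N j = k + 1 := by
        rw [← h.1, Finsupp.degree_apply]
        refine (Finset.sum_subset h.2 fun i _ hi => ?_).symm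
        exact Finsupp.notMem_support_iff.mp hi
      rw [this, Nat.factorial_succ]
      push_cast
      ring
    · simp

-- This treats both Hamiltonians at once. If `B_n` expands in the odd currents with matrix `c`, and
-- `π_j` is the combination of power sums for which `(2/j) π_j = ∑_n (2/n) p_n c_{n j}`, then the
-- Hamiltonian equals `2 ∑_j π_j b_j / j`. The finite set `J`, the invariant subspace `S` and the
-- degree bound `N` confine the statement to a range where all sums are finite.
open Classical in
theorem hamiltonian_iterate (ρ : MvPolynomial OddNat K →ₐ[K] Module.End K M) (J : Finset OddNat)
    (B : ℕ → M →ₗ[K] M) (S : Submodule K M) (c : ℕ → OddNat → K)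
    (π : OddNat → MvPowerSeries ℕ K) (N : ℕ)
    (hS : ∀ j ∈ J, ∀ u ∈ S, ρ (MvPolynomial.X j) u ∈ S)
    (hB : ∀ n, 1 ≤ n → n ≤ N → ∀ u ∈ S, B n u = ∑ j ∈ J, c n j • ρ (MvPolynomial.X j) u)
    (hπ : ∀ j ∈ J, ∀ a : ℕ →₀ ℕ, 2 / ((j : ℕ) : K) * MvPowerSeries.coeff a (π j) =
      ∑ n ∈ Finset.Icc 1 a.degree, 2 / (n : K) * MvPowerSeries.coeff a (powerSum n) * c n j)
    {u : M} (hu : u ∈ S) (k : ℕ) : ∀ d : ℕ →₀ ℕ, d.degree ≤ N →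
      (hamiltonian B)^[k] (fun e => if e = 0 then u else 0) d ∈ S ∧
      ∀ v : Module.Dual K M, v ((hamiltonian B)^[k] (fun e => if e = 0 then u else 0) d) =
        MvPowerSeries.coeff d (MvPolynomial.aeval π (hamPoly ρ J k v u)) := by
  induction k with
  | zero =>
    intro d _
    simp only [Function.iterate_zero, id]
    constructor
    · split_ifs
      · exact hu
      · exact S.zero_mem
    · intro v
      rw [hamPoly, MvPolynomial.aeval_C, MvPowerSeries.algebraMap_apply, Algebra.algebraMap_self,
        RingHom.id_apply, MvPowerSeries.coeff_C]
      split_ifs <;> simp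
  | succ k ih =>
    intro d hd
    rw [Function.iterate_succ_apply']
    set U := (hamiltonian B)^[k] (fun e => if e = 0 then u else 0) with hU
    have e : hamiltonian B U d = ∑ a ∈ Finset.HasAntidiagonal.antidiagonal d, ∑ j ∈ J,
        (2 / ((j : ℕ) : K) * MvPowerSeries.coeff a.1 (π j)) • ρ (MvPolynomial.X j) (U a.2) := by
      rw [hamiltonian]
      refine Finset.sum_congr rfl fun a ha => ?_
      have had := congrArg Finsupp.degree (Finset.HasAntidiagonal.mem_antidiagonal.mp ha)
      rw [map_add] at had
      have h1 : ∀ n ∈ Finset.Icc 1 a.1.degree,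
          (2 / (n : K) * MvPowerSeries.coeff a.1 (powerSum n)) • B n (U a.2) =
          ∑ j ∈ J, (2 / (n : K) * MvPowerSeries.coeff a.1 (powerSum n) * c n j) •
            ρ (MvPolynomial.X j) (U a.2) := by
        intro n hn
        rw [Finset.mem_Icc] at hn
        rw [hB n hn.1 (by omega) _ (ih a.2 (by omega)).1, Finset.smul_sum]
        simp only [smul_smul]
      rw [Finset.sum_congr rfl h1, Finset.sum_comm]
      refine Finset.sum_congr rfl fun j hj => ?_
      rw [hπ j hj, Finset.sum_smul]
    rw [e]
    constructor
    · refine Submodule.sum_mem _ fun a ha => Submodule.sum_mem _ fun j hj =>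
        Submodule.smul_mem _ _ (hS j hj _ (ih a.2 ?_).1)
      have had := congrArg Finsupp.degree (Finset.HasAntidiagonal.mem_antidiagonal.mp ha)
      rw [map_add] at had
      omega
    · intro v
      rw [hamPoly, map_sum, map_sum, map_sum]
      simp only [map_sum, map_smul, smul_eq_mul]
      rw [Finset.sum_comm]
      refine Finset.sum_congr rfl fun j hj => ?_
      rw [map_mul (MvPolynomial.aeval π), map_mul (MvPolynomial.aeval π), MvPolynomial.aeval_C,
        MvPolynomial.aeval_X,
        MvPowerSeries.algebraMap_apply, Algebra.algebraMap_self, RingHom.id_apply,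
        MvPowerSeries.coeff_C_mul, MvPowerSeries.coeff_mul, Finset.mul_sum]
      refine Finset.sum_congr rfl fun a ha => ?_
      have had := congrArg Finsupp.degree (Finset.HasAntidiagonal.mem_antidiagonal.mp ha)
      rw [map_add] at had
      rw [← (ih a.2 (by omega)).2, LinearMap.comp_apply, mul_assoc]

theorem apply_expHamiltonian (ρ : MvPolynomial OddNat K →ₐ[K] Module.End K M) (J : Finset OddNat)
    (B : ℕ → M →ₗ[K] M) (S : Submodule K M) (c : ℕ → OddNat → K)
    (π : OddNat → MvPowerSeries ℕ K) (N : ℕ)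
    (hS : ∀ j ∈ J, ∀ u ∈ S, ρ (MvPolynomial.X j) u ∈ S)
    (hB : ∀ n, 1 ≤ n → n ≤ N → ∀ u ∈ S, B n u = ∑ j ∈ J, c n j • ρ (MvPolynomial.X j) u)
    (hπ : ∀ j ∈ J, ∀ a : ℕ →₀ ℕ, 2 / ((j : ℕ) : K) * MvPowerSeries.coeff a (π j) =
      ∑ n ∈ Finset.Icc 1 a.degree, 2 / (n : K) * MvPowerSeries.coeff a (powerSum n) * c n j)
    {u : M} (hu : u ∈ S) (d : ℕ →₀ ℕ) (hd : d.degree ≤ N) (v : Module.Dual K M) :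
    v (expHamiltonian B u d) = MvPowerSeries.coeff d (MvPolynomial.aeval π
      (∑ k ∈ Finset.range (d.degree + 1), ((k.factorial : K)⁻¹) • hamPoly ρ J k v u)) := by
  rw [expHamiltonian, map_sum, map_sum, map_sum]
  refine Finset.sum_congr rfl fun k _ => ?_
  rw [map_smul, map_smul, map_smul, (hamiltonian_iterate ρ J B S c π N hS hB hπ hu k d hd).2]

/-! ### Weights of monomials -/

/-- The size of an odd partition given by multiplicities. -/
abbrev size : (OddNat →₀ ℕ) →+ ℕ := Finsupp.weight fun j : OddNat => (j : ℕ)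

theorem degree_le_size (N : OddNat →₀ ℕ) : N.degree ≤ size N := by
  induction N using multiset_induction with
  | h0 => simp
  | hs N j ih =>
    rw [map_add, map_add, Finsupp.degree_single, Finsupp.weight_single, smul_eq_mul, one_mul]
    have := j.2.pos
    omega

theorem le_size {N : OddNat →₀ ℕ} {j : OddNat} (h : j ∈ N.support) : (j : ℕ) ≤ size N :=
  Finsupp.le_weight_of_ne_zero' _ (Finsupp.mem_support_iff.mp h)

theorem coeff_prod_eq_zero {σ : Type} {π : OddNat → MvPowerSeries σ K}
    (hπ : ∀ (j : OddNat) (d : σ →₀ ℕ), d.degree < j → MvPowerSeries.coeff d (π j) = 0)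
    (N : OddNat →₀ ℕ) : ∀ d : σ →₀ ℕ, d.degree < size N →
    MvPowerSeries.coeff d (N.prod fun j e => π j ^ e) = 0 := by
  classical
  induction N using multiset_induction with
  | h0 => intro d hd; simp at hd
  | hs N j ih =>
    intro d hd
    rw [map_add, Finsupp.weight_single, smul_eq_mul, one_mul] at hd
    rw [Finsupp.prod_add_index' (by simp) (by intros; exact pow_add _ _ _),
      Finsupp.prod_single_index (by simp), pow_one, MvPowerSeries.coeff_mul]
    refine Finset.sum_eq_zero fun a ha => ?_
    have had := congrArg Finsupp.degree (Finset.HasAntidiagonal.mem_antidiagonal.mp ha)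
    rw [map_add] at had
    by_cases h : a.1.degree < size N
    · rw [ih _ h, zero_mul]
    · rw [hπ j a.2 (by omega), mul_zero]

/-- When the series substituted for `X_j` starts in degree at least `j`, a monomial of size `s`
contributes only in degrees at least `s`. Infinite substitutions can therefore be compared with
truncated polynomials one coefficient at a time. -/
theorem coeff_subst_congr {σ : Type} {π : OddNat → MvPowerSeries σ K}
    (ha : MvPowerSeries.HasSubst π)
    (hπ : ∀ (j : OddNat) (d : σ →₀ ℕ), d.degree < j → MvPowerSeries.coeff d (π j) = 0)
    {f g : MvPowerSeries OddNat K} {d : σ →₀ ℕ}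
    (h : ∀ N, size N ≤ d.degree → MvPowerSeries.coeff N f = MvPowerSeries.coeff N g) :
    MvPowerSeries.coeff d (MvPowerSeries.substAlgHom ha f) =
      MvPowerSeries.coeff d (MvPowerSeries.substAlgHom ha g) := by
  rw [MvPowerSeries.substAlgHom_apply, MvPowerSeries.substAlgHom_apply,
    MvPowerSeries.coeff_subst ha, MvPowerSeries.coeff_subst ha]
  refine finsum_congr fun N => ?_
  by_cases hN : size N ≤ d.degree
  · rw [h N hN]
  · rw [coeff_prod_eq_zero hπ N d (by omega), smul_zero, smul_zero]

/-! ### The Hamiltonian `H^{(β)}` -/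

theorem coeff_powerSum_eq_zero {n : ℕ} {a : ℕ →₀ ℕ} (h : a.degree ≠ n) :
    MvPowerSeries.coeff a (powerSum n) = 0 := by
  refine if_neg ?_
  rintro ⟨i, rfl⟩
  simp at h

/-- Each `p_n` is homogeneous of degree `n`, so only `n = a.degree` survives. -/
theorem sum_powerSum (a : ℕ →₀ ℕ) (c : ℕ → K) :
    ∑ n ∈ Finset.Icc 1 a.degree, 2 / (n : K) * MvPowerSeries.coeff a (powerSum n) * c n =
      if a.degree = 0 then 0 else
        2 / (a.degree : K) * MvPowerSeries.coeff a (powerSum a.degree) * c a.degree := by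
  split_ifs with h
  · rw [h]; simp
  · rw [Finset.sum_eq_single a.degree]
    · intro n _ hn
      rw [coeff_powerSum_eq_zero (Ne.symm hn)]; simp
    · intro h'
      exact absurd (Finset.mem_Icc.mpr ⟨by omega, le_rfl⟩) h'

/-- For odd `j` the two binomial expansions contribute equally to the coefficient of `X^j`, which
cancels the factor `1/2`. -/
theorem coeff_currentPoly (n j : ℕ) (hj : Odd j) :
    (Polynomial.C (1 / 2 : K) * ((Polynomial.X - Polynomial.C (β / 2)) ^ n -
      (-Polynomial.X - Polynomial.C (β / 2)) ^ n)).coeff j =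
      (-(β / 2)) ^ (n - j) * (n.choose j : K) := by
  have e1 : (Polynomial.X - Polynomial.C (β / 2)) ^ n =
      (Polynomial.X + Polynomial.C (-(β / 2))) ^ n := by rw [Polynomial.C_neg, sub_eq_add_neg]
  have e2 : (-Polynomial.X - Polynomial.C (β / 2)) ^ n =
      Polynomial.C ((-1) ^ n) * (Polynomial.X + Polynomial.C (β / 2)) ^ n := by
    rw [show -Polynomial.X - Polynomial.C (β / 2) =
      Polynomial.C (-1) * (Polynomial.X + Polynomial.C (β / 2)) by simp; ring, mul_pow,
      Polynomial.C_pow]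
  rw [Polynomial.coeff_C_mul, e1, e2, Polynomial.coeff_sub, Polynomial.coeff_C_mul,
    Polynomial.coeff_X_add_C_pow, Polynomial.coeff_X_add_C_pow]
  by_cases h : j ≤ n
  · have h3 : (-1 : K) ^ n = -(-1) ^ (n - j) := by
      conv_lhs => rw [← Nat.sub_add_cancel h]
      rw [pow_add, hj.neg_one_pow]; ring
    rw [h3, neg_pow (β / 2)]
    ring
  · rw [Nat.choose_eq_zero_of_lt (by omega)]; simp

theorem ring_choose_neg {n j : ℕ} (hj : 0 < j) (h : j ≤ n) :
    Ring.choose (-(j : ℤ)) (n - j) = (-1) ^ (n - j) * ((n - 1).choose (j - 1) : ℤ) := by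
  rw [Ring.choose_neg]
  have : (j : ℤ) + ((n - j : ℕ) : ℤ) - 1 = ((n - 1 : ℕ) : ℤ) := by omega
  rw [this, Ring.choose_natCast, Nat.choose_symm_of_eq_add (by omega : n - 1 = n - j + (j - 1))]
  simp [Int.negOnePow_def, Units.smul_def]

/-- Both sides reduce to `n · binom(n-1, j-1) = j · binom(n, j)`. This is what converts `2 ∑_n p_n
b_n^{(β)} / n` into `2 ∑_j p_j^{(β)} b_j / j`. -/
theorem choose_neg_identity {n j : ℕ} (hj : 0 < j) (h : j ≤ n) :
    2 / (j : K) * ((Ring.choose (-(j : ℤ)) (n - j) : ℤ) : K) =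
      2 / (n : K) * ((-1) ^ (n - j) * (n.choose j : K)) := by
  have h2 : n * (n - 1).choose (j - 1) = n.choose j * j := by
    obtain ⟨n, rfl⟩ : ∃ p, n = p + 1 := ⟨n - 1, by omega⟩
    obtain ⟨j, rfl⟩ : ∃ p, j = p + 1 := ⟨j - 1, by omega⟩
    exact Nat.add_one_mul_choose_eq n j
  have h3 : (n : K) * ((n - 1).choose (j - 1) : K) = (n.choose j : K) * j := by exact_mod_cast h2
  have hj' : (j : K) ≠ 0 := Nat.cast_ne_zero.mpr hj.ne'
  have hn' : (n : K) ≠ 0 := Nat.cast_ne_zero.mpr (by omega)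
  rw [ring_choose_neg hj h]
  push_cast
  field_simp
  linear_combination h3

theorem coeff_powerSumBeta_of_le {j : ℕ} {a : ℕ →₀ ℕ} (h : j ≤ a.degree) :
    MvPowerSeries.coeff a (powerSumBeta j) =
      ((Ring.choose (-(j : ℤ)) (a.degree - j) : ℤ) : K) * (β / 2) ^ (a.degree - j) *
        MvPowerSeries.coeff a (powerSum a.degree) := by
  change (∑ i ∈ Finset.range (a.degree + 1), ((Ring.choose (-(j : ℤ)) i : ℤ) : K) *
    (β / 2) ^ i * MvPowerSeries.coeff a (powerSum (j + i))) = _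
  rw [Finset.sum_eq_single (a.degree - j)]
  · rw [Nat.add_sub_cancel' h]
  · intro i _ hi
    rw [coeff_powerSum_eq_zero (by omega), mul_zero]
  · intro h'
    exact absurd (Finset.mem_range.mpr (by omega)) h'

theorem coeff_powerSumBeta (j : OddNat) (a : ℕ →₀ ℕ) :
    2 / ((j : ℕ) : K) * MvPowerSeries.coeff a (powerSumBeta j) =
      ∑ n ∈ Finset.Icc 1 a.degree, 2 / (n : K) * MvPowerSeries.coeff a (powerSum n) *
        ((-(β / 2)) ^ (n - j) * (n.choose j : K)) := by
  have hj := j.2.pos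
  rw [sum_powerSum a fun n => (-(β / 2)) ^ (n - (j : ℕ)) * (n.choose j : K)]
  by_cases h : (j : ℕ) ≤ a.degree
  · rw [if_neg (by omega)]
    rw [coeff_powerSumBeta_of_le h, neg_pow]
    linear_combination (β / 2) ^ (a.degree - j) * MvPowerSeries.coeff a (powerSum a.degree) *
      choose_neg_identity hj h
  · rw [powerSumBeta_coeff_eq_zero (by omega), mul_zero]
    split_ifs
    · rfl
    · rw [Nat.choose_eq_zero_of_lt (by omega)]; simp

/-- The odd numbers up to `N`. -/
def oddUpTo (N : ℕ) : Finset OddNat := (Finset.range (N + 1)).subtype Odd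

theorem mem_oddUpTo {N : ℕ} {j : OddNat} : j ∈ oddUpTo N ↔ (j : ℕ) ≤ N := by
  rw [oddUpTo, Finset.mem_subtype, Finset.mem_range]; omega

theorem braCurrentBeta_eq (n N : ℕ) (h : n ≤ N) (u : Bra) : braCurrentBeta n u =
    ∑ j ∈ oddUpTo N, ((-(β / 2)) ^ (n - j) * (n.choose j : K)) • creation (MvPolynomial.X j) u := by
  have e : ∀ j : OddNat, ((-(β / 2)) ^ (n - (j : ℕ)) * (n.choose j : K)) •
      creation (MvPolynomial.X j) u = (Polynomial.C (1 / 2 : K) * ((Polynomial.X -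
        Polynomial.C (β / 2)) ^ n - (-Polynomial.X - Polynomial.C (β / 2)) ^ n)).coeff j •
        braCurrent ((j : ℕ) : ℤ) u := by
    intro j
    rw [coeff_currentPoly n j j.2, creation_X]
  rw [Finset.sum_congr rfl fun j _ => e j, oddUpTo]
  have e2 := Finset.sum_subtype_eq_sum_filter (s := Finset.range (N + 1)) (p := Odd)
    (fun k : ℕ => (Polynomial.C (1 / 2 : K) * ((Polynomial.X - Polynomial.C (β / 2)) ^ n -
      (-Polynomial.X - Polynomial.C (β / 2)) ^ n)).coeff k • braCurrent (k : ℤ) u)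
  rw [e2, Finset.sum_filter, braCurrentBeta, LinearMap.sum_apply]
  have hsub : Finset.range (n + 1) ⊆ Finset.range (N + 1) := Finset.range_mono (by omega)
  -- Even indices drop out because `braCurrent` is zero there by convention.
  have hodd : ∀ k : ℕ, ¬ Odd k → braCurrent (k : ℤ) u = 0 := by
    intro k hk
    rw [braCurrent, dif_neg (by exact_mod_cast hk), LinearMap.zero_apply]
  rw [← Finset.sum_subset hsub]
  · refine Finset.sum_congr rfl fun k _ => ?_
    split_ifs with hk
    · rfl
    · rw [LinearMap.smul_apply, hodd k hk, smul_zero]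
  · intro k _ hk
    rw [Finset.mem_range] at hk
    split_ifs with ho
    · rw [coeff_currentPoly n k ho, Nat.choose_eq_zero_of_lt (by omega)]; simp
    · rfl

/-- The generating series of the values of a functional `v` at the vectors `⟨0|∏ b_j^{m_j}`. -/
def braSeries (v : Module.Dual K Bra) : MvPowerSeries OddNat K := fun N =>
  expWeight N * v (creation (MvPolynomial.monomial N 1) bra0)

theorem coeff_braSeries (v : Module.Dual K Bra) (N : OddNat →₀ ℕ) :
    MvPowerSeries.coeff N (braSeries v) =
      expWeight N * v (creation (MvPolynomial.monomial N 1) bra0) := rfl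

theorem coeff_sum_hamPoly (ρ : MvPolynomial OddNat K →ₐ[K] Module.End K M) (J : Finset OddNat)
    (D : ℕ) (v : Module.Dual K M) (u : M) (N : OddNat →₀ ℕ) :
    MvPolynomial.coeff N (∑ k ∈ Finset.range (D + 1), ((k.factorial : K)⁻¹) • hamPoly ρ J k v u) =
      if N.degree ≤ D ∧ N.support ⊆ J then
        expWeight N * v (ρ (MvPolynomial.monomial N 1) u) else 0 := by
  rw [MvPolynomial.coeff_sum]
  simp only [MvPolynomial.coeff_smul, coeff_hamPoly, smul_eq_mul]
  by_cases h : N.degree ≤ D ∧ N.support ⊆ J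
  · rw [if_pos h, Finset.sum_eq_single N.degree]
    · rw [if_pos ⟨rfl, h.2⟩, inv_mul_cancel_left₀ (Nat.cast_ne_zero.mpr (Nat.factorial_ne_zero _))]
    · intro k _ hk
      rw [if_neg (fun h' => hk h'.1.symm), mul_zero]
    · intro h'
      exact absurd (Finset.mem_range.mpr (by omega)) h'
  · rw [if_neg h]
    refine Finset.sum_eq_zero fun k hk => ?_
    rw [Finset.mem_range] at hk
    rw [if_neg (fun h' => h ⟨by omega, h'.2⟩), mul_zero]

/-- With the Hamiltonian in the form `2 ∑ p_j^{(β)} b_j / j`, its exponential on the vacuum is the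
sum over odd partitions of `expWeight` times a monomial in the `p_j^{(β)}` times the same monomial
in the `b_j`. -/
theorem expectH_eq (v : Module.Dual K Bra) :
    expectH (v ∘ₗ braEven.subtype) = evalBeta (braSeries v) := by
  ext d
  have h1 : MvPowerSeries.coeff d (expectH (v ∘ₗ braEven.subtype)) =
      v (expHamiltonian braCurrentBeta bra0 d) := rfl
  rw [h1, apply_expHamiltonian creation (oddUpTo d.degree) braCurrentBeta ⊤
    (fun n j => (-(β / 2)) ^ (n - (j : ℕ)) * (n.choose j : K)) (fun j => powerSumBeta j) d.degree
    (fun _ _ _ _ => trivial) (fun n _ hn u _ => braCurrentBeta_eq n _ hn u)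
    (fun j _ a => coeff_powerSumBeta j a) trivial d le_rfl, evalBeta,
    ← MvPowerSeries.substAlgHom_coe powerSumBeta_hasSubst]
  refine coeff_subst_congr _ (fun j a h => powerSumBeta_coeff_eq_zero h) fun N hN => ?_
  rw [MvPolynomial.coeff_coe, coeff_sum_hamPoly, if_pos, coeff_braSeries]
  exact ⟨(degree_le_size N).trans hN, fun j hj => mem_oddUpTo.mpr ((le_size hj).trans hN)⟩

end KFermion

end

/-! ### The dual side: `χ` as a polynomial in the `p_j^{[β]}`. -/

noncomputable section

namespace KFermion

/-! ### The Fock space as the dual of the dual Fock space -/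

/-- `b_m* = b_{-m}`. -/
theorem ketStar_ketCurrent (m : ℤ) (v : Ket) :
    ketStar (ketCurrent m v) = braCurrent (-m) (ketStar v) := by
  by_cases hm : Odd m
  · rw [ketCurrent, dif_pos hm, map_lfSum, braCurrent_apply hm.neg,
      ← finsum_comp_equiv (Equiv.addRight m) (f := fun i : ℤ => ((1 / 4 : K) * (-1) ^ i) •
        braMul (φ i) (braMul (φ (-i - -m)) (ketStar v)))]
    refine finsum_congr fun i => ?_
    simp only [Equiv.coe_addRight]
    rw [LinearMap.smul_apply, map_smul, ketStar_ketMul, star_mul, star_φ, star_φ, smul_mul_smul_comm,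
      braMul_smul, smul_smul, braMul_mul, neg_one_zpow_odd_sub hm,
      neg_one_zpow_neg, zpow_add₀ (neg_ne_zero.mpr one_ne_zero), hm.neg_one_zpow,
      show -(-i - m) = i + m by ring, show -(i + m) - -m = -i by ring]
    congr 1
    linear_combination (-(1 / 4 : K) * (-1) ^ i) * neg_one_zpow_sq i
  · rw [ketCurrent, dif_neg hm, braCurrent, dif_neg (by rwa [odd_neg])]
    simp

/-- The functional `⟨0|X ↦ ⟨0|X*|0⟩`. -/
def starVac : Module.Dual K Bra := braNull.liftQ (vev ∘ₗ star) (by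
  refine Submodule.span_le.mpr ?_
  rintro _ ⟨n, hn, X, rfl⟩
  rw [SetLike.mem_coe, LinearMap.mem_ker, LinearMap.comp_apply, star_mul, star_φ, mul_smul_comm,
    map_smul, vev_mul_φ n hn, smul_zero])

theorem starVac_φ {n : ℤ} (hn : n < 0) (u : Bra) : starVac (braMul (φ n) u) = 0 := by
  obtain ⟨Z, rfl⟩ := braNull.mkQ_surjective u
  have : starVac (braMul (φ n) (braNull.mkQ Z)) = vev (star (Z * φ n)) := rfl
  rw [this, star_mul, star_φ, smul_mul_assoc, map_smul, vev_φ_mul _ (by omega), smul_zero]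

theorem star_one : star 1 = 1 := by simp [star]

theorem starVac_eq {u : Bra} (hu : u ∈ braEven) : starVac u = braVac u := by
  obtain ⟨p, rfl⟩ := exists_creation hu
  rw [braVac_creation, vac_creation (fun _ => starVac_φ)]
  change vev (star 1) = 1
  rw [star_one, vev_one]

/-- The vacuum expectation value is invariant under the anti-involution on even vectors: both
functionals kill everything in the image of a negative mode and equal `1` on the vacuum, and the
even part is generated by the `b_j` with `j > 0`. -/
theorem ketVac_eq {v : Ket} (hv : ketStar v ∈ braEven) : ketVac v = braVac (ketStar v) := by
  rw [← starVac_eq hv]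
  obtain ⟨Z, rfl⟩ := ketNull.mkQ_surjective v
  change vev Z = vev (star (star Z))
  rw [star_star]

theorem ketCurrent_comm (i j : OddNat) :
    (ketCurrent ((i : ℕ) : ℤ) : Module.End K Ket) * ketCurrent ((j : ℕ) : ℤ) =
      ketCurrent ((j : ℕ) : ℤ) * ketCurrent ((i : ℕ) : ℤ) := by
  refine LinearMap.ext fun v => ketStar_injective ?_
  rw [Module.End.mul_apply, Module.End.mul_apply]
  simp only [ketStar_ketCurrent]
  exact LinearMap.congr_fun (annihilation_comm i j) (ketStar v)

/-- Polynomials in the annihilation operators `b_j`, `j > 0`, of the Fock space. -/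
def ketAnnihilation : MvPolynomial OddNat K →ₐ[K] Module.End K Ket :=
  (exists_algHom_of_commute _ ketCurrent_comm).choose

theorem ketAnnihilation_X (j : OddNat) :
    ketAnnihilation (MvPolynomial.X j) = ketCurrent ((j : ℕ) : ℤ) :=
  (exists_algHom_of_commute _ ketCurrent_comm).choose_spec j

theorem ketStar_ketAnnihilation (p : MvPolynomial OddNat K) (v : Ket) :
    ketStar (ketAnnihilation p v) = annihilation p (ketStar v) := by
  induction p using MvPolynomial.induction_on generalizing v with
  | C a =>
    rw [← MvPolynomial.algebraMap_eq, AlgHom.commutes, AlgHom.commutes,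
      Module.algebraMap_end_apply, Module.algebraMap_end_apply, map_smul]
  | add p q hp hq => simp only [map_add, LinearMap.add_apply, hp, hq]
  | mul_X p i hp =>
    rw [map_mul, map_mul, Module.End.mul_apply, Module.End.mul_apply, hp, ketAnnihilation_X,
      annihilation_X, ketStar_ketCurrent]

theorem braEven_annihilation (p : MvPolynomial OddNat K) {u : Bra} (hu : u ∈ braEven) :
    annihilation p u ∈ braEven := by
  induction p using MvPolynomial.induction_on generalizing u with
  | C a =>
    rw [← MvPolynomial.algebraMap_eq, AlgHom.commutes, Module.algebraMap_end_apply]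
    exact Submodule.smul_mem _ _ hu
  | add p q hp hq => rw [map_add]; exact add_mem (hp hu) (hq hu)
  | mul_X p i hp =>
    rw [map_mul, Module.End.mul_apply, annihilation_X]
    exact hp (braEven_current _ hu)

theorem braFil_annihilation (N : OddNat →₀ ℕ) {d : ℤ} {u : Bra} (hu : u ∈ braFil d) :
    annihilation (MvPolynomial.monomial N 1) u ∈ braFil (d - size N) := by
  induction N using multiset_induction generalizing d u with
  | h0 =>
    have : MvPolynomial.monomial (0 : OddNat →₀ ℕ) (1 : K) = 1 := rfl
    simpa [this] using hu
  | hs N j ih =>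
    have e : MvPolynomial.monomial (N + Finsupp.single j 1) (1 : K) =
        MvPolynomial.monomial N 1 * MvPolynomial.X j := by
      rw [MvPolynomial.X, MvPolynomial.monomial_mul, one_mul]
    rw [e, map_mul, Module.End.mul_apply, annihilation_X, map_add, Finsupp.weight_single,
      smul_eq_mul, one_mul]
    have := ih (braFil_current (-((j : ℕ) : ℤ)) hu)
    rwa [show d + -((j : ℕ) : ℤ) - size N = d - ((size N + (j : ℕ) : ℕ) : ℤ) by
      push_cast; ring] at this

/-! ### The Hamiltonian `H^{[β]}` -/

theorem inv_one_sub_pow (c : K) (n : ℕ) :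
    ((1 - PowerSeries.C c * PowerSeries.X)⁻¹) ^ (n + 1) =
      PowerSeries.mk fun k => c ^ k * ((n + k).choose n : K) := by
  have h1 : (1 - PowerSeries.C c * PowerSeries.X)⁻¹ =
      PowerSeries.rescale c (PowerSeries.mk 1) := by
    rw [PowerSeries.inv_eq_iff_mul_eq_one (by simp)]
    have h := congrArg (PowerSeries.rescale c) (PowerSeries.mk_one_mul_one_sub_eq_one K)
    rw [map_mul, map_one, map_sub, map_one, PowerSeries.rescale_X] at h
    exact h
  rw [h1, ← map_pow, PowerSeries.mk_one_pow_eq_mk_choose_add]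
  ext k
  simp [PowerSeries.coeff_rescale]

/-- Again the two terms agree for odd `j`, because `(-1)^n (-1)^{j-n} = -1`. -/
theorem coeff_currentSeries (n j : ℕ) (hn : 0 < n) (hj : Odd j) :
    PowerSeries.coeff j (currentSeries n) =
      if n ≤ j then (β / 2) ^ (j - n) * ((j - 1).choose (n - 1) : K) else 0 := by
  obtain ⟨n, rfl⟩ : ∃ p, n = p + 1 := ⟨n - 1, by omega⟩
  have e : (1 + PowerSeries.C (β / 2) * PowerSeries.X : PowerSeries K) =
      1 - PowerSeries.C (-(β / 2)) * PowerSeries.X := by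
    rw [map_neg, neg_mul, sub_neg_eq_add]
  rw [currentSeries, e, mul_pow, mul_pow, inv_one_sub_pow, inv_one_sub_pow, neg_pow PowerSeries.X,
    PowerSeries.coeff_C_mul, map_sub, PowerSeries.coeff_X_pow_mul', mul_assoc,
    show (-1 : PowerSeries K) ^ (n + 1) = PowerSeries.C ((-1) ^ (n + 1)) by simp,
    PowerSeries.coeff_C_mul, PowerSeries.coeff_X_pow_mul']
  split_ifs with h
  · rw [PowerSeries.coeff_mk, PowerSeries.coeff_mk, show n + (j - (n + 1)) = j - 1 by omega,
      neg_pow (β / 2)]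
    have h3 : (-1 : K) ^ (n + 1) * (-1) ^ (j - (n + 1)) = -1 := by
      rw [← pow_add, Nat.add_sub_cancel' h, hj.neg_one_pow]
    simp only [Nat.add_sub_cancel]
    linear_combination (-(1 / 2 : K) * (β / 2) ^ (j - (n + 1)) * ((j - 1).choose n : K)) * h3
  · simp

/-- The counterpart of `coeff_powerSumBeta` for the expansion in negative powers. It rests on the
same identity with the roles of the indices exchanged, `j · binom(j-1, n-1) = n · binom(j, n)`. -/
theorem coeff_powerSumBracket (j : OddNat) (a : ℕ →₀ ℕ) :
    2 / ((j : ℕ) : K) * MvPowerSeries.coeff a (powerSumBracket j) =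
      ∑ n ∈ Finset.Icc 1 a.degree, 2 / (n : K) * MvPowerSeries.coeff a (powerSum n) *
        PowerSeries.coeff j (currentSeries n) := by
  have hj := j.2.pos
  rw [sum_powerSum a fun n => PowerSeries.coeff j (currentSeries n), powerSumBracket, map_sum]
  by_cases h : a.degree = 0
  · rw [if_pos h, Finset.sum_eq_zero, mul_zero]
    intro i hi
    rw [Finset.mem_Icc] at hi
    rw [map_smul, coeff_powerSum_eq_zero (by omega), smul_zero]
  · rw [if_neg h, coeff_currentSeries _ _ (by omega) j.2]
    split_ifs with h'
    · rw [Finset.sum_eq_single a.degree]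
      · have h2 : (j : ℕ) * ((j : ℕ) - 1).choose (a.degree - 1) = (j : ℕ).choose a.degree * a.degree := by
          obtain ⟨n, hn⟩ : ∃ p, a.degree = p + 1 := ⟨a.degree - 1, by omega⟩
          obtain ⟨k, hk⟩ : ∃ p, (j : ℕ) = p + 1 := ⟨(j : ℕ) - 1, by omega⟩
          rw [hn, hk]
          exact Nat.add_one_mul_choose_eq k n
        have h3 : ((j : ℕ) : K) * (((j : ℕ) - 1).choose (a.degree - 1) : K) =
          ((j : ℕ).choose a.degree : K) * a.degree := by exact_mod_cast h2
        have h4 : (a.degree : K) ≠ 0 := Nat.cast_ne_zero.mpr h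
        have h5 := oddNat_cast_ne_zero j
        rw [map_smul, smul_eq_mul]
        field_simp
        linear_combination (-1 : K) * (β / 2) ^ ((j : ℕ) - a.degree) *
          MvPowerSeries.coeff a (powerSum a.degree) * h3
      · intro i _ hi
        rw [map_smul, coeff_powerSum_eq_zero (Ne.symm hi), smul_zero]
      · intro h''
        exact absurd (Finset.mem_Icc.mpr ⟨by omega, h'⟩) h''
    · rw [Finset.sum_eq_zero, mul_zero, mul_zero]
      intro i hi
      rw [Finset.mem_Icc] at hi
      rw [map_smul, coeff_powerSum_eq_zero (by omega), smul_zero]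

theorem ketCurrentBracket_eq (n D : ℕ) {v : Ket} (hv : v ∈ ketFil D) : ketCurrentBracket n v =
    ∑ j ∈ oddUpTo D, PowerSeries.coeff (j : ℕ) (currentSeries n) •
      ketAnnihilation (MvPolynomial.X j) v := by
  have e : ∀ j : OddNat, PowerSeries.coeff (j : ℕ) (currentSeries n) •
      ketAnnihilation (MvPolynomial.X j) v =
      PowerSeries.coeff (j : ℕ) (currentSeries n) • ketCurrent ((j : ℕ) : ℤ) v := by
    intro j
    rw [ketAnnihilation_X]
  rw [Finset.sum_congr rfl fun j _ => e j, oddUpTo]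
  have e2 := Finset.sum_subtype_eq_sum_filter (s := Finset.range (D + 1)) (p := Odd)
    (fun k : ℕ => PowerSeries.coeff k (currentSeries n) • ketCurrent (k : ℤ) v)
  rw [e2, Finset.sum_filter, ketCurrentBracket, lfSum_eq_sum _ _ v (Finset.range (D + 1))]
  · refine Finset.sum_congr rfl fun k _ => ?_
    split_ifs with hk
    · rfl
    · rw [ketCurrent, dif_neg (by exact_mod_cast hk)]
      simp
  · intro k hk
    rw [Finset.mem_range] at hk
    rw [LinearMap.smul_apply, ketFil_eq_zero (ketFil_current k hv) (by omega), smul_zero]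

theorem hamiltonian_iterate_eq_zero {M : Type} [AddCommGroup M] [Module K M] (B : ℕ → M →ₗ[K] M)
    (U : (ℕ →₀ ℕ) → M) (k : ℕ) : ∀ d : ℕ →₀ ℕ, d.degree < k → (hamiltonian B)^[k] U d = 0 := by
  induction k with
  | zero => intro d hd; omega
  | succ k ih =>
    intro d hd
    rw [Function.iterate_succ_apply', hamiltonian]
    refine Finset.sum_eq_zero fun a ha => Finset.sum_eq_zero fun n hn => ?_
    have had := congrArg Finsupp.degree (Finset.HasAntidiagonal.mem_antidiagonal.mp ha)
    rw [map_add] at had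
    rw [Finset.mem_Icc] at hn
    rw [ih _ (by omega), map_zero, smul_zero]

theorem ketStar_mem_braEven (w : ketEven) : ketStar (w : Ket) ∈ braEven := (ketStarEven w).2

/-- `χ(|w⟩)` is the polynomial in the `p_j^{[β]}` given by the pairings of `|w⟩*` with the vectors
`∏ b_{-j}^{m_j}|0⟩`. -/
theorem exists_evalBracket (w : ketEven) : ∃ g : MvPolynomial OddNat K, evalBracket g = χ w ∧
    ∀ N, MvPolynomial.coeff N g =
      expWeight N * braVac (annihilation (MvPolynomial.monomial N 1) (ketStar (w : Ket))) := by
  obtain ⟨D, hD⟩ := exists_braFil (ketStar (w : Ket))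
  have hzero : ∀ N : OddNat →₀ ℕ, D < size N →
      annihilation (MvPolynomial.monomial N 1) (ketStar (w : Ket)) = 0 := fun N hN =>
    braFil_eq_zero (braFil_annihilation N hD) (by omega)
  have hvac : ∀ N : OddNat →₀ ℕ, ketVac (ketAnnihilation (MvPolynomial.monomial N 1) (w : Ket)) =
      braVac (annihilation (MvPolynomial.monomial N 1) (ketStar (w : Ket))) := by
    intro N
    rw [ketVac_eq, ketStar_ketAnnihilation]
    rw [ketStar_ketAnnihilation]
    exact braEven_annihilation _ (ketStar_mem_braEven w)
  -- A vector of degree at most `D` is killed by monomials of size greater than `D`, so the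
  -- truncated exponential stabilizes once `E ≥ D`.
  have hcoeff : ∀ E, D ≤ E → ∀ N, MvPolynomial.coeff N (∑ k ∈ Finset.range (E + 1),
      ((k.factorial : K)⁻¹) • hamPoly ketAnnihilation (oddUpTo D) k ketVac (w : Ket)) =
      expWeight N * braVac (annihilation (MvPolynomial.monomial N 1) (ketStar (w : Ket))) := by
    intro E hE N
    rw [coeff_sum_hamPoly]
    split_ifs with h
    · rw [hvac]
    · rw [hzero, map_zero, mul_zero]
      by_contra! hc
      exact h ⟨(degree_le_size N).trans (hc.trans hE),
        fun j hj => mem_oddUpTo.mpr ((le_size hj).trans hc)⟩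
  have hmono : ∀ {a b : ℤ}, a ≤ b → ketFil a ≤ ketFil b := fun h => Submodule.comap_mono (braFil_mono h)
  have hS : ∀ j ∈ oddUpTo D, ∀ u ∈ ketFil D, ketAnnihilation (MvPolynomial.X j) u ∈ ketFil D := by
    intro j _ u hu
    rw [ketAnnihilation_X]
    exact hmono (by omega) (ketFil_current _ hu)
  refine ⟨_, ?_, hcoeff D le_rfl⟩
  ext d
  have h1 : MvPowerSeries.coeff d (χ w) = ketVac (expHamiltonian ketCurrentBracket (w : Ket) d) := rfl
  rw [h1, apply_expHamiltonian ketAnnihilation (oddUpTo D) ketCurrentBracket (ketFil D)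
    (fun n j => PowerSeries.coeff (j : ℕ) (currentSeries n)) (fun j => powerSumBracket j) d.degree
    hS (fun n _ _ u hu => ketCurrentBracket_eq n D hu) (fun j _ a => coeff_powerSumBracket j a)
    hD d le_rfl ketVac]
  -- The polynomial is cut off at `D`, whereas the definition of the exponential is cut off at the
  -- degree of `d`. Both cutoffs are compared with their maximum.
  have e1 : ∑ k ∈ Finset.range (D + 1),
      ((k.factorial : K)⁻¹) • hamPoly ketAnnihilation (oddUpTo D) k ketVac (w : Ket) =
      ∑ k ∈ Finset.range (max D d.degree + 1),
      ((k.factorial : K)⁻¹) • hamPoly ketAnnihilation (oddUpTo D) k ketVac (w : Ket) := by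
    ext N
    rw [hcoeff D le_rfl, hcoeff _ (le_max_left _ _)]
  rw [e1, evalBracket, map_sum, map_sum, map_sum, map_sum]
  refine (Finset.sum_subset (Finset.range_mono (by omega)) fun k _ hk => ?_).symm
  rw [Finset.mem_range] at hk
  rw [map_smul, map_smul, ← (hamiltonian_iterate ketAnnihilation (oddUpTo D) ketCurrentBracket
    (ketFil D) (fun n j => PowerSeries.coeff (j : ℕ) (currentSeries n))
    (fun j => powerSumBracket j) d.degree hS (fun n _ _ u hu => ketCurrentBracket_eq n D hu)
    (fun j _ a => coeff_powerSumBracket j a) hD k d le_rfl).2 ketVac,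
    hamiltonian_iterate_eq_zero _ _ k d (by omega), map_zero, smul_zero]

end KFermion

end

/-! ### Existence and uniqueness of `Ω`. -/

noncomputable section

namespace KFermion

/-! ### Algebraic independence of the `p_j^{[β]}` -/

instance (σ : Type) : IsDomain (MvPowerSeries σ K) := NoZeroDivisors.to_isDomain _

theorem pderiv_powerSum (i n : ℕ) (hn : 0 < n) :
    MvPowerSeries.pderiv K i (powerSum n) = (n : MvPowerSeries ℕ K) * MvPowerSeries.X i ^ (n - 1) := by
  classical
  ext d
  rw [MvPowerSeries.coeff_pderiv, show (n : MvPowerSeries ℕ K) = MvPowerSeries.C (n : K) by simp,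
    MvPowerSeries.coeff_C_mul, MvPowerSeries.coeff_X_pow]
  by_cases h : d = Finsupp.single i (n - 1)
  · have h1 : MvPowerSeries.coeff (d + Finsupp.single i 1) (powerSum n) = 1 := by
      refine if_pos ⟨i, ?_⟩
      rw [h, ← Finsupp.single_add, Nat.sub_add_cancel hn]
    rw [h1, if_pos h, h, Finsupp.single_eq_same, one_mul, mul_one]
    exact_mod_cast Nat.sub_add_cancel hn
  · have h1 : MvPowerSeries.coeff (d + Finsupp.single i 1) (powerSum n) = 0 := by
      refine if_neg ?_
      rintro ⟨k, hk⟩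
      have hki : k = i := by
        by_contra hc
        have := DFunLike.congr_fun hk i
        rw [Finsupp.add_apply, Finsupp.single_eq_same, Finsupp.single_eq_of_ne (Ne.symm hc)] at this
        omega
      subst hki
      apply h
      have h2 : d + Finsupp.single k 1 = Finsupp.single k (n - 1) + Finsupp.single k 1 := by
        rw [hk, ← Finsupp.single_add, Nat.sub_add_cancel hn]
      exact add_right_cancel h2
    rw [h1, if_neg h]
    simp

/-- This is the derivative of `∑_i ((x_i + β/2)^n - (β/2)^n)` with respect to one variable, carried
out on the binomial expansion. -/
theorem pderiv_powerSumBracket (i n : ℕ) (hn : 0 < n) :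
    MvPowerSeries.pderiv K i (powerSumBracket n) = (n : MvPowerSeries ℕ K) *
      (MvPowerSeries.X i + MvPowerSeries.C (β / 2)) ^ (n - 1) := by
  obtain ⟨n, rfl⟩ : ∃ p, n = p + 1 := ⟨n - 1, by omega⟩
  rw [powerSumBracket, map_sum, Nat.add_sub_cancel, add_pow, Finset.mul_sum,
    show Finset.Icc 1 (n + 1) = Finset.Ico 1 (n + 2) by ext; simp; omega,
    Finset.sum_Ico_eq_sum_range, show n + 2 - 1 = n + 1 by omega]
  refine Finset.sum_congr rfl fun k hk => ?_
  rw [Finset.mem_range] at hk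
  rw [Derivation.map_smul, pderiv_powerSum _ _ (by omega), MvPowerSeries.smul_eq_C_mul, map_mul, map_pow,
    Nat.add_sub_cancel_left, show n + 1 - (1 + k) = n - k by omega]
  have h := Nat.add_one_mul_choose_eq n k
  have h' : ((n + 1 : ℕ) : MvPowerSeries ℕ K) * (n.choose k : MvPowerSeries ℕ K) =
    ((n + 1).choose (1 + k) : MvPowerSeries ℕ K) * ((1 + k : ℕ) : MvPowerSeries ℕ K) := by
    rw [add_comm 1 k, ← Nat.cast_mul, ← Nat.cast_mul, h]
  rw [map_natCast]
  linear_combination -(MvPowerSeries.C (β / 2)) ^ (n - k) * MvPowerSeries.X i ^ k * h'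

theorem pderiv_evalBracket (i : ℕ) (g : MvPolynomial OddNat K) (J : Finset OddNat)
    (hJ : g.vars ⊆ J) : MvPowerSeries.pderiv K i (evalBracket g) =
      ∑ j ∈ J, evalBracket (MvPolynomial.pderiv j g) *
        (((j : ℕ) : MvPowerSeries ℕ K) *
          (MvPowerSeries.X i + MvPowerSeries.C (β / 2)) ^ ((j : ℕ) - 1)) := by
  have hg : g ∈ MvPolynomial.supported K (J : Set OddNat) :=
    MvPolynomial.mem_supported.mpr (by exact_mod_cast hJ)
  clear hJ
  rw [MvPolynomial.supported] at hg
  induction hg using Algebra.adjoin_induction with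
  | mem x hx =>
    obtain ⟨k, hk, rfl⟩ := hx
    classical
    rw [Finset.sum_eq_single k]
    · rw [MvPolynomial.pderiv_X_self, map_one, one_mul, evalBracket, MvPolynomial.aeval_X,
        pderiv_powerSumBracket i _ k.2.pos]
    · intro j _ hj
      rw [MvPolynomial.pderiv_X_of_ne (Ne.symm hj), map_zero, zero_mul]
    · intro h
      exact absurd hk h
  | algebraMap r => simp
  | add x y _ _ hx hy => simp only [map_add, hx, hy, add_mul, Finset.sum_add_distrib]
  | mul x y _ _ hx hy =>
    rw [map_mul, Derivation.leibniz, hx, hy, smul_eq_mul, smul_eq_mul, Finset.mul_sum,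
      Finset.mul_sum, ← Finset.sum_add_distrib]
    refine Finset.sum_congr rfl fun j _ => ?_
    rw [Derivation.leibniz, smul_eq_mul, smul_eq_mul, map_add, map_mul, map_mul]
    ring

/-- Differentiating a relation `g(p) = 0` with respect to `x_i` gives `∑_j (∂_j g)(p) · j (x_i +
β/2)^{j-1} = 0` for every `i`. So one polynomial over a domain has infinitely many roots, hence all
`(∂_j g)(p)` vanish. By induction on the degree all `∂_j g` vanish, so `g` is constant, and then
zero. -/
theorem evalBracket_injective : Function.Injective evalBracket := by
  rw [injective_iff_map_eq_zero]
  suffices h : ∀ (D : ℕ) (g : MvPolynomial OddNat K),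
      (∀ N : OddNat →₀ ℕ, D ≤ N.degree → MvPolynomial.coeff N g = 0) → evalBracket g = 0 → g = 0 by
    intro g hg
    refine h (g.totalDegree + 1) g (fun N hN => ?_) hg
    exact MvPolynomial.coeff_eq_zero_of_totalDegree_lt (by
      change _ < N.sum fun _ e => e
      rw [Finsupp.degree_apply] at hN
      exact hN)
  intro D
  induction D with
  | zero => intro g hg _; ext N; simpa using hg N (Nat.zero_le _)
  | succ D ih =>
    intro g hg hg0
    have hder : ∀ j ∈ g.vars, evalBracket (MvPolynomial.pderiv j g) = 0 := by
      set q : Polynomial (MvPowerSeries ℕ K) := ∑ j ∈ g.vars,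
        Polynomial.C (evalBracket (MvPolynomial.pderiv j g) * ((j : ℕ) : MvPowerSeries ℕ K)) *
          Polynomial.X ^ ((j : ℕ) - 1) with hq
      have hroot : ∀ i : ℕ, q.IsRoot (MvPowerSeries.X i + MvPowerSeries.C (β / 2)) := by
        intro i
        have h := pderiv_evalBracket i g g.vars subset_rfl
        rw [hg0, map_zero] at h
        rw [Polynomial.IsRoot, hq, Polynomial.eval_finsetSum, h]
        refine Finset.sum_congr rfl fun j _ => ?_
        simp [mul_assoc]
      have hq0 : q = 0 := by
        refine Polynomial.eq_zero_of_infinite_isRoot q ?_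
        refine Set.Infinite.mono (s := Set.range fun i : ℕ =>
          (MvPowerSeries.X i + MvPowerSeries.C (β / 2) : MvPowerSeries ℕ K)) ?_ ?_
        · rintro _ ⟨i, rfl⟩
          exact hroot i
        · refine Set.infinite_range_of_injective fun i k hik => ?_
          have := add_right_cancel hik
          exact MvPowerSeries.X_inj.mp this
      intro j hj
      have h := congrArg (Polynomial.coeff · ((j : ℕ) - 1)) hq0
      simp only [hq, Polynomial.finsetSum_coeff, Polynomial.coeff_C_mul, Polynomial.coeff_X_pow,
        Polynomial.coeff_zero] at h
      rw [Finset.sum_eq_single j] at h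
      · rw [if_pos rfl, mul_one] at h
        refine (mul_eq_zero.mp h).resolve_right ?_
        have : ((j : ℕ) : MvPowerSeries ℕ K) = MvPowerSeries.C ((j : ℕ) : K) := by simp
        rw [this]
        intro h0
        apply oddNat_cast_ne_zero j
        have := congrArg MvPowerSeries.constantCoeff h0
        simpa using this
      · intro k _ hk
        rw [if_neg, mul_zero]
        intro hc
        have h1 := k.2.pos
        have h2 := j.2.pos
        exact hk (Subtype.ext (by omega))
      · intro h'; exact absurd hj h'
    have hder0 : ∀ j, MvPolynomial.pderiv j g = 0 := by
      intro j
      by_cases hj : j ∈ g.vars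
      · refine ih _ (fun N hN => ?_) (hder j hj)
        rw [MvPolynomial.coeff_pderiv, hg, zero_mul]
        rw [map_add, Finsupp.degree_single]; omega
      · exact MvPolynomial.pderiv_eq_zero_of_notMem_vars hj
    have hconst : g = MvPolynomial.C (MvPolynomial.coeff 0 g) := by
      ext N
      rw [MvPolynomial.coeff_C]
      split_ifs with h
      · rw [h]
      · obtain ⟨j, hj⟩ : ∃ j, N j ≠ 0 := by
          by_contra! hc
          exact h (Finsupp.ext hc).symm
        obtain ⟨N', rfl⟩ : ∃ N', N = N' + Finsupp.single j 1 := by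
          refine ⟨N - Finsupp.single j 1, ?_⟩
          ext i
          by_cases hi : j = i
          · subst hi; simp; omega
          · simp [hi]
        have h1 := MvPolynomial.coeff_pderiv (i := j) g N'
        rw [hder0, MvPolynomial.coeff_zero] at h1
        refine (mul_eq_zero.mp h1.symm).resolve_right ?_
        exact_mod_cast Nat.succ_ne_zero (N' j)
    rw [hconst, evalBracket, MvPolynomial.aeval_C] at hg0
    have := congrArg MvPowerSeries.constantCoeff hg0
    rw [MvPowerSeries.algebraMap_apply] at this
    rw [hconst]
    simp at this
    rw [this, MvPolynomial.C_0]

/-! ### The boson-fermion correspondence -/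

theorem pairing_weight (N : OddNat →₀ ℕ) :
    (2 : K)⁻¹ ^ N.degree * (N.prod fun n e => ((n : ℕ) : K) ^ e * (e.factorial : K)) =
      (expWeight N)⁻¹ := by
  rw [Finsupp.degree_apply, ← Finset.prod_pow_eq_pow_sum, expWeight, Finsupp.prod, Finsupp.prod,
    ← Finset.prod_mul_distrib, ← Finset.prod_inv_distrib]
  refine Finset.prod_congr rfl fun j _ => ?_
  rw [div_pow, inv_div, inv_pow, div_div_eq_mul_div]
  ring

/-- The weight of the pairing is the inverse of `expWeight`. Pairing the series of `v` with the
polynomial of `w` therefore evaluates `v` on the expansion of `w*` in the monomial basis. -/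
theorem isOmega_expectH (v : Module.Dual K Bra) :
    IsOmega (v ∘ₗ braEven.subtype) (expectH (v ∘ₗ braEven.subtype)) := by
  refine ⟨braSeries v, (expectH_eq v).symm, fun w => ?_⟩
  obtain ⟨g, hg, hc⟩ := exists_evalBracket w
  refine ⟨g, hg, ?_⟩
  have h1 := eq_sum_creation (ketStar_mem_braEven w) g.support (fun N hN => by
    have := hc N
    rw [MvPolynomial.notMem_support_iff.mp hN] at this
    exact (mul_eq_zero.mp this.symm).resolve_left (expWeight_ne_zero N))
  have h2 : (v ∘ₗ braEven.subtype) (ketStarEven w) = v (ketStar (w : Ket)) := rfl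
  rw [h2]
  conv_rhs => rw [h1]
  rw [map_sum, pairing]
  refine Finset.sum_congr rfl fun N _ => ?_
  rw [pairing_weight, coeff_braSeries, hc, map_smul, smul_eq_mul]
  have := expWeight_ne_zero N
  field_simp

theorem braEven_creation (p : MvPolynomial OddNat K) {u : Bra} (hu : u ∈ braEven) :
    creation p u ∈ braEven := by
  induction p using MvPolynomial.induction_on generalizing u with
  | C a =>
    rw [← MvPolynomial.algebraMap_eq, AlgHom.commutes, Module.algebraMap_end_apply]
    exact Submodule.smul_mem _ _ hu
  | add p q hp hq => rw [map_add]; exact add_mem (hp hu) (hq hu)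
  | mul_X p i hp =>
    rw [map_mul, Module.End.mul_apply, creation_X]
    exact hp (braEven_current _ hu)

theorem isOmega_unique {v : KetHatEven} {F F' : MvPowerSeries ℕ K} (h : IsOmega v F)
    (h' : IsOmega v F') : F = F' := by
  obtain ⟨f, rfl, hf⟩ := h
  obtain ⟨f', rfl, hf'⟩ := h'
  classical
  congr 1
  ext N
  obtain ⟨X, hX, hXe⟩ := braEven_creation (MvPolynomial.monomial N 1) bra0_even
  have hw : ketNull.mkQ (star X) ∈ ketEven := ⟨star X, star_even hX, rfl⟩
  obtain ⟨g, hg, hc⟩ := exists_evalBracket ⟨_, hw⟩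
  -- The test vector is the star of the current monomial with exponent `N`. Its `χ` is a single
  -- monomial, so pairing with it isolates the coefficient at `N`. Injectivity of `evalBracket`
  -- ensures that both witnesses use this same polynomial.
  have hmono : g = MvPolynomial.monomial N 1 := by
    ext N'
    rw [hc, ketStar_mk, star_star, hXe, braVac_annihilation_creation]
  obtain ⟨g1, e1, p1⟩ := hf ⟨_, hw⟩
  obtain ⟨g2, e2, p2⟩ := hf' ⟨_, hw⟩
  rw [← hg] at e1 e2
  rw [evalBracket_injective e1] at p1
  rw [evalBracket_injective e2, ← p1] at p2
  have hp : ∀ f : MvPowerSeries OddNat K, pairing f g =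
      MvPowerSeries.coeff N f * (expWeight N)⁻¹ := by
    intro f
    rw [pairing, hmono, MvPolynomial.support_monomial, if_neg one_ne_zero, Finset.sum_singleton,
      pairing_weight, MvPolynomial.coeff_monomial, if_pos rfl, mul_one]
  rw [hp, hp] at p2
  exact (mul_right_cancel₀ (inv_ne_zero (expWeight_ne_zero N)) p2).symm

end KFermion

end

/-! ### Coherent states in finitely many variables. -/

noncomputable section

namespace KFermion

/-! ### Series of high order -/

/-- The ideal of power series without terms of degree less than `N`. -/
def lowIdeal (σ : Type) (N : ℕ) : Ideal (MvPowerSeries σ K) where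
  carrier := {f | ∀ d : σ →₀ ℕ, d.degree < N → MvPowerSeries.coeff d f = 0}
  add_mem' := by
    intro f g hf hg d hd
    rw [map_add, hf d hd, hg d hd, add_zero]
  zero_mem' := by intro d _; simp
  smul_mem' := by
    classical
    intro c f hf d hd
    rw [smul_eq_mul, MvPowerSeries.coeff_mul]
    refine Finset.sum_eq_zero fun a ha => ?_
    have had := congrArg Finsupp.degree (Finset.HasAntidiagonal.mem_antidiagonal.mp ha)
    rw [map_add] at had
    rw [hf _ (by omega), mul_zero]

variable {σ : Type}

theorem lowIdeal_mul {a b : ℕ} {f g : MvPowerSeries σ K} (hf : f ∈ lowIdeal σ a)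
    (hg : g ∈ lowIdeal σ b) : f * g ∈ lowIdeal σ (a + b) := by
  classical
  intro d hd
  rw [MvPowerSeries.coeff_mul]
  refine Finset.sum_eq_zero fun x hx => ?_
  have had := congrArg Finsupp.degree (Finset.HasAntidiagonal.mem_antidiagonal.mp hx)
  rw [map_add] at had
  by_cases h : x.1.degree < a
  · rw [hf _ h, zero_mul]
  · rw [hg _ (by omega), mul_zero]

theorem lowIdeal_pow {f : MvPowerSeries σ K} (hf : f ∈ lowIdeal σ 1) (k : ℕ) :
    f ^ k ∈ lowIdeal σ k := by
  induction k with
  | zero => intro d hd; omega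
  | succ k ih => rw [pow_succ]; exact lowIdeal_mul ih hf

theorem mem_lowIdeal_one {f : MvPowerSeries σ K} :
    f ∈ lowIdeal σ 1 ↔ MvPowerSeries.constantCoeff f = 0 := by
  constructor
  · intro h
    rw [← MvPowerSeries.coeff_zero_eq_constantCoeff_apply]
    exact h 0 (by simp)
  · intro h d hd
    rw [(Finsupp.degree_eq_zero_iff d).mp (by omega), MvPowerSeries.coeff_zero_eq_constantCoeff_apply,
      h]

theorem lowIdeal_anti {a b : ℕ} (h : a ≤ b) : lowIdeal σ b ≤ lowIdeal σ a :=
  fun _ hf d hd => hf d (by omega)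

theorem eq_of_forall_lowIdeal {f g : MvPowerSeries σ K} (h : ∀ N, f - g ∈ lowIdeal σ N) : f = g := by
  ext d
  have := h (d.degree + 1) d (by omega)
  rwa [map_sub, sub_eq_zero] at this

/-! ### Coherent states -/

/-- The series `x_i / (1 + β x_i / 2)`. -/
def tau (i : σ) : MvPowerSeries σ K :=
  MvPowerSeries.X i * (1 + MvPowerSeries.C (β / 2) * MvPowerSeries.X i)⁻¹

theorem tau_mul (i : σ) :
    tau i * (1 + MvPowerSeries.C (β / 2) * MvPowerSeries.X i) = MvPowerSeries.X i := by
  rw [tau, mul_assoc, MvPowerSeries.inv_mul_cancel _ (by simp), mul_one]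

theorem tau_mem (i : σ) : tau i ∈ lowIdeal σ 1 := by
  rw [mem_lowIdeal_one]; simp [tau]

/-- The power sum `∑_{i ∈ S} τ_i^j`. -/
def tauSum (S : Finset σ) (j : ℕ) : MvPowerSeries σ K := ∑ i ∈ S, tau i ^ j

theorem tauSum_mem (S : Finset σ) (j : ℕ) : tauSum S j ∈ lowIdeal σ j :=
  Ideal.sum_mem _ fun i _ => lowIdeal_pow (tau_mem i) j

theorem hasSubst_tauSum (S : Finset σ) :
    MvPowerSeries.HasSubst (fun j : OddNat => tauSum S (j : ℕ)) where
  const_coeff j := by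
    rw [mem_lowIdeal_one.mp (lowIdeal_anti j.2.pos (tauSum_mem S j))]
    exact IsNilpotent.zero
  coeff_zero d := by
    refine Set.Finite.subset ((Set.finite_Iic d.degree).preimage
      (f := (Subtype.val : OddNat → ℕ)) Subtype.val_injective.injOn) ?_
    intro n hn
    by_contra hc
    simp only [Set.mem_preimage, Set.mem_Iic, not_le] at hc
    exact hn (tauSum_mem S n d hc)

/-- `braSeries` as a linear map. -/
def braSeriesLin : Module.Dual K Bra →ₗ[K] MvPowerSeries OddNat K where
  toFun := braSeries
  map_add' v w := by
    ext N
    simp only [map_add, coeff_braSeries, LinearMap.add_apply, mul_add]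
  map_smul' c v := by
    ext N
    simp only [map_smul, coeff_braSeries, LinearMap.smul_apply, smul_eq_mul, RingHom.id_apply]
    ring

/-- The coherent state `⟨0|exp(2 ∑_j s_j b_j / j)` with `s_j = ∑_{i ∈ S} τ_i^j`, as the family of
its pairings with functionals. -/
def coherent (S : Finset σ) : Module.Dual K Bra →ₗ[K] MvPowerSeries σ K :=
  (MvPowerSeries.substAlgHom (hasSubst_tauSum S)).toLinearMap ∘ₗ braSeriesLin

theorem coherent_apply (S : Finset σ) (v : Module.Dual K Bra) :
    coherent S v = MvPowerSeries.substAlgHom (hasSubst_tauSum S) (braSeries v) := rfl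

theorem coeff_braSeries_annihilation (v : Module.Dual K Bra) (j : OddNat) (N : OddNat →₀ ℕ) :
    MvPowerSeries.coeff N (braSeries (v ∘ₗ braCurrent (-((j : ℕ) : ℤ)))) =
      expWeight N * (((j : ℕ) : K) / 2 * (N j *
        v (creation (MvPolynomial.monomial (N - Finsupp.single j 1) 1) bra0))) := by
  rw [coeff_braSeries, LinearMap.comp_apply, annihilation_creation, MvPolynomial.pderiv_monomial,
    one_mul, map_smul, smul_eq_mul]
  have : MvPolynomial.monomial (N - Finsupp.single j 1) (N j : K) =
      (N j : K) • MvPolynomial.monomial (N - Finsupp.single j 1) 1 := by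
    rw [MvPolynomial.smul_monomial, smul_eq_mul, mul_one]
  rw [this, map_smul, LinearMap.smul_apply, map_smul, smul_eq_mul]

theorem braSeries_annihilation (v : Module.Dual K Bra) (j : OddNat) :
    braSeries (v ∘ₗ braCurrent (-((j : ℕ) : ℤ))) = MvPowerSeries.X j * braSeries v := by
  classical
  ext N
  rw [coeff_braSeries_annihilation]
  by_cases h : N j = 0
  · rw [h, MvPowerSeries.X_dvd_iff.mp (dvd_mul_right _ _) N h]
    simp
  · obtain ⟨N', rfl⟩ : ∃ N', N = N' + Finsupp.single j 1 := by
      refine ⟨N - Finsupp.single j 1, ?_⟩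
      ext i
      by_cases hi : j = i
      · subst hi; simp; omega
      · simp [hi]
    have h1 := expWeight_add_single N' j
    have hj := oddNat_cast_ne_zero j
    rw [add_tsub_cancel_right, mul_comm (MvPowerSeries.X j), MvPowerSeries.X,
      MvPowerSeries.coeff_add_mul_monomial, mul_one, coeff_braSeries, Finsupp.add_apply,
      Finsupp.single_eq_same]
    have h2 : expWeight N' = expWeight (N' + Finsupp.single j 1) * (N' j + 1) * (((j : ℕ) : K) / 2) := by
      rw [h1]; field_simp
    rw [h2]
    push_cast
    ring

/-- The defining property of a coherent state: `b_{-j}` acts as `(j/2) ∂/∂b_j` on the exponential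
and brings down the eigenvalue `∑ τ_i^j`. -/
theorem coherent_annihilation (S : Finset σ) (v : Module.Dual K Bra) (j : OddNat) :
    coherent S (v ∘ₗ braCurrent (-((j : ℕ) : ℤ))) = tauSum S j * coherent S v := by
  rw [coherent_apply, braSeries_annihilation, map_mul, MvPowerSeries.substAlgHom_X]
  rfl

theorem braFil_creation (N : OddNat →₀ ℕ) :
    creation (MvPolynomial.monomial N 1) bra0 ∈ braFil (size N) := by
  induction N using multiset_induction with
  | h0 =>
    have : MvPolynomial.monomial (0 : OddNat →₀ ℕ) (1 : K) = 1 := rfl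
    simpa [this] using bra0_mem_braFil
  | hs N j ih =>
    have e : MvPolynomial.monomial (N + Finsupp.single j 1) (1 : K) =
        MvPolynomial.X j * MvPolynomial.monomial N 1 := by
      rw [mul_comm, MvPolynomial.X, MvPolynomial.monomial_mul, one_mul]
    rw [e, map_mul, Module.End.mul_apply, creation_X, map_add, Finsupp.weight_single,
      smul_eq_mul, one_mul, Nat.cast_add]
    exact braFil_current _ ih

/-- Each coefficient of the coherent state is an honest even vector of bounded degree. Evenness
feeds the separation principle, and the degree bound makes infinite operator sums converge. -/
theorem exists_coherent_vector (S : Finset σ) (d : σ →₀ ℕ) :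
    ∃ u ∈ braEven, u ∈ braFil d.degree ∧ ∀ v, MvPowerSeries.coeff d (coherent S v) = v u := by
  set c : (OddNat →₀ ℕ) → K := fun N =>
    MvPowerSeries.coeff d (N.prod fun j e => tauSum S (j : ℕ) ^ e) with hc
  have hsz : ∀ N, d.degree < size N → c N = 0 := fun N hN =>
    coeff_prod_eq_zero (fun j a h => tauSum_mem S j a h) N d hN
  have hfin : (Function.support fun N => (expWeight N * c N) •
      creation (MvPolynomial.monomial N 1) bra0).Finite := by
    have h := MvPowerSeries.coeff_subst_finite (hasSubst_tauSum S)
      (fun _ => (1 : K) : MvPowerSeries OddNat K) d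
    refine Set.Finite.subset h fun N hN hc' => hN ?_
    have h1 : MvPowerSeries.coeff N (fun _ => (1 : K) : MvPowerSeries OddNat K) = 1 := rfl
    simp only [h1, one_smul] at hc'
    simp only [hc, hc', mul_zero, zero_smul]
  refine ⟨∑ᶠ N, (expWeight N * c N) • creation (MvPolynomial.monomial N 1) bra0, ?_, ?_, ?_⟩
  · exact finsum_induction (· ∈ braEven) (zero_mem _) (fun _ _ => add_mem)
      fun N => Submodule.smul_mem _ _ (braEven_creation _ bra0_even)
  · refine finsum_induction (· ∈ braFil d.degree) (zero_mem _) (fun _ _ => add_mem) fun N => ?_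
    by_cases hN : d.degree < size N
    · rw [hsz N hN, mul_zero, zero_smul]
      exact zero_mem _
    · exact Submodule.smul_mem _ _ (braFil_mono (by exact_mod_cast not_lt.mp hN) (braFil_creation N))
  · intro v
    have hv : v (∑ᶠ N, (expWeight N * c N) • creation (MvPolynomial.monomial N 1) bra0) =
        ∑ᶠ N, v ((expWeight N * c N) • creation (MvPolynomial.monomial N 1) bra0) :=
      AddMonoidHom.map_finsum v.toAddMonoidHom hfin
    rw [coherent_apply, MvPowerSeries.substAlgHom_apply,
      MvPowerSeries.coeff_subst (hasSubst_tauSum S), hv]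
    refine finsum_congr fun N => ?_
    rw [coeff_braSeries, map_smul, smul_eq_mul, smul_eq_mul]
    ring

theorem coherent_braVac (S : Finset σ) : coherent S braVac = 1 := by
  classical
  have : braSeries braVac = 1 := by
    ext N
    rw [coeff_braSeries, braVac_creation, MvPolynomial.coeff_monomial, MvPowerSeries.coeff_one]
    split_ifs with h
    · rw [h, expWeight_zero, mul_one]
    · rw [mul_zero]
  rw [coherent_apply, this, map_one]

/-! ### The coherent states and a single fermion -/

theorem braVac_braJ_φ_bra0 (m : ℤ) : braVac (braJ (braMul (φ m) bra0)) = if m = 0 then 1 else 0 := by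
  rcases lt_trichotomy m 0 with h | h | h
  · rw [braJ_braMul, braVac_φ h, if_neg h.ne]
  · subst h
    rw [if_pos rfl, bra0, braMul_mk, braJ_mk, one_mul, φ_zero_sq]
    exact braVac_bra0
  · rw [bra0_φ h, map_zero, map_zero, if_neg h.ne']

/-- Moving `b_j` to the right past `φ_m` leaves `φ_{m-j}`, and `b_j` itself kills the ket vacuum.
Each current thus lowers the mode by its index, until `⟨φ_0 φ_m⟩ = δ_{m,0}` for the remaining mode.
-/
theorem braVac_braJ_φ_creation (N : OddNat →₀ ℕ) (m : ℤ) :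
    braVac (braJ (braMul (φ m) (creation (MvPolynomial.monomial N 1) bra0))) =
      if m = size N then 1 else 0 := by
  induction N using multiset_induction generalizing m with
  | h0 =>
    have : MvPolynomial.monomial (0 : OddNat →₀ ℕ) (1 : K) = 1 := rfl
    rw [this, map_one, Module.End.one_apply, braVac_braJ_φ_bra0, map_zero, Nat.cast_zero]
  | hs N j ih =>
    have e : MvPolynomial.monomial (N + Finsupp.single j 1) (1 : K) =
        MvPolynomial.X j * MvPolynomial.monomial N 1 := by
      rw [mul_comm, MvPolynomial.X, MvPolynomial.monomial_mul, one_mul]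
    rw [e, map_mul, Module.End.mul_apply, creation_X, braMul_φ_current (oddNat_cast j), map_add,
      map_add, braJ_current, braVac_current (by have := j.2.pos; omega), zero_add, ih, map_add,
      Finsupp.weight_single, smul_eq_mul, one_mul]
    congr 1
    apply propext
    push_cast
    constructor <;> intro h <;> omega

/-- The functional `⟨u| ↦ ⟨0|φ_0 u φ_m|0⟩`. -/
def vacφ (m : ℕ) : Module.Dual K Bra := braVac ∘ₗ braJ ∘ₗ braMul (φ m)

theorem coeff_braSeries_vacφ (m : ℕ) (N : OddNat →₀ ℕ) :
    MvPowerSeries.coeff N (braSeries (vacφ m)) = if m = size N then expWeight N else 0 := by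
  rw [coeff_braSeries]
  have := braVac_braJ_φ_creation N m
  simp only [Nat.cast_inj] at this
  rw [vacφ, LinearMap.comp_apply, LinearMap.comp_apply, this, mul_ite, mul_one, mul_zero]

theorem braSeries_vacφ_zero : braSeries (vacφ 0) = 1 := by
  classical
  ext N
  rw [coeff_braSeries_vacφ, MvPowerSeries.coeff_one]
  by_cases h : N = 0
  · subst h; simp [expWeight_zero]
  · rw [if_neg h, if_neg]
    intro h0
    have := degree_le_size N
    exact h ((Finsupp.degree_eq_zero_iff N).mp (by omega))

/-- The Newton recursion `m q_m = 2 ∑_{j odd} p_j q_{m-j}` of Schur's functions `q_m`.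
Coefficientwise it says that `∑ j N_j` is the size of `N`. -/
theorem braSeries_vacφ_rec (m : ℕ) : (m : K) • braSeries (vacφ m) =
    ∑ j ∈ oddUpTo m, (2 : K) • (MvPowerSeries.X j * braSeries (vacφ (m - j))) := by
  classical
  ext N
  rw [map_smul, map_sum, coeff_braSeries_vacφ]
  have key : ∀ j ∈ oddUpTo m, MvPowerSeries.coeff N
      ((2 : K) • (MvPowerSeries.X j * braSeries (vacφ (m - j)))) =
      (if m = size N then expWeight N else 0) * (((N j) * (j : ℕ) : ℕ) : K) := by
    intro j hj
    rw [mem_oddUpTo] at hj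
    rw [map_smul, ← braSeries_annihilation, coeff_braSeries_annihilation, vacφ,
      LinearMap.comp_apply, LinearMap.comp_apply, braVac_braJ_φ_creation, smul_eq_mul]
    by_cases h : N j = 0
    · rw [h]; simp
    · have hs : size N = size (N - Finsupp.single j 1) + j := by
        have e : N = N - Finsupp.single j 1 + Finsupp.single j 1 := by
          ext i
          by_cases hi : j = i
          · subst hi; simp; omega
          · simp [hi]
        conv_lhs => rw [e]
        rw [map_add, Finsupp.weight_single, smul_eq_mul, one_mul]
      by_cases hm : m = size N
      · rw [if_pos hm, if_pos (by omega)]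
        push_cast
        ring
      · rw [if_neg hm, if_neg (by omega)]
        ring
  rw [Finset.sum_congr rfl key, ← Finset.mul_sum, ← Nat.cast_sum]
  split_ifs with h
  · have : ∑ j ∈ oddUpTo m, N j * (j : ℕ) = m := by
      conv_rhs => rw [h, Finsupp.weight_apply, Finsupp.sum]
      refine (Finset.sum_subset ?_ fun j _ hj => ?_).symm
      · intro j hj
        rw [mem_oddUpTo, h]
        exact le_size hj
      · rw [Finsupp.notMem_support_iff.mp hj, zero_mul]
    rw [this, smul_eq_mul, mul_comm]
  · rw [smul_zero, zero_mul]

theorem coherent_vacφ_zero (S : Finset σ) : coherent S (vacφ 0) = 1 := by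
  rw [coherent_apply, braSeries_vacφ_zero, map_one]

theorem coherent_vacφ_rec (S : Finset σ) (m : ℕ) : (m : K) • coherent S (vacφ m) =
    ∑ j ∈ oddUpTo m, (2 : K) • (tauSum S j * coherent S (vacφ (m - j))) := by
  rw [coherent_apply, ← map_smul, braSeries_vacφ_rec, map_sum]
  refine Finset.sum_congr rfl fun j _ => ?_
  rw [map_smul, map_mul, MvPowerSeries.substAlgHom_X]
  rfl

end KFermion

end

/-! ### Partial fractions of `∏ (1 + t_i w) / (1 - t_i w)`. -/

noncomputable section

namespace KFermion

/-! ### Partial fractions -/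

section PartialFractions

variable {F ι : Type} [Field F] [DecidableEq ι]

/-- The residues of `∏_i (1 + t_i w) / (1 - t_i w)`. -/
def residue (t : ι → F) (S : Finset ι) (i : ι) : F :=
  2 * ∏ j ∈ S.erase i, (t i + t j) / (t i - t j)

-- The partial fraction expansion with denominators cleared; `(-1)^|S|` is the value of the product
-- at infinity. The difference of the two sides has degree less than `|S|`, since the leading
-- coefficients cancel, and it vanishes at the `|S|` distinct points `t_i⁻¹`.
open Polynomial in
theorem prod_one_add_eq (t : ι → F) (S : Finset ι) (hinj : Set.InjOn t S) (h0 : ∀ i ∈ S, t i ≠ 0) :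
    ∏ i ∈ S, (1 + C (t i) * X) = (-1) ^ S.card * ∏ i ∈ S, (1 - C (t i) * X) +
      ∑ i ∈ S, C (residue t S i) * ∏ j ∈ S.erase i, (1 - C (t j) * X) := by
  have hd1 : ∀ c : F, (1 + C c * X).natDegree ≤ 1 := fun c => by compute_degree
  have hd2 : ∀ c : F, (1 - C c * X).natDegree ≤ 1 := fun c => by compute_degree
  have hdeg : ∀ (f : ι → F[X]) (T : Finset ι), (∀ i, (f i).natDegree ≤ 1) →
      (∏ i ∈ T, f i).natDegree ≤ T.card := fun f T hf =>
    (natDegree_prod_le T f).trans ((Finset.sum_le_card_nsmul _ _ 1 fun i _ => hf i).trans (by simp))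
  rw [← sub_eq_iff_eq_add']
  refine eq_of_degree_sub_lt_of_eval_index_eq S (v := fun i => (t i)⁻¹)
    (fun i hi j hj h => hinj hi hj (inv_injective h)) ?_ ?_
  · rcases S.eq_empty_or_nonempty with rfl | hS
    · simp
    rw [degree_lt_iff_coeff_zero]
    intro m hm
    rw [coeff_sub, coeff_sub, finsetSum_coeff, Finset.sum_eq_zero, sub_zero]
    · have e : (-1 : F[X]) ^ S.card = C ((-1) ^ S.card) := by simp
      rw [e, coeff_C_mul]
      rcases hm.eq_or_lt with rfl | hm
      · have h1 := coeff_prod_of_natDegree_le S (fun i => 1 + C (t i) * X) 1 fun i _ => hd1 _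
        have h2 := coeff_prod_of_natDegree_le S (fun i => 1 - C (t i) * X) 1 fun i _ => hd2 _
        rw [mul_one] at h1 h2
        rw [h1, h2]
        simp [coeff_one, Finset.prod_neg, ← mul_assoc, ← mul_pow]
      · rw [coeff_eq_zero_of_natDegree_lt ((hdeg _ S fun i => hd1 _).trans_lt hm),
          coeff_eq_zero_of_natDegree_lt ((hdeg _ S fun i => hd2 _).trans_lt hm)]
        simp
    · intro i hi
      rw [coeff_C_mul, coeff_eq_zero_of_natDegree_lt, mul_zero]
      refine (hdeg _ _ fun i => hd2 _).trans_lt ?_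
      rw [Finset.card_erase_of_mem hi]
      have := Finset.card_pos.mpr hS
      omega
  · intro i hi
    have hti := h0 i hi
    simp only [eval_sub, eval_mul, eval_prod, eval_finsetSum, eval_add, eval_one, eval_C, eval_X]
    rw [Finset.prod_eq_zero (s := S) (f := fun j => 1 - t j * (t i)⁻¹) hi
      (by rw [mul_inv_cancel₀ hti, sub_self]), mul_zero, sub_zero, Finset.sum_eq_single_of_mem i hi]
    · rw [residue, mul_assoc, ← Finset.prod_mul_distrib, ← Finset.mul_prod_erase S _ hi,
        mul_inv_cancel₀ hti]
      congr 1
      · norm_num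
      refine Finset.prod_congr rfl fun j hj => ?_
      have hne : t i - t j ≠ 0 := sub_ne_zero.mpr fun h =>
        (Finset.ne_of_mem_erase hj) (hinj hi (Finset.mem_of_mem_erase hj) h).symm
      field_simp
    · intro j _ hji
      rw [Finset.prod_eq_zero (i := i) (Finset.mem_erase.mpr ⟨hji.symm, hi⟩)
        (by rw [mul_inv_cancel₀ hti, sub_self]), mul_zero]

theorem sum_residue_div (t : ι → F) (S : Finset ι) (hinj : Set.InjOn t S)
    (h0 : ∀ i ∈ S, t i ≠ 0) (w : F) (hw : ∀ i ∈ S, 1 - t i * w ≠ 0) :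
    ∑ i ∈ S, residue t S i / (1 - t i * w) + (-1) ^ S.card =
      ∏ i ∈ S, (1 + t i * w) / (1 - t i * w) := by
  have h := congrArg (Polynomial.eval w) (prod_one_add_eq t S hinj h0)
  simp only [Polynomial.eval_add, Polynomial.eval_sub, Polynomial.eval_mul, Polynomial.eval_prod,
    Polynomial.eval_finsetSum, Polynomial.eval_one, Polynomial.eval_C, Polynomial.eval_X,
    Polynomial.eval_pow, Polynomial.eval_neg] at h
  have hB : ∏ i ∈ S, (1 - t i * w) ≠ 0 := Finset.prod_ne_zero_iff.mpr hw
  rw [Finset.prod_div_distrib, eq_div_iff hB, h, add_mul, add_comm, Finset.sum_mul]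
  congr 1
  refine Finset.sum_congr rfl fun i hi => ?_
  rw [← Finset.mul_prod_erase S _ hi, ← mul_assoc, div_mul_cancel₀ _ (hw i hi)]

open PowerSeries in
/-- The odd part of `1 / (1 - t w)`. -/
def oddGeom (t : F) : PowerSeries F := PowerSeries.mk fun k => if Odd k then t ^ k else 0

open PowerSeries in
theorem oddGeom_mul (t : F) : (1 - C t * X) * (1 + C t * X) * oddGeom t = C t * X := by
  have e : (1 - C t * X) * (1 + C t * X) * oddGeom t =
      oddGeom t - C (t ^ 2) * (X ^ 2 * oddGeom t) := by
    rw [map_pow]; ring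
  rw [e]
  ext k
  rw [map_sub, coeff_C_mul, coeff_C_mul, coeff_X_pow_mul']
  rcases k with _ | _ | k
  · simp [oddGeom]
  · simp [oddGeom]
  · have : Odd (k + 1 + 1) ↔ Odd k := by
      simp only [Nat.odd_iff]; omega
    simp only [oddGeom, coeff_mk, this, coeff_X]
    rw [if_pos (show 2 ≤ k + 1 + 1 by omega), show k + 1 + 1 - 2 = k by omega, if_neg (show ¬ k + 1 + 1 = 1 by omega)]
    split_ifs <;> ring

-- Logarithmic derivative: `X h'/h` for `h = (1 + tX)/(1 - tX)` is `tX/(1 - tX) + tX/(1 + tX)`,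
-- twice the odd part of the geometric series.
open PowerSeries in
theorem single_factor {t : F} {h : PowerSeries F} (hh : (1 - C t * X) * h = 1 + C t * X) :
    X * derivative F h = 2 * oddGeom t * h := by
  have hd := congrArg (derivative F) hh
  have hdX : derivative F (C t * X) = C t := by
    rw [Derivation.leibniz]
    simp
  rw [Derivation.leibniz, map_sub, map_add, hdX, Derivation.map_one_eq_zero, smul_eq_mul, smul_eq_mul] at hd
  have h1 : (1 - C t * X : PowerSeries F) ≠ 0 := fun h => by simpa using congrArg constantCoeff h
  have h2 : (1 + C t * X : PowerSeries F) ≠ 0 := fun h => by simpa using congrArg constantCoeff h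
  refine mul_left_cancel₀ (mul_ne_zero (mul_ne_zero h1 h1) h2) ?_
  have ho := oddGeom_mul t
  linear_combination (X * (1 - C t * X) * (1 + C t * X)) * hd +
    (C t * X * (1 + C t * X) - 2 * (1 - C t * X) * (1 + C t * X) * oddGeom t) * hh -
      2 * (1 + C t * X) * ho

open PowerSeries in
theorem prod_factor (t : ι → F) (S : Finset ι) (h : ι → PowerSeries F)
    (hh : ∀ i, (1 - C (t i) * X) * h i = 1 + C (t i) * X) :
    X * derivative F (∏ i ∈ S, h i) = 2 * (∑ i ∈ S, oddGeom (t i)) * ∏ i ∈ S, h i := by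
  induction S using Finset.induction_on with
  | empty => simp
  | insert i S hi ih =>
    rw [Finset.prod_insert hi, Finset.sum_insert hi, Derivation.leibniz, smul_eq_mul, smul_eq_mul]
    linear_combination h i * ih + (∏ i ∈ S, h i) * single_factor (hh i)

open PowerSeries in
theorem geom_mul (t : F) : (1 - C t * X) * PowerSeries.mk (fun k => t ^ k) = 1 := by
  ext k
  rw [sub_mul, one_mul, mul_assoc, map_sub, coeff_C_mul]
  rcases k with _ | k
  · simp
  · rw [coeff_succ_X_mul, coeff_mk, coeff_mk, coeff_one, if_neg (by omega)]; ring

-- The recursion is the differential equation for the logarithmic derivative of `∏ (1 + t_i X)/(1 -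
-- t_i X)`. In characteristic zero it has one solution with `e 0 = 1`, and partial fractions give
-- its coefficients in closed form.
open PowerSeries in
theorem eq_of_recursion [CharZero F] (t : ι → F) (S : Finset ι) (hinj : Set.InjOn t S)
    (h0 : ∀ i ∈ S, t i ≠ 0) (e : ℕ → F) (he0 : e 0 = 1)
    (hrec : ∀ m : ℕ, (m : F) * e m = ∑ j ∈ oddUpTo m, 2 * ((∑ i ∈ S, t i ^ (j : ℕ)) * e (m - j)))
    (m : ℕ) :
    e m = ∑ i ∈ S, residue t S i * t i ^ m + if m = 0 then (-1) ^ S.card else 0 := by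
  set h : ι → PowerSeries F := fun i => (1 + C (t i) * X) * PowerSeries.mk fun k => t i ^ k with hdef
  have hh : ∀ i, (1 - C (t i) * X) * h i = 1 + C (t i) * X := fun i => by
    rw [hdef, mul_left_comm, geom_mul, mul_one]
  have hode := prod_factor t S h hh
  set H := ∏ i ∈ S, h i with hH
  have hH0 : coeff 0 H = 1 := by
    rw [hH, coeff_zero_eq_constantCoeff_apply, map_prod]
    refine Finset.prod_eq_one fun i _ => ?_
    rw [hdef, map_mul, ← coeff_zero_eq_constantCoeff_apply (PowerSeries.mk _)]
    simp
  have hHrec : ∀ m : ℕ, (m : F) * coeff m H =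
      ∑ j ∈ oddUpTo m, 2 * ((∑ i ∈ S, t i ^ (j : ℕ)) * coeff (m - j) H) := by
    intro m
    have h1 := congrArg (coeff m) hode
    have h2 : coeff m (X * derivative F H) = (m : F) * coeff m H := by
      rcases m with _ | m
      · simp
      · rw [coeff_succ_X_mul, coeff_derivative]; push_cast; ring
    have h3 : (2 : PowerSeries F) = C 2 := (map_ofNat C 2).symm
    rw [h2, mul_assoc, h3, coeff_C_mul, coeff_mul, Finset.Nat.sum_antidiagonal_eq_sum_range_succ
      (fun i j => coeff i (∑ i ∈ S, oddGeom (t i)) * coeff j H)] at h1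
    rw [h1, oddUpTo, Finset.sum_subtype_eq_sum_filter (s := Finset.range (m + 1)) (p := Odd)
      (f := fun j => 2 * ((∑ i ∈ S, t i ^ j) * coeff (m - j) H)), Finset.sum_filter, Finset.mul_sum]
    refine Finset.sum_congr rfl fun j _ => ?_
    simp only [map_sum, oddGeom, coeff_mk]
    split_ifs <;> simp
  have heH : ∀ m, e m = coeff m H := by
    intro m
    induction m using Nat.strong_induction_on with
    | _ m ih =>
      rcases Nat.eq_zero_or_pos m with rfl | hm
      · rw [he0, hH0]
      · refine mul_left_cancel₀ (Nat.cast_ne_zero.mpr hm.ne' : (m : F) ≠ 0) ?_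
        rw [hrec, hHrec]
        refine Finset.sum_congr rfl fun j hj => ?_
        have := j.2.pos
        rw [ih (m - j) (by omega)]
  have hB0 : ∏ i ∈ S, (1 - C (t i) * X : PowerSeries F) ≠ 0 :=
    Finset.prod_ne_zero_iff.mpr fun i _ h => by simpa using congrArg constantCoeff h
  have hpf : H = (-1) ^ S.card + ∑ i ∈ S, C (residue t S i) * PowerSeries.mk fun k => t i ^ k := by
    refine mul_left_cancel₀ hB0 ?_
    have h1 : (∏ i ∈ S, (1 - C (t i) * X : PowerSeries F)) * H = ∏ i ∈ S, (1 + C (t i) * X) := by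
      rw [hH, ← Finset.prod_mul_distrib]
      exact Finset.prod_congr rfl fun i _ => hh i
    have h2 := congrArg (Polynomial.coeToPowerSeries.ringHom (R := F)) (prod_one_add_eq t S hinj h0)
    simp only [map_add, map_sub, map_mul, map_prod, map_sum, map_one, map_pow, map_neg,
      Polynomial.coeToPowerSeries.ringHom_apply, Polynomial.coe_C, Polynomial.coe_X] at h2
    rw [h1, h2, mul_add, mul_comm, Finset.mul_sum]
    congr 1
    refine Finset.sum_congr rfl fun i hi => ?_
    rw [← Finset.mul_prod_erase S _ hi]
    linear_combination -(C (residue t S i) * ∏ j ∈ S.erase i, (1 - C (t j) * X)) * geom_mul (t i)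
  rw [heH, hpf, map_add, map_sum, add_comm]
  have h4 : (-1 : PowerSeries F) ^ S.card = C ((-1) ^ S.card) := by simp
  rw [h4, coeff_C]
  simp only [coeff_C_mul, coeff_mk]

end PartialFractions

end KFermion

end

/-! ### The Wick formula for coherent states. -/

noncomputable section

namespace KFermion

variable {σ : Type}

/-! ### Removing one fermion from a coherent state -/

theorem tau_injective : Function.Injective (tau : σ → MvPowerSeries σ K) := by
  intro i j h
  have hi := tau_mul i
  have hj := tau_mul j
  rw [h] at hi
  have e : (MvPowerSeries.X i : MvPowerSeries σ K) = MvPowerSeries.X j := by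
    linear_combination (1 + MvPowerSeries.C (β / 2) * MvPowerSeries.X i) * hj -
      (1 + MvPowerSeries.C (β / 2) * MvPowerSeries.X j) * hi
  exact MvPowerSeries.X_inj.mp e

theorem tau_ne_zero (i : σ) : tau i ≠ 0 := by
  intro h
  have := tau_mul i
  rw [h, zero_mul] at this
  have h1 := congrArg (MvPowerSeries.coeff (Finsupp.single i 1)) this
  simp [MvPowerSeries.coeff_index_single_self_X] at h1

/-- A family of power series indexed by the functionals on `F*` whose coefficients are the
evaluations at vectors `y` with `φ_0 y` even. -/
def Represented (F : Module.Dual K Bra → MvPowerSeries σ K) : Prop :=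
  ∀ d, ∃ y, braJ y ∈ braEven ∧ ∀ v, MvPowerSeries.coeff d (F v) = v y

theorem Represented.add {F G : Module.Dual K Bra → MvPowerSeries σ K} (hF : Represented F)
    (hG : Represented G) : Represented fun v => F v + G v := by
  intro d
  obtain ⟨y, hy, hy'⟩ := hF d
  obtain ⟨z, hz, hz'⟩ := hG d
  exact ⟨y + z, by rw [map_add]; exact add_mem hy hz, fun v => by rw [map_add, map_add, hy', hz']⟩

theorem Represented.mul {F : Module.Dual K Bra → MvPowerSeries σ K} (hF : Represented F)
    (c : MvPowerSeries σ K) : Represented fun v => c * F v := by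
  classical
  intro d
  choose y hy hy' using hF
  refine ⟨∑ a ∈ Finset.HasAntidiagonal.antidiagonal d, MvPowerSeries.coeff a.1 c • y a.2, ?_, ?_⟩
  · rw [map_sum]
    exact Submodule.sum_mem _ fun a _ => by rw [map_smul]; exact Submodule.smul_mem _ _ (hy _)
  · intro v
    rw [MvPowerSeries.coeff_mul, map_sum]
    exact Finset.sum_congr rfl fun a _ => by rw [map_smul, smul_eq_mul, hy']

theorem Represented.sum {ι : Type} (s : Finset ι)
    {F : ι → Module.Dual K Bra → MvPowerSeries σ K} (hF : ∀ i, Represented (F i)) :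
    Represented fun v => ∑ i ∈ s, F i v := by
  classical
  induction s using Finset.induction_on with
  | empty => intro d; exact ⟨0, by simp, fun v => by simp⟩
  | insert i s hi ih => simpa only [Finset.sum_insert hi] using (hF i).add ih

theorem represented_coherent_φ (S : Finset σ) (m : ℕ) :
    Represented fun v => coherent S (v ∘ₗ braMul (φ m)) := by
  intro d
  obtain ⟨u, hu, -, hu'⟩ := exists_coherent_vector S d
  refine ⟨braMul (φ m) u, ?_, fun v => hu' _⟩
  obtain ⟨X, hX, rfl⟩ := hu
  have h1 := SetLike.mul_mem_graded (A := CliffordAlgebra.evenOdd Q)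
    (SetLike.mul_mem_graded (A := CliffordAlgebra.evenOdd Q)
    (CliffordAlgebra.ι_mem_evenOdd_one Q (Finsupp.single 0 1)) hX)
    (CliffordAlgebra.ι_mem_evenOdd_one Q (Finsupp.single (m : ℤ) 1))
  rw [add_zero, show (1 + 1 : ZMod 2) = 0 from rfl, mul_assoc] at h1
  exact ⟨_, h1, rfl⟩

theorem represented_coherent_braJ (S : Finset σ) : Represented fun v => coherent S (v ∘ₗ braJ) := by
  intro d
  obtain ⟨u, hu, -, hu'⟩ := exists_coherent_vector S d
  exact ⟨braJ u, by rwa [braJ_braJ], fun v => hu' _⟩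

/-- Since `φ_0 y` is even for every representing vector `y`, the separation principle applies after
multiplication by `φ_0` on the left, which is an involution. -/
theorem Represented.eq_zero {F : Module.Dual K Bra → MvPowerSeries σ K} (hF : Represented F)
    (h : ∀ N, F (braVac ∘ₗ annihilation (MvPolynomial.monomial N 1) ∘ₗ braJ) = 0)
    (v : Module.Dual K Bra) : F v = 0 := by
  ext d
  obtain ⟨y, hy, hy'⟩ := hF d
  have h0 : braJ y = 0 := eq_zero_of_annihilation hy fun N => by
    rw [← LinearMap.comp_apply, ← LinearMap.comp_apply, LinearMap.comp_assoc, ← hy', h, map_zero]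
  rw [hy', ← braJ_braJ y, h0, map_zero, map_zero, map_zero]

theorem comp_braJ_braJ (v : Module.Dual K Bra) : (v ∘ₗ braJ) ∘ₗ braJ = v := by
  ext u
  simp only [LinearMap.comp_apply, braJ_braJ]

theorem comp_current_braJ (v : Module.Dual K Bra) (m : ℤ) :
    (v ∘ₗ braCurrent m) ∘ₗ braJ = (v ∘ₗ braJ) ∘ₗ braCurrent m := by
  ext u
  simp only [LinearMap.comp_apply, braJ_current]

theorem comp_annihilation_φ (v : Module.Dual K Bra) (j : OddNat) (m : ℕ) :
    (v ∘ₗ braCurrent (-((j : ℕ) : ℤ))) ∘ₗ braMul (φ m) =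
      (v ∘ₗ braMul (φ m)) ∘ₗ braCurrent (-((j : ℕ) : ℤ)) - v ∘ₗ braMul (φ ((m + j : ℕ) : ℤ)) := by
  ext u
  simp only [LinearMap.comp_apply, LinearMap.sub_apply]
  rw [braMul_φ_current (oddNat_cast j).neg, map_add, sub_neg_eq_add, Nat.cast_add]
  ring

/-- The field of fractions of the ring of power series. -/
abbrev FracSeries (σ : Type) : Type := FractionRing (MvPowerSeries σ K)

/-- The inclusion of the ring of power series into its field of fractions. -/
def toFrac : MvPowerSeries σ K →+* FracSeries σ := algebraMap _ _

theorem toFrac_injective : Function.Injective (toFrac (σ := σ)) := IsFractionRing.injective _ _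

theorem tau_injOn (S : Finset σ) : Set.InjOn (fun i : σ => toFrac (tau i)) S :=
  fun _ _ _ _ h => tau_injective (toFrac_injective h)

theorem toFrac_tau_ne_zero (i : σ) : toFrac (tau i) ≠ 0 :=
  (map_ne_zero_iff _ toFrac_injective).mpr (tau_ne_zero i)

variable [DecidableEq σ]

theorem tauSum_erase {S : Finset σ} {i : σ} (hi : i ∈ S) (j : ℕ) :
    tauSum (S.erase i) j = tauSum S j - tau i ^ j := by
  rw [tauSum, tauSum, ← Finset.add_sum_erase S _ hi, add_sub_cancel_left]

/-- The residues at the points `τ_i`. -/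
def tauResidue (S : Finset σ) (i : σ) : FracSeries σ := residue (fun i => toFrac (tau i)) S i

theorem toFrac_coherent_vacφ (S : Finset σ) (m : ℕ) : toFrac (coherent S (vacφ m)) =
    ∑ i ∈ S, tauResidue S i * toFrac (tau i) ^ m + if m = 0 then (-1) ^ S.card else 0 := by
  have : CharZero (FracSeries σ) := charZero_of_injective_algebraMap (R := K) (algebraMap K _).injective
  refine eq_of_recursion _ S (tau_injOn S) (fun i _ => toFrac_tau_ne_zero i)
    (fun m => toFrac (coherent S (vacφ m))) ?_ ?_ m
  · rw [coherent_vacφ_zero, map_one]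
  · intro m
    have h := congrArg toFrac (coherent_vacφ_rec S m)
    simp only [MvPowerSeries.smul_eq_C_mul, map_mul, map_sum, map_natCast, map_ofNat, tauSum,
      map_pow] at h
    exact h

/-- The residues have poles at `τ_i = τ_j`. Arguments made coefficient by coefficient need power
series, hence a common denominator. -/
theorem exists_clear_denominators (S : Finset σ) : ∃ (Δ : MvPowerSeries σ K) (c : σ → MvPowerSeries σ K),
    toFrac Δ ≠ 0 ∧ ∀ i ∈ S, toFrac (c i) = toFrac Δ * tauResidue S i := by
  obtain ⟨Δ, hΔ⟩ := IsLocalization.exist_integer_multiples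
    (nonZeroDivisors (MvPowerSeries σ K)) S (tauResidue S)
  choose c hc using hΔ
  refine ⟨Δ, fun i => if h : i ∈ S then c i h else 0,
    (map_ne_zero_iff _ toFrac_injective).mpr (nonZeroDivisors.ne_zero Δ.2), fun i hi => ?_⟩
  simp only [dif_pos hi]
  exact (hc i hi).trans (Algebra.smul_def _ _)

/-- Wick's theorem for a coherent state and a fermion. -/
theorem toFrac_coherent_φ (S : Finset σ) (v : Module.Dual K Bra) (m : ℕ) :
    toFrac (coherent S (v ∘ₗ braMul (φ m))) =
      ∑ i ∈ S, tauResidue S i * toFrac (tau i) ^ m * toFrac (coherent (S.erase i) (v ∘ₗ braJ)) +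
        (if m = 0 then (-1) ^ S.card else 0) * toFrac (coherent S (v ∘ₗ braJ)) := by
  obtain ⟨Δ, c, hΔ0, hc⟩ := exists_clear_denominators S
  -- `Δ` times the difference of the two sides, with denominators cleared, as a family indexed by
  -- all functionals. The goal is that it vanishes.
  set G : ℕ → Module.Dual K Bra → MvPowerSeries σ K := fun m v =>
    Δ * coherent S (v ∘ₗ braMul (φ m)) +
      (∑ i ∈ S, -(c i * tau i ^ m) * coherent (S.erase i) (v ∘ₗ braJ) +
        -((if m = 0 then (-1) ^ S.card else 0) * Δ) * coherent S (v ∘ₗ braJ)) with hG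
  have hrep : ∀ m, Represented (G m) := fun m =>
    ((represented_coherent_φ S m).mul _).add ((Represented.sum S fun i =>
      (represented_coherent_braJ (S.erase i)).mul _).add ((represented_coherent_braJ S).mul _))
  -- The eigenvalue of `b_{-j}` on `S∖i` is that on `S` minus `τ_i^j`, and `[b_{-j}, φ_m] =
  -- φ_{m+j}`. Both sides of the formula thus obey the same recursion. No vacuum term occurs at `m +
  -- j`, which is positive.
  have hstep : ∀ m v (j : OddNat), G m (v ∘ₗ braCurrent (-((j : ℕ) : ℤ))) =
      tauSum S j * G m v - G (m + j) v := by
    intro m v j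
    have hj : m + (j : ℕ) ≠ 0 := by have := j.2.pos; omega
    simp only [hG]
    rw [comp_annihilation_φ, map_sub, coherent_annihilation, comp_current_braJ,
      coherent_annihilation, if_neg hj]
    have hs : ∑ i ∈ S, -(c i * tau i ^ m) *
          coherent (S.erase i) ((v ∘ₗ braJ) ∘ₗ braCurrent (-((j : ℕ) : ℤ))) =
        tauSum S j * ∑ i ∈ S, -(c i * tau i ^ m) * coherent (S.erase i) (v ∘ₗ braJ) -
          ∑ i ∈ S, -(c i * tau i ^ (m + j)) * coherent (S.erase i) (v ∘ₗ braJ) := by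
      rw [Finset.mul_sum, ← Finset.sum_sub_distrib]
      refine Finset.sum_congr rfl fun i hi => ?_
      rw [coherent_annihilation, tauSum_erase hi, pow_add]
      ring
    rw [hs]
    ring
  -- For this functional the shorter coherent states all have value `1`, and the claim is the
  -- partial fraction form of the vacuum values of `φ_m`.
  have hbase : ∀ m, G m (braVac ∘ₗ braJ) = 0 := by
    intro m
    apply toFrac_injective
    simp only [hG]
    have e : coherent S ((braVac ∘ₗ braJ) ∘ₗ braMul (φ m)) = coherent S (vacφ m) := rfl
    rw [e, comp_braJ_braJ, coherent_braVac, map_zero, map_add, map_mul, toFrac_coherent_vacφ,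
      map_add, map_sum, mul_one, mul_add, Finset.mul_sum, map_neg, map_mul]
    have e2 : ∀ i ∈ S, toFrac (-(c i * tau i ^ m) * coherent (S.erase i) braVac) =
        -(toFrac Δ * (tauResidue S i * toFrac (tau i) ^ m)) := by
      intro i hi
      rw [coherent_braVac, mul_one, map_neg, map_mul, map_pow, hc i hi]
      ring
    rw [Finset.sum_congr rfl e2, Finset.sum_neg_distrib]
    split_ifs
    · simp only [map_pow, map_neg, map_one]; ring
    · simp only [map_zero]; ring
  have hzero : ∀ N m, G m (braVac ∘ₗ annihilation (MvPolynomial.monomial N 1) ∘ₗ braJ) = 0 := by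
    intro N
    induction N using multiset_induction with
    | h0 =>
      have : MvPolynomial.monomial (0 : OddNat →₀ ℕ) (1 : K) = 1 := rfl
      intro m
      rw [this, map_one]
      exact hbase m
    | hs N j ih =>
      intro m
      have e : MvPolynomial.monomial (N + Finsupp.single j 1) (1 : K) =
          MvPolynomial.monomial N 1 * MvPolynomial.X j := by
        rw [MvPolynomial.X, MvPolynomial.monomial_mul, one_mul]
      have e2 : braVac ∘ₗ annihilation (MvPolynomial.monomial (N + Finsupp.single j 1) 1) ∘ₗ braJ =
          (braVac ∘ₗ annihilation (MvPolynomial.monomial N 1) ∘ₗ braJ) ∘ₗ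
            braCurrent (-((j : ℕ) : ℤ)) := by
        ext u
        simp only [LinearMap.comp_apply]
        rw [e, map_mul, Module.End.mul_apply, annihilation_X, braJ_current]
      rw [e2, hstep, ih, ih, mul_zero, sub_zero]
  have hfin := congrArg toFrac ((hrep m).eq_zero (fun N => hzero N m) v)
  refine mul_left_cancel₀ hΔ0 ?_
  simp only [hG, map_add, map_mul, map_sum, map_neg, map_pow, map_zero] at hfin
  rw [mul_add, Finset.mul_sum]
  have e3 : ∀ i ∈ S, -(toFrac (c i) * toFrac (tau i) ^ m) *
      toFrac (coherent (S.erase i) (v ∘ₗ braJ)) = -(toFrac Δ * (tauResidue S i * toFrac (tau i) ^ m *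
        toFrac (coherent (S.erase i) (v ∘ₗ braJ)))) := by
    intro i hi
    rw [hc i hi]
    ring
  rw [Finset.sum_congr rfl e3, Finset.sum_neg_distrib] at hfin
  have e4 : toFrac (σ := σ) (if m = 0 then (-1) ^ S.card else 0) =
      if m = 0 then (-1) ^ S.card else 0 := by
    split_ifs <;> simp
  rw [e4] at hfin
  linear_combination hfin

end KFermion

end

/-! ### The action of `e^Θ` on coherent states. -/

noncomputable section

namespace KFermion

variable {σ : Type}

/-! ### Substitution into power series in one variable -/

theorem hasSubst_of_mem {y : MvPowerSeries σ K} (hy : y ∈ lowIdeal σ 1) : PowerSeries.HasSubst y :=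
  PowerSeries.HasSubst.of_constantCoeff_zero (mem_lowIdeal_one.mp hy)

theorem subst_sub_sum_mem {y : MvPowerSeries σ K} (hy : y ∈ lowIdeal σ 1) (f : PowerSeries K) (N : ℕ) :
    f.subst y - ∑ k ∈ Finset.range N, PowerSeries.coeff k f • y ^ k ∈ lowIdeal σ N := by
  have hs := hasSubst_of_mem hy
  have h := congrArg (PowerSeries.subst y) (f.eq_X_pow_mul_shift_add_trunc N)
  rw [PowerSeries.subst_add hs, PowerSeries.subst_mul hs, PowerSeries.subst_pow hs,
    PowerSeries.subst_X hs, PowerSeries.subst_coe hs] at h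
  have e : Polynomial.aeval y (PowerSeries.trunc N f) =
      ∑ k ∈ Finset.range N, PowerSeries.coeff k f • y ^ k := by
    rcases N with _ | N
    · simp
    · rw [Polynomial.aeval_eq_sum_range' (PowerSeries.natDegree_trunc_lt f N)]
      exact Finset.sum_congr rfl fun k hk => by
        rw [PowerSeries.coeff_trunc, if_pos (Finset.mem_range.mp hk)]
  rw [h, e, add_sub_cancel_right]
  exact Ideal.mul_mem_right _ _ (lowIdeal_pow hy N)

/-- Modulo series of order `N` the arguments are nilpotent, and the addition law of the nilpotent
exponential applies. -/
theorem subst_exp_add {y z : MvPowerSeries σ K} (hy : y ∈ lowIdeal σ 1) (hz : z ∈ lowIdeal σ 1) :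
    (PowerSeries.exp K).subst (y + z) = (PowerSeries.exp K).subst y * (PowerSeries.exp K).subst z := by
  refine eq_of_forall_lowIdeal fun N => ?_
  rw [← Ideal.Quotient.eq]
  have key : ∀ w : MvPowerSeries σ K, w ∈ lowIdeal σ 1 →
      IsNilpotent (Ideal.Quotient.mk (lowIdeal σ N) w) ∧
      Ideal.Quotient.mk (lowIdeal σ N) ((PowerSeries.exp K).subst w) =
        IsNilpotent.exp (Ideal.Quotient.mk (lowIdeal σ N) w) := by
    intro w hw
    have hp : (Ideal.Quotient.mk (lowIdeal σ N) w) ^ N = 0 := by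
      rw [← map_pow, Ideal.Quotient.eq_zero_iff_mem]
      exact lowIdeal_pow hw N
    refine ⟨⟨N, hp⟩, ?_⟩
    rw [IsNilpotent.exp_eq_sum hp, Ideal.Quotient.eq.mpr (subst_sub_sum_mem hw (PowerSeries.exp K) N),
      map_sum]
    refine Finset.sum_congr rfl fun k _ => ?_
    rw [inv_natCast_smul_eq ℚ K, PowerSeries.coeff_exp, map_div₀, map_one, map_natCast, one_div]
    exact map_smul (Ideal.Quotient.mkₐ K (lowIdeal σ N)) _ _
  rw [map_mul, (key _ hy).2, (key _ hz).2, (key _ (add_mem hy hz)).2, map_add]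
  exact IsNilpotent.exp_add_of_commute (Commute.all _ _) (key _ hy).1 (key _ hz).1

theorem subst_exp_sum {ι : Type} (S : Finset ι) (y : ι → MvPowerSeries σ K)
    (hy : ∀ i, y i ∈ lowIdeal σ 1) :
    (PowerSeries.exp K).subst (∑ i ∈ S, y i) = ∏ i ∈ S, (PowerSeries.exp K).subst (y i) := by
  classical
  induction S using Finset.induction_on with
  | empty =>
    rw [Finset.sum_empty, Finset.prod_empty, PowerSeries.subst_zero_eq_C_constantCoeff]
    simp
  | insert i S hi ih =>
    rw [Finset.sum_insert hi, Finset.prod_insert hi, subst_exp_add (hy i) (sum_mem fun i _ => hy i), ih]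

/-- The series `2 ∑_{k odd} c^k X^k / k = log ((1 + c X) / (1 - c X))`. -/
def logSeries (c : K) : PowerSeries K :=
  PowerSeries.mk fun k => if Odd k then 2 * c ^ k / (k : K) else 0

theorem constantCoeff_logSeries (c : K) : PowerSeries.constantCoeff (logSeries c) = 0 := by
  rw [← PowerSeries.coeff_zero_eq_constantCoeff_apply]; simp [logSeries]

open PowerSeries in
theorem X_mul_derivative_logSeries (c : K) :
    X * derivative K (logSeries c) = 2 * oddGeom c := by
  ext k
  rw [show (2 : PowerSeries K) = C 2 from (map_ofNat C 2).symm, coeff_C_mul]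
  rcases k with _ | k
  · simp [oddGeom]
  · rw [coeff_succ_X_mul, coeff_derivative]
    simp only [logSeries, oddGeom, coeff_mk]
    split_ifs
    · have : ((k : K) + 1) ≠ 0 := by exact_mod_cast k.succ_ne_zero
      push_cast
      field_simp
    · simp

open PowerSeries in
theorem oddGeom_neg (c : K) : oddGeom (-c) = -oddGeom c := by
  ext k
  simp only [oddGeom, coeff_mk, map_neg]
  split_ifs with h
  · rw [h.neg_pow]
  · simp

-- With `g = (1 - cX)/(1 + cX)`, the product `exp(log) · g` has derivative zero and constant term
-- one.
open PowerSeries in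
theorem subst_logSeries_exp (c : K) :
    (exp K).subst (logSeries c) * (1 - C c * X) = 1 + C c * X := by
  have hs : HasSubst (logSeries c) := HasSubst.of_constantCoeff_zero' (constantCoeff_logSeries c)
  set E : PowerSeries K := (exp K).subst (logSeries c) with hE
  have hE' : derivative K E = E * derivative K (logSeries c) := by
    rw [hE, derivative_subst hs, derivative_exp]
  have hE0 : constantCoeff E = 1 := by
    have h0 : constantCoeff (E - 1) = 0 := by
      have e : E - 1 = (exp K - 1).subst (logSeries c) := by
        rw [subst_sub hs, hE]
        congr 1
        have := (subst_C (a := logSeries c) (1 : K)).symm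
        simpa using this
      rw [e]
      exact constantCoeff_subst_eq_zero (constantCoeff_logSeries c) _ (by simp)
    rw [map_sub, map_one, sub_eq_zero] at h0
    exact h0
  set g : PowerSeries K := (1 + C (-c) * X) * PowerSeries.mk fun k => (-c) ^ k with hg
  have hg1 : (1 - C (-c) * X) * g = 1 + C (-c) * X := by
    rw [hg, mul_left_comm, geom_mul, mul_one]
  have hg' := single_factor hg1
  have hg0 : constantCoeff g = 1 := by
    have := congrArg constantCoeff hg1
    simpa using this
  have hEg : E * g = 1 := by
    refine derivative.ext ?_ (by rw [map_mul, hE0, hg0, one_mul, map_one])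
    refine mul_left_cancel₀ (X_ne_zero (R := K)) ?_
    rw [Derivation.map_one_eq_zero, mul_zero, Derivation.leibniz, smul_eq_mul, smul_eq_mul, hE']
    rw [oddGeom_neg] at hg'
    linear_combination E * hg' + g * E * X_mul_derivative_logSeries c
  rw [map_neg] at hg1
  linear_combination -E * hg1 + (1 + C c * X) * hEg

theorem one_sub_tau_mul (i : σ) : (1 - MvPowerSeries.C (β / 2) * tau i) *
    (1 + MvPowerSeries.C (β / 2) * MvPowerSeries.X i) = 1 := by
  linear_combination -MvPowerSeries.C (β / 2) * tau_mul i

theorem subst_C' {y : MvPowerSeries σ K} (c : K) :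
    (PowerSeries.C c).subst y = MvPowerSeries.C c := PowerSeries.subst_C c

theorem subst_one' {y : MvPowerSeries σ K} : (1 : PowerSeries K).subst y = 1 := by
  simpa using subst_C' (y := y) 1

theorem C_half_add : (MvPowerSeries.C β : MvPowerSeries σ K) =
    MvPowerSeries.C (β / 2) + MvPowerSeries.C (β / 2) := by
  rw [← map_add, add_halves]

/-- `log (1 + β x_i)` as a series in `τ_i`. -/
def tauLog (i : σ) : MvPowerSeries σ K := (logSeries (β / 2)).subst (tau i)

theorem tauLog_mem (i : σ) : tauLog i ∈ lowIdeal σ 1 := by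
  rw [mem_lowIdeal_one]
  exact PowerSeries.constantCoeff_subst_eq_zero (mem_lowIdeal_one.mp (tau_mem i)) _
    (constantCoeff_logSeries _)

theorem exp_tauLog (i : σ) :
    (PowerSeries.exp K).subst (tauLog i) = 1 + MvPowerSeries.C β * MvPowerSeries.X i := by
  have hs := hasSubst_of_mem (tau_mem i)
  have hl : PowerSeries.HasSubst (logSeries (β / 2)) :=
    PowerSeries.HasSubst.of_constantCoeff_zero' (constantCoeff_logSeries _)
  have h := congrArg (PowerSeries.subst (tau i)) (subst_logSeries_exp (β / 2))
  rw [PowerSeries.subst_mul hs, PowerSeries.subst_comp_subst_apply hl hs, PowerSeries.subst_add hs,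
    PowerSeries.subst_sub hs, PowerSeries.subst_mul hs, PowerSeries.subst_X hs, subst_C',
    subst_one'] at h
  change (PowerSeries.exp K).subst (tauLog i) * _ = _ at h
  have h1 := one_sub_tau_mul i
  rw [C_half_add]
  linear_combination (1 + MvPowerSeries.C (β / 2) * MvPowerSeries.X i) * h -
    (PowerSeries.exp K).subst (tauLog i) * h1 + MvPowerSeries.C (β / 2) * tau_mul i

/-! ### Continuity of the coherent states -/

/-- Continuity: the coefficient at `d` is evaluation at a vector of degree at most that of `d`,
which an operator lowering the degree by more annihilates. -/
theorem coherent_lfSum_sub_mem (S : Finset σ) (v : Module.Dual K Bra) (f : ℕ → Bra →ₗ[K] Bra)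
    (hf : ∀ u, {k | f k u ≠ 0}.Finite)
    (hd : ∀ (k : ℕ) (d : ℤ) u, u ∈ braFil d → f k u ∈ braFil (d - k)) (N : ℕ) :
    coherent S (v ∘ₗ lfSum f hf) - ∑ k ∈ Finset.range N, coherent S (v ∘ₗ f k) ∈ lowIdeal σ N := by
  intro d hdN
  obtain ⟨u, -, hu, hu'⟩ := exists_coherent_vector S d
  rw [map_sub, map_sum, hu', LinearMap.comp_apply, lfSum_eq_sum f hf u (Finset.range N), map_sum,
    sub_eq_zero]
  · exact Finset.sum_congr rfl fun k _ => (hu' (v ∘ₗ f k)).symm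
  · intro k hk
    rw [Finset.mem_range, not_lt] at hk
    exact braFil_eq_zero (hd k _ u hu) (by omega)

theorem sum_range_two_mul {M : Type} [AddCommMonoid M] (f : ℕ → M) (N : ℕ) :
    ∑ k ∈ Finset.range (2 * N), f k = ∑ j ∈ Finset.range N, (f (2 * j) + f (2 * j + 1)) := by
  induction N with
  | zero => simp
  | succ N ih =>
    rw [Finset.sum_range_succ, ← ih, show 2 * (N + 1) = 2 * N + 1 + 1 by ring,
      Finset.sum_range_succ, Finset.sum_range_succ, add_assoc]

/-- `Θ` is a series in the `b_{-j}`, so the coherent state is an eigenvector. The eigenvalue `2 ∑_j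
(β/2)^j τ_i^j / j` of one variable is `log ((1 + βτ_i/2)/(1 - βτ_i/2)) = log (1 + β x_i)`. -/
theorem coherent_theta (S : Finset σ) (v : Module.Dual K Bra) :
    coherent S (v ∘ₗ braTheta) = (∑ i ∈ S, tauLog i) * coherent S v := by
  refine eq_of_forall_lowIdeal fun N => ?_
  have h1 := coherent_lfSum_sub_mem S v _ braTheta_finite (fun j d u hu => Submodule.smul_mem _ _
    (braFil_mono (by push_cast; omega) (braFil_current _ hu))) N
  have h2 : (∑ j ∈ Finset.range N, coherent S (v ∘ₗ
      ((2 * (β / 2) ^ (2 * j + 1) / ((2 * j + 1 : ℕ) : K)) •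
        braCurrent (-((2 * j + 1 : ℕ) : ℤ))))) =
      (∑ i ∈ S, ∑ k ∈ Finset.range (2 * N),
        PowerSeries.coeff k (logSeries (β / 2)) • tau i ^ k) * coherent S v := by
    rw [Finset.sum_comm, sum_range_two_mul, Finset.sum_mul]
    refine Finset.sum_congr rfl fun j _ => ?_
    have e0 : ¬ Odd (2 * j) := by simp
    have e1 : Odd (2 * j + 1) := ⟨j, rfl⟩
    have := coherent_annihilation S v ⟨2 * j + 1, e1⟩
    rw [LinearMap.comp_smul, map_smul, this]
    simp only [logSeries, PowerSeries.coeff_mk, if_neg e0, if_pos e1, zero_smul,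
      Finset.sum_const_zero, zero_add, ← Finset.smul_sum, smul_mul_assoc]
    rfl
  have h3 : (∑ i ∈ S, tauLog i) * coherent S v - (∑ i ∈ S, ∑ k ∈ Finset.range (2 * N),
      PowerSeries.coeff k (logSeries (β / 2)) • tau i ^ k) * coherent S v ∈ lowIdeal σ N := by
    rw [← sub_mul, ← Finset.sum_sub_distrib]
    exact Ideal.mul_mem_right _ _ (sum_mem fun i _ =>
      lowIdeal_anti (by omega) (subst_sub_sum_mem (tau_mem i) _ (2 * N)))
  rw [h2] at h1
  have := sub_mem h1 h3
  rwa [sub_sub_sub_cancel_right] at this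

theorem coherent_theta_pow (S : Finset σ) (v : Module.Dual K Bra) (k : ℕ) :
    coherent S (v ∘ₗ (braTheta ^ k : Module.End K Bra)) =
      (∑ i ∈ S, tauLog i) ^ k * coherent S v := by
  induction k with
  | zero => rw [pow_zero, pow_zero, one_mul]; rfl
  | succ k ih =>
    have e : v ∘ₗ (braTheta ^ (k + 1) : Module.End K Bra) =
        (v ∘ₗ (braTheta ^ k : Module.End K Bra)) ∘ₗ braTheta := by
      rw [pow_succ]; rfl
    rw [e, coherent_theta, ih]
    ring

theorem coherent_expTheta (S : Finset σ) (v : Module.Dual K Bra) :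
    coherent S (v ∘ₗ braExpTheta) =
      (∏ i ∈ S, (1 + MvPowerSeries.C β * MvPowerSeries.X i)) * coherent S v := by
  have e : ∏ i ∈ S, (1 + MvPowerSeries.C β * MvPowerSeries.X i : MvPowerSeries σ K) =
      (PowerSeries.exp K).subst (∑ i ∈ S, tauLog i) := by
    rw [subst_exp_sum S _ tauLog_mem]
    exact Finset.prod_congr rfl fun i _ => (exp_tauLog i).symm
  rw [e]
  refine eq_of_forall_lowIdeal fun N => ?_
  have h1 := coherent_lfSum_sub_mem S v _ braExpTheta_finite (fun k d u hu =>
    Submodule.smul_mem (braFil (d - k)) _ (braFil_theta_pow k hu)) N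
  have h3 := Ideal.mul_mem_right (coherent S v) _ (subst_sub_sum_mem
    (sum_mem fun i _ => tauLog_mem i : ∑ i ∈ S, tauLog i ∈ lowIdeal σ 1) (PowerSeries.exp K) N)
  have h2 : ∑ k ∈ Finset.range N,
      coherent S (v ∘ₗ (((k.factorial : K)⁻¹) • braTheta ^ k : Module.End K Bra)) =
      (∑ k ∈ Finset.range N, PowerSeries.coeff k (PowerSeries.exp K) • (∑ i ∈ S, tauLog i) ^ k) *
        coherent S v := by
    rw [Finset.sum_mul]
    refine Finset.sum_congr rfl fun k _ => ?_
    rw [LinearMap.comp_smul, map_smul, coherent_theta_pow, PowerSeries.coeff_exp, smul_mul_assoc]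
    simp
  rw [h2] at h1
  rw [sub_mul] at h3
  have := sub_mem h1 h3
  rwa [sub_sub_sub_cancel_right] at this

end KFermion

end

/-! ### Resummation of the Wick formula for the deformed fermions. -/

noncomputable section

namespace KFermion

variable {σ : Type} [DecidableEq σ]

/-! ### Symbols of fermionic operators -/

/-- The operator `T` removes a variable `x_i` from a coherent state with weight the residue at
`τ_i` times `y i`, up to a multiple of the state itself. -/
def HasSymbol (T : Bra →ₗ[K] Bra) (y : σ → MvPowerSeries σ K) (a : K) : Prop :=
  ∀ (S : Finset σ) (v : Module.Dual K Bra), toFrac (coherent S (v ∘ₗ T)) =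
    ∑ i ∈ S, tauResidue S i * toFrac (y i) * toFrac (coherent (S.erase i) (v ∘ₗ braJ)) +
      toFrac (MvPowerSeries.C a * (-1) ^ S.card * coherent S (v ∘ₗ braJ))

theorem hasSymbol_φ (m : ℕ) :
    HasSymbol (σ := σ) (braMul (φ m)) (fun i => tau i ^ m) (if m = 0 then 1 else 0) := by
  intro S v
  rw [toFrac_coherent_φ, map_mul _ (_ * _)]
  simp only [map_pow]
  congr 2
  split_ifs <;> simp

theorem symbol_iff {S : Finset σ} {Δ : MvPowerSeries σ K} {c : σ → MvPowerSeries σ K}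
    (hΔ : toFrac Δ ≠ 0) (hc : ∀ i ∈ S, toFrac (c i) = toFrac Δ * tauResidue S i)
    (y E : σ → MvPowerSeries σ K) (F G : MvPowerSeries σ K) :
    toFrac F = ∑ i ∈ S, tauResidue S i * toFrac (y i) * toFrac (E i) + toFrac G ↔
      Δ * F = ∑ i ∈ S, c i * y i * E i + Δ * G := by
  have e : toFrac Δ * (∑ i ∈ S, tauResidue S i * toFrac (y i) * toFrac (E i) + toFrac G) =
      toFrac (∑ i ∈ S, c i * y i * E i + Δ * G) := by
    rw [map_add, map_sum, map_mul, mul_add, Finset.mul_sum]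
    congr 1
    refine Finset.sum_congr rfl fun i hi => ?_
    rw [map_mul, map_mul, hc i hi]
    ring
  rw [← mul_right_inj' hΔ, e, ← map_mul, toFrac_injective.eq_iff]

theorem HasSymbol.lfSum {T : ℕ → Bra →ₗ[K] Bra} {y : ℕ → σ → MvPowerSeries σ K} {a : K}
    (hT : ∀ k, HasSymbol (T k) (y k) (if k = 0 then a else 0))
    (hd : ∀ (k : ℕ) (d : ℤ) u, u ∈ braFil d → T k u ∈ braFil (d - k)) (h : ℕ → K)
    (hf : ∀ u, {k | (h k • T k) u ≠ 0}.Finite) {z : σ → MvPowerSeries σ K}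
    (hz : ∀ i N, z i - ∑ k ∈ Finset.range N, h k • y k i ∈ lowIdeal σ N) :
    HasSymbol (lfSum (fun k => h k • T k) hf) z (h 0 * a) := by
  intro S v
  obtain ⟨Δ, c, hΔ, hc⟩ := exists_clear_denominators S
  refine (symbol_iff hΔ hc _ _ _ _).mpr (eq_of_forall_lowIdeal fun N => ?_)
  -- Truncating at `N + 1` rather than `N` guarantees that the term `k = 0`, the only one carrying
  -- the vacuum part, is included.
  refine lowIdeal_anti N.le_succ ?_
  have h1 := Ideal.mul_mem_left _ Δ (coherent_lfSum_sub_mem S v _ hf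
    (fun k d u hu => Submodule.smul_mem (braFil (d - k)) _ (hd k d u hu)) (N + 1))
  have h2 : Δ * ∑ k ∈ Finset.range (N + 1), coherent S (v ∘ₗ (h k • T k)) =
      ∑ i ∈ S, c i * (∑ k ∈ Finset.range (N + 1), h k • y k i) * coherent (S.erase i) (v ∘ₗ braJ) +
        Δ * (MvPowerSeries.C (h 0 * a) * (-1) ^ S.card * coherent S (v ∘ₗ braJ)) := by
    have e : ∀ k, Δ * coherent S (v ∘ₗ (h k • T k)) =
        ∑ i ∈ S, c i * (h k • y k i) * coherent (S.erase i) (v ∘ₗ braJ) +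
          if k = 0 then Δ * (MvPowerSeries.C (h 0 * a) * (-1) ^ S.card * coherent S (v ∘ₗ braJ))
            else 0 := by
      intro k
      rw [LinearMap.comp_smul, map_smul, mul_smul_comm, (symbol_iff hΔ hc _ _ _ _).mp (hT k S v),
        smul_add, Finset.smul_sum]
      congr 1
      · exact Finset.sum_congr rfl fun i _ => by rw [mul_smul_comm, smul_mul_assoc]
      · split_ifs with hk
        · subst hk
          rw [MvPowerSeries.smul_eq_C_mul, map_mul]
          ring
        · simp
    rw [Finset.mul_sum, Finset.sum_congr rfl fun k _ => e k, Finset.sum_add_distrib,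
      Finset.sum_comm, Finset.sum_ite_eq' (Finset.range (N + 1)) 0, if_pos (by simp)]
    congr 1
    exact Finset.sum_congr rfl fun i _ => by rw [Finset.mul_sum, Finset.sum_mul]
  have h3 : ∑ i ∈ S, c i * z i * coherent (S.erase i) (v ∘ₗ braJ) -
      ∑ i ∈ S, c i * (∑ k ∈ Finset.range (N + 1), h k • y k i) *
        coherent (S.erase i) (v ∘ₗ braJ) ∈ lowIdeal σ (N + 1) := by
    rw [← Finset.sum_sub_distrib]
    refine sum_mem fun i _ => ?_
    rw [← sub_mul, ← mul_sub]
    exact Ideal.mul_mem_right _ _ (Ideal.mul_mem_left _ _ (hz i (N + 1)))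
  rw [mul_sub, h2] at h1
  have := sub_mem h1 h3
  convert this using 1
  ring

/-- Replacing `φ_k` by `τ^k` in the definition sums to `τ^m / (1 - βτ/2)^{m+1}`. This equals `x^m (1
+ βx/2)`, because `1/(1 - βτ/2) = 1 + βx/2` and `τ (1 + βx/2) = x`. -/
theorem hasSymbol_braPhi (m : ℕ) :
    HasSymbol (σ := σ) (braPhi m)
      (fun i => MvPowerSeries.X i ^ m * (1 + MvPowerSeries.C (β / 2) * MvPowerSeries.X i))
      (if m = 0 then 1 else 0) := by
  have hser : ∀ k, PowerSeries.coeff k (PowerSeries.X ^ m *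
      ((1 - PowerSeries.C (β / 2) * PowerSeries.X)⁻¹) ^ (m + 1)) =
      ((Polynomial.X + Polynomial.C (β / 2)) ^ k).coeff m := by
    intro k
    rw [inv_one_sub_pow, PowerSeries.coeff_X_pow_mul', Polynomial.coeff_X_add_C_pow]
    split_ifs with hk
    · rw [PowerSeries.coeff_mk, show m + (k - m) = k by omega]
    · rw [Nat.choose_eq_zero_of_lt (by omega)]; simp
  have hz : ∀ (i : σ) N, MvPowerSeries.X i ^ m * (1 + MvPowerSeries.C (β / 2) * MvPowerSeries.X i) -
      ∑ k ∈ Finset.range N, ((Polynomial.X + Polynomial.C (β / 2)) ^ k).coeff m • tau i ^ k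
        ∈ lowIdeal σ N := by
    intro i N
    have hs := hasSubst_of_mem (tau_mem i)
    have h := subst_sub_sum_mem (tau_mem i) (PowerSeries.X ^ m *
      ((1 - PowerSeries.C (β / 2) * PowerSeries.X)⁻¹) ^ (m + 1)) N
    simp only [hser] at h
    have hinv : (1 - PowerSeries.C (β / 2) * PowerSeries.X)⁻¹.subst (tau i) =
        1 + MvPowerSeries.C (β / 2) * MvPowerSeries.X i := by
      have h1 := congrArg (PowerSeries.subst (tau i)) (PowerSeries.inv_mul_cancel
        (1 - PowerSeries.C (β / 2) * PowerSeries.X) (by simp))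
      rw [PowerSeries.subst_mul hs, PowerSeries.subst_sub hs, PowerSeries.subst_mul hs,
        PowerSeries.subst_X hs, subst_C', subst_one'] at h1
      linear_combination (1 + MvPowerSeries.C (β / 2) * MvPowerSeries.X i) * h1 -
        (1 - PowerSeries.C (β / 2) * PowerSeries.X)⁻¹.subst (tau i) * one_sub_tau_mul i
    rw [PowerSeries.subst_mul hs, PowerSeries.subst_pow hs, PowerSeries.subst_pow hs,
      PowerSeries.subst_X hs, hinv, pow_succ (1 + _), ← mul_assoc, ← mul_pow, tau_mul] at h
    exact h
  have := HasSymbol.lfSum (σ := σ) (hasSymbol_φ) (fun k d u hu => braFil_φ k hu)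
    (fun k => ((Polynomial.X + Polynomial.C (β / 2)) ^ k).coeff m) (braPhi_finite m) hz
  rw [pow_zero, Polynomial.coeff_one, mul_one] at this
  exact this

theorem coeff_inv_two_add (k : ℕ) :
    PowerSeries.coeff k (PowerSeries.C 2 + PowerSeries.C β * PowerSeries.X)⁻¹ =
      (1 / 2 : K) * (-(β / 2)) ^ k := by
  have h : (PowerSeries.C 2 + PowerSeries.C β * PowerSeries.X)⁻¹ =
      PowerSeries.C (1 / 2 : K) * PowerSeries.mk fun k => (-(β / 2)) ^ k := by
    rw [PowerSeries.inv_eq_iff_mul_eq_one (by simp)]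
    have h1 := geom_mul (-(β / 2))
    have h2 : PowerSeries.C (2 : K) + PowerSeries.C β * PowerSeries.X =
        PowerSeries.C 2 * (1 - PowerSeries.C (-(β / 2)) * PowerSeries.X) := by
      rw [mul_sub, mul_one, ← mul_assoc, ← map_mul]
      simp [mul_div_cancel₀]
    have h3 : PowerSeries.C (1 / 2 : K) * PowerSeries.C 2 = 1 := by
      rw [← map_mul]; simp
    rw [h2]
    linear_combination (PowerSeries.C (1 / 2 : K) * PowerSeries.C 2) * h1 + h3
  rw [h, PowerSeries.coeff_C_mul, PowerSeries.coeff_mk]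

/-- The coefficients of `1/(2 + βz⁻¹)` form a geometric series in `-β/2`, and its product with `1 +
βx/2` telescopes to `x^n / 2`. For `n > 0` no mode `φ_0^{(β)}` is involved, so there is no vacuum
term. -/
theorem hasSymbol_braPhiHalf {n : ℕ} (hn : 0 < n) :
    HasSymbol (σ := σ) (braPhiHalf n) (fun i => MvPowerSeries.C (1 / 2) * MvPowerSeries.X i ^ n) 0 := by
  have hz : ∀ (i : σ) N, MvPowerSeries.C (1 / 2) * MvPowerSeries.X i ^ n -
      ∑ k ∈ Finset.range N, PowerSeries.coeff k (PowerSeries.C 2 + PowerSeries.C β * PowerSeries.X)⁻¹ •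
        (MvPowerSeries.X i ^ (n + k) * (1 + MvPowerSeries.C (β / 2) * MvPowerSeries.X i))
        ∈ lowIdeal σ N := by
    intro i N
    have hX : (MvPowerSeries.X i : MvPowerSeries σ K) ∈ lowIdeal σ 1 := by
      rw [mem_lowIdeal_one]; simp
    have e : ∀ N, MvPowerSeries.C (1 / 2) * MvPowerSeries.X i ^ n -
      ∑ k ∈ Finset.range N, PowerSeries.coeff k (PowerSeries.C 2 + PowerSeries.C β * PowerSeries.X)⁻¹ •
        (MvPowerSeries.X i ^ (n + k) * (1 + MvPowerSeries.C (β / 2) * MvPowerSeries.X i)) =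
        MvPowerSeries.C (1 / 2) * MvPowerSeries.X i ^ n * (-MvPowerSeries.C (β / 2)) ^ N *
          MvPowerSeries.X i ^ N := by
      intro N
      induction N with
      | zero => simp
      | succ N ih =>
        rw [Finset.sum_range_succ, ← sub_sub, ih, coeff_inv_two_add, MvPowerSeries.smul_eq_C_mul,
          map_mul, map_pow, map_neg]
        ring
    rw [e]
    exact Ideal.mul_mem_left _ _ (lowIdeal_pow hX N)
  have := HasSymbol.lfSum (σ := σ) (a := 0) (T := fun k => braPhi (n + k))
    (y := fun k i => MvPowerSeries.X i ^ (n + k) *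
      (1 + MvPowerSeries.C (β / 2) * MvPowerSeries.X i))
    (fun k => by
      have := hasSymbol_braPhi (σ := σ) (n + k)
      rw [if_neg (by omega)] at this
      rwa [ite_self])
    (fun k d u hu => braFil_mono (by push_cast; omega) (braFil_braPhi (n + k) hu))
    (fun k => PowerSeries.coeff k (PowerSeries.C 2 + PowerSeries.C β * PowerSeries.X)⁻¹)
    (braPhiHalf_finite n) hz
  rw [mul_zero] at this
  exact this

end KFermion

end

/-! ### Symmetrized products from successive removal of variables. -/

noncomputable section

namespace KFermion

/-! ### The recursion for symmetrized products -/

section Symmetrized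

variable {F : Type} [Field F]

/-- The factor `(x ⊕ y) / (x ⊖ y)`. -/
def pairWeight (b x y : F) : F := (x + y + b * x * y) / ((x - y) / (1 + b * y))

/-- The symmetrized product defining the `K`-theoretic `P`-function, at the elements `x i`. -/
def symProd (b : F) (l : List ℕ) (m : ℕ) (x : Fin m → F) : F :=
  ((m - l.length).factorial : F)⁻¹ * ∑ w : Equiv.Perm (Fin m),
    ∏ i : Fin m, if h : (i : ℕ) < l.length then
      x (w i) ^ l[(i : ℕ)] * ∏ j ∈ Finset.Ioi i, pairWeight b (x (w i)) (x (w j))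
    else 1

theorem symProd_nil [CharZero F] (b : F) (m : ℕ) (x : Fin m → F) : symProd b [] m x = 1 := by
  have : (m.factorial : F) ≠ 0 := Nat.cast_ne_zero.mpr m.factorial_ne_zero
  simp [symProd, Fintype.card_perm, this]

/-- The enumeration of the complement of `p`. -/
def skip {m : ℕ} (p : Fin (m + 1)) (k : Fin m) : Fin (m + 1) := Equiv.swap 0 p k.succ

theorem skip_injective {m : ℕ} (p : Fin (m + 1)) : Function.Injective (skip p) :=
  (Equiv.injective _).comp (Fin.succ_injective m)

theorem skip_ne {m : ℕ} (p : Fin (m + 1)) (k : Fin m) : skip p k ≠ p := by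
  intro h
  have := congrArg (Equiv.swap 0 p) h
  rw [skip, Equiv.swap_apply_self, Equiv.swap_apply_right] at this
  exact Fin.succ_ne_zero k this

/-- Permutations are sorted by `p = w 0`, which receives the first part. Its factor runs over all
the other variables and does not depend on their order. The remaining permutation gives the same sum
for `l`, and the factorial is unchanged since `m + 1 - (r + 1) = m - r`. -/
theorem symProd_cons (b : F) (n : ℕ) (l : List ℕ) (m : ℕ) (x : Fin (m + 1) → F) :
    symProd b (n :: l) (m + 1) x = ∑ p, x p ^ n * (∏ k, pairWeight b (x p) (x (skip p k))) *
      symProd b l m (fun k => x (skip p k)) := by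
  rw [symProd, ← Equiv.sum_comp Equiv.Perm.decomposeFin.symm, Fintype.sum_prod_type, Finset.mul_sum]
  refine Finset.sum_congr rfl fun p _ => ?_
  have hlen : m + 1 - (n :: l).length = m - l.length := by rw [List.length_cons]; omega
  rw [symProd, hlen, mul_left_comm, Finset.mul_sum _ _ (_ * _)]
  congr 1
  refine Finset.sum_congr rfl fun e _ => ?_
  rw [Fin.prod_univ_succ, dif_pos (by simp), Fin.prod_Ioi_zero]
  simp only [Equiv.Perm.decomposeFin_symm_apply_zero, Equiv.Perm.decomposeFin_symm_apply_succ]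
  congr 1
  · congr 1
    exact Equiv.prod_comp e fun k => pairWeight b (x p) (x (skip p k))
  · refine Finset.prod_congr rfl fun i _ => ?_
    by_cases h : (i : ℕ) < l.length
    · rw [dif_pos h, dif_pos (by simpa using h), Fin.prod_Ioi_succ]
      simp only [Equiv.Perm.decomposeFin_symm_apply_succ]
      rfl
    · rw [dif_neg h, dif_neg (by simpa using h)]

end Symmetrized

/-! ### Coherent states and the vectors `|λ⟩_P` -/

theorem braJ_theta (u : Bra) : braJ (braTheta u) = braTheta (braJ u) :=
  lfSum_comm _ _ _ (fun j u => by
    rw [LinearMap.smul_apply, map_smul, braJ_current, LinearMap.smul_apply]) u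

theorem braJ_theta_pow (k : ℕ) (u : Bra) : braJ ((braTheta ^ k) u) = (braTheta ^ k) (braJ u) := by
  induction k generalizing u with
  | zero => rfl
  | succ k ih => rw [pow_succ, Module.End.mul_apply, Module.End.mul_apply, ih, braJ_theta]

theorem braJ_expTheta (u : Bra) : braJ (braExpTheta u) = braExpTheta (braJ u) :=
  lfSum_comm _ _ _ (fun k u => by
    rw [LinearMap.smul_apply, map_smul, braJ_theta_pow, LinearMap.smul_apply]) u

theorem braJ_braPhi (n : ℕ) (u : Bra) : braJ (braPhi n u) = braPhi n (braJ u) :=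
  lfSum_comm _ _ _ (fun k u => by
    rw [LinearMap.smul_apply, map_smul, braJ_braMul, LinearMap.smul_apply]) u

theorem braJ_braPhiHalf (n : ℕ) (u : Bra) : braJ (braPhiHalf n u) = braPhiHalf n (braJ u) :=
  lfSum_comm _ _ _ (fun k u => by
    rw [LinearMap.smul_apply, map_smul, braJ_braPhi, LinearMap.smul_apply]) u

theorem braJ_braProd (l : List ℕ) (u : Bra) : braJ (braProd l u) = braProd l (braJ u) := by
  induction l generalizing u with
  | nil => rfl
  | cons n l ih =>
    simp only [braProd, LinearMap.comp_apply]
    rw [ih, braJ_expTheta, braJ_braPhiHalf]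

variable {σ : Type}

theorem charZero_fracSeries : CharZero (FracSeries σ) :=
  charZero_of_injective_algebraMap (R := K) (algebraMap K _).injective

/-- The variable `x_i` in the field of fractions. -/
def fracVar (i : σ) : FracSeries σ := toFrac (MvPowerSeries.X i)

/-- The element `β` of the field of fractions. -/
def fracβ : FracSeries σ := toFrac (MvPowerSeries.C β)

theorem fracβ_eq : (fracβ : FracSeries σ) = 2 * toFrac (MvPowerSeries.C (β / 2)) := by
  rw [fracβ, C_half_add, map_add, two_mul]

theorem fracVar_injective : Function.Injective (fracVar : σ → FracSeries σ) :=
  fun _ _ h => MvPowerSeries.X_inj.mp (toFrac_injective h)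

theorem one_add_fracVar_ne_zero (c : K) (i : σ) :
    1 + toFrac (MvPowerSeries.C c) * fracVar i ≠ 0 := by
  have : (1 + MvPowerSeries.C c * MvPowerSeries.X i : MvPowerSeries σ K) ≠ 0 := fun h => by
    simpa using congrArg MvPowerSeries.constantCoeff h
  simpa [fracVar] using (map_ne_zero_iff toFrac toFrac_injective).mpr this

theorem toFrac_tau (i : σ) :
    toFrac (tau i) = fracVar i / (1 + toFrac (MvPowerSeries.C (β / 2)) * fracVar i) := by
  rw [eq_div_iff (one_add_fracVar_ne_zero _ i)]
  simpa [fracVar] using congrArg toFrac (tau_mul i)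

theorem tau_ratio {i j : σ} (hij : i ≠ j) :
    (toFrac (tau i) + toFrac (tau j)) / (toFrac (tau i) - toFrac (tau j)) * (1 + fracβ * fracVar j) =
      pairWeight fracβ (fracVar i) (fracVar j) := by
  have hi := one_add_fracVar_ne_zero (β / 2) i
  have hj := one_add_fracVar_ne_zero (β / 2) j
  have hx : fracVar i - fracVar j ≠ 0 := sub_ne_zero.mpr fun h => hij (fracVar_injective h)
  have h2 : toFrac (tau i) - toFrac (tau j) = (fracVar i - fracVar j) /
      ((1 + toFrac (MvPowerSeries.C (β / 2)) * fracVar i) *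
        (1 + toFrac (MvPowerSeries.C (β / 2)) * fracVar j)) := by
    rw [toFrac_tau, toFrac_tau, div_sub_div _ _ hi hj]
    congr 1
    ring
  have h1 : toFrac (tau i) + toFrac (tau j) = (fracVar i + fracVar j + fracβ * fracVar i * fracVar j) /
      ((1 + toFrac (MvPowerSeries.C (β / 2)) * fracVar i) *
        (1 + toFrac (MvPowerSeries.C (β / 2)) * fracVar j)) := by
    rw [toFrac_tau, toFrac_tau, div_add_div _ _ hi hj, fracβ_eq]
    congr 1
    ring
  rw [h1, h2, div_div_div_cancel_right₀ (mul_ne_zero hi hj), pairWeight, div_div_eq_mul_div,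
    div_mul_eq_mul_div]

variable [DecidableEq σ]

/-- `Φ_n` removes `x_i` with weight `2 ∏ (τ_i + τ_j)/(τ_i - τ_j) · x_i^n / 2`. Then `e^Θ` acts on
the state without `x_i` and supplies exactly the factors `1 + β x_j` that complete `(x_i ⊕ x_j)/(x_i
⊖ x_j)`. -/
theorem coherent_cons (S : Finset σ) (v : Module.Dual K Bra) {n : ℕ} (hn : 0 < n) :
    toFrac (coherent S (v ∘ₗ braExpTheta ∘ₗ braPhiHalf n)) =
      ∑ i ∈ S, fracVar i ^ n * (∏ j ∈ S.erase i, pairWeight fracβ (fracVar i) (fracVar j)) *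
        toFrac (coherent (S.erase i) (v ∘ₗ braJ)) := by
  have := charZero_fracSeries (σ := σ)
  have h := hasSymbol_braPhiHalf (σ := σ) hn S (v ∘ₗ braExpTheta)
  have e : (v ∘ₗ braExpTheta) ∘ₗ braJ = (v ∘ₗ braJ) ∘ₗ braExpTheta := by
    ext u
    simp only [LinearMap.comp_apply, braJ_expTheta]
  rw [map_zero, zero_mul, zero_mul, map_zero, add_zero] at h
  rw [← LinearMap.comp_assoc, h]
  refine Finset.sum_congr rfl fun i hi => ?_
  rw [e, coherent_expTheta, map_mul, map_mul, map_prod, map_pow]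
  have hw : ∏ j ∈ S.erase i, pairWeight fracβ (fracVar i) (fracVar j) =
      (∏ j ∈ S.erase i, (toFrac (tau i) + toFrac (tau j)) / (toFrac (tau i) - toFrac (tau j))) *
        ∏ j ∈ S.erase i, toFrac (1 + MvPowerSeries.C β * MvPowerSeries.X j) := by
    rw [← Finset.prod_mul_distrib]
    refine Finset.prod_congr rfl fun j hj => ?_
    rw [← tau_ratio (Finset.ne_of_mem_erase hj).symm]
    simp [fracβ, fracVar]
  have h2 : 2 * toFrac (MvPowerSeries.C (1 / 2) : MvPowerSeries σ K) = 1 := by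
    rw [← map_ofNat toFrac 2, ← map_ofNat MvPowerSeries.C 2, ← map_mul, ← map_mul]
    simp
  rw [hw, tauResidue, residue, fracVar]
  linear_combination (toFrac (MvPowerSeries.X i) ^ n *
    (∏ j ∈ S.erase i, (toFrac (tau i) + toFrac (tau j)) / (toFrac (tau i) - toFrac (tau j))) *
    (∏ j ∈ S.erase i, toFrac (1 + MvPowerSeries.C β * MvPowerSeries.X j)) *
    toFrac (coherent (S.erase i) (v ∘ₗ braJ))) * h2

/-- After division by `∏ (1 + β x_i)` the symbol of `φ_0^{(β)}` gives the partial fraction sum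
evaluated at `w = -β/2`. That sum is `∏ (1 - βτ_i/2)/(1 + βτ_i/2) = ∏ 1/(1 + β x_i)`, and the
product is `1`. -/
theorem coherent_odd_vacuum (S : Finset σ) :
    coherent S ((braVac ∘ₗ braExpTheta ∘ₗ braPhi 0) ∘ₗ braJ) = 1 := by
  apply toFrac_injective
  have e1 : (braVac ∘ₗ braExpTheta ∘ₗ braPhi 0) ∘ₗ braJ =
      ((braVac ∘ₗ braExpTheta) ∘ₗ braJ) ∘ₗ braPhi 0 := by
    ext u
    simp only [LinearMap.comp_apply, braJ_braPhi]
  set c : FracSeries σ := toFrac (MvPowerSeries.C (β / 2)) with hc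
  have hx : ∀ T : Finset σ, toFrac (coherent T (braVac ∘ₗ braExpTheta)) =
      ∏ i ∈ T, (1 + fracβ * fracVar i) := by
    intro T
    rw [coherent_expTheta, coherent_braVac, mul_one, map_prod]
    exact Finset.prod_congr rfl fun i _ => by simp [fracβ, fracVar]
  have hminus : ∀ i : σ, (1 - c * toFrac (tau i)) * (1 + c * fracVar i) = 1 := fun i => by
    simpa [fracVar] using congrArg toFrac (one_sub_tau_mul i)
  have hplus : ∀ i : σ, (1 + c * toFrac (tau i)) * (1 + c * fracVar i) = 1 + fracβ * fracVar i := by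
    intro i
    rw [fracβ_eq]
    linear_combination -hminus i
  have hx0 : ∀ i : σ, 1 + fracβ * fracVar i ≠ 0 := fun i => one_add_fracVar_ne_zero β i
  have hp0 : ∀ i : σ, 1 + c * toFrac (tau i) ≠ 0 := fun i h => hx0 i (by rw [← hplus i, h, zero_mul])
  rw [e1, hasSymbol_braPhi 0 S, comp_braJ_braJ, if_pos rfl, map_one, one_mul, map_mul, hx]
  have hpf := sum_residue_div _ S (tau_injOn S) (fun i _ => toFrac_tau_ne_zero i) (-c)
    (fun i _ => by rw [mul_neg, sub_neg_eq_add, mul_comm]; exact hp0 i)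
  have hs : ∀ i ∈ S, tauResidue S i * toFrac (MvPowerSeries.X i ^ 0 *
      (1 + MvPowerSeries.C (β / 2) * MvPowerSeries.X i)) *
      toFrac (coherent (S.erase i) (braVac ∘ₗ braExpTheta)) =
      (∏ i ∈ S, (1 + fracβ * fracVar i)) *
        (residue (fun i => toFrac (tau i)) S i / (1 - toFrac (tau i) * -c)) := by
    intro i hi
    rw [hx, ← Finset.mul_prod_erase S _ hi, ← hplus i, tauResidue, mul_neg, sub_neg_eq_add,
      mul_comm (toFrac (tau i)) c, pow_zero, one_mul, map_add, map_one, map_mul, ← hc]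
    have := hp0 i
    field_simp
    rw [fracVar]
    ring
  rw [Finset.sum_congr rfl hs, ← Finset.mul_sum, mul_comm (toFrac _), map_pow, map_neg, map_one,
    ← mul_add, hpf, ← Finset.prod_mul_distrib]
  refine Finset.prod_eq_one fun i _ => ?_
  rw [mul_neg, sub_neg_eq_add, ← sub_eq_add_neg, mul_comm (toFrac (tau i)) c, mul_div_assoc',
    div_eq_one_iff_eq (hp0 i), ← hplus i]
  linear_combination (1 + c * toFrac (tau i)) * hminus i

/-- Every removed variable leaves a factor `φ_0` on the left, so after all parts are used the final
functional is composed with `braJ` as many times as there are parts. Normalizing that value to `1`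
makes the recursion end in the empty symmetrized product. -/
theorem coherent_braProd (l : List ℕ) (hl : ∀ n ∈ l, 0 < n) (v : Module.Dual K Bra)
    (hv : ∀ S : Finset σ, coherent S (v ∘ₗ (braJ ^ l.length : Module.End K Bra)) = 1) (m : ℕ)
    (a : Fin m → σ) (ha : Function.Injective a) (hm : l.length ≤ m) :
    toFrac (coherent (Finset.univ.image a) (v ∘ₗ braProd l)) =
      symProd fracβ l m (fun i => fracVar (a i)) := by
  have := charZero_fracSeries (σ := σ)
  induction l generalizing v m with
  | nil =>
    rw [symProd_nil, ← map_one toFrac]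
    exact congrArg toFrac (hv _)
  | cons n l ih =>
    obtain ⟨m, rfl⟩ : ∃ m', m = m' + 1 := ⟨m - 1, by rw [List.length_cons] at hm; omega⟩
    have e : v ∘ₗ braProd (n :: l) = (v ∘ₗ braProd l) ∘ₗ braExpTheta ∘ₗ braPhiHalf n := rfl
    have e2 : (v ∘ₗ braProd l) ∘ₗ braJ = (v ∘ₗ braJ) ∘ₗ braProd l := by
      ext u
      simp only [LinearMap.comp_apply, braJ_braProd]
    rw [e, coherent_cons _ _ (hl n List.mem_cons_self), Finset.sum_image fun _ _ _ _ h => ha h,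
      symProd_cons, e2]
    refine Finset.sum_congr rfl fun p _ => ?_
    have hinj : Function.Injective fun k => a (skip p k) := ha.comp (skip_injective p)
    have hT : (Finset.univ.image a).erase (a p) = Finset.univ.image fun k => a (skip p k) := by
      refine (Finset.eq_of_subset_of_card_le ?_ ?_).symm
      · intro y hy
        obtain ⟨k, -, rfl⟩ := Finset.mem_image.mp hy
        exact Finset.mem_erase.mpr ⟨fun h => skip_ne p k (ha h), Finset.mem_image_of_mem _ (Finset.mem_univ _)⟩
      · rw [Finset.card_erase_of_mem (Finset.mem_image_of_mem _ (Finset.mem_univ _)),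
          Finset.card_image_of_injective _ ha, Finset.card_image_of_injective _ hinj]
        simp
    rw [hT, Finset.prod_image fun _ _ _ _ h => hinj h,
      ih (fun n hn => hl n (List.mem_cons_of_mem _ hn)) (v ∘ₗ braJ) ?_ m _ hinj
        (by rw [List.length_cons] at hm; omega)]
    intro S
    have := hv S
    rw [List.length_cons, pow_succ'] at this
    exact this

end KFermion

end

/-! ### From coherent states to `GP`: restriction of variables and polynomiality. -/

noncomputable section

namespace KFermion

/-! ### Restriction to finitely many variables -/

theorem coeff_tau_pow {σ : Type} [DecidableEq σ] (i : σ) {j : ℕ} (hj : 0 < j) (d : σ →₀ ℕ)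
    (h : j ≤ d.degree) : MvPowerSeries.coeff d (tau i ^ j) =
      if d = Finsupp.single i d.degree then
        ((Ring.choose (-(j : ℤ)) (d.degree - j) : ℤ) : K) * (β / 2) ^ (d.degree - j) else 0 := by
  have hs := PowerSeries.HasSubst.X (S := K) i
  have e : tau i = (PowerSeries.X * (1 - PowerSeries.C (-(β / 2)) * PowerSeries.X)⁻¹).subst
      (MvPowerSeries.X i : MvPowerSeries σ K) := by
    have h1 : (1 + MvPowerSeries.C (β / 2) * MvPowerSeries.X i : MvPowerSeries σ K) ≠ 0 := fun h => by
      simpa using congrArg MvPowerSeries.constantCoeff h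
    refine mul_right_cancel₀ h1 ?_
    have h2 := congrArg (PowerSeries.subst (MvPowerSeries.X i : MvPowerSeries σ K))
      (PowerSeries.inv_mul_cancel (1 - PowerSeries.C (-(β / 2)) * PowerSeries.X) (by simp))
    rw [PowerSeries.subst_mul hs, PowerSeries.subst_sub hs, PowerSeries.subst_mul hs,
      PowerSeries.subst_X hs, subst_C', subst_one', map_neg MvPowerSeries.C,
      neg_mul (MvPowerSeries.C _), sub_neg_eq_add] at h2
    rw [tau_mul, PowerSeries.subst_mul hs, PowerSeries.subst_X hs, mul_assoc, h2, mul_one]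
  rw [e, ← PowerSeries.subst_pow hs, PowerSeries.coeff_subst_single]
  have hiff : d = Finsupp.single i (d i) ↔ d = Finsupp.single i d.degree := by
    constructor <;> intro h
    · have := congrArg Finsupp.degree h
      rw [Finsupp.degree_single] at this
      rwa [this]
    · have := DFunLike.congr_fun h i
      rw [Finsupp.single_eq_same] at this
      rwa [this]
  by_cases hd : d = Finsupp.single i d.degree
  · rw [if_pos hd, if_pos (hiff.mpr hd)]
    have hdi : d i = d.degree := by
      have := DFunLike.congr_fun hd i
      rwa [Finsupp.single_eq_same] at this
    obtain ⟨p, rfl⟩ : ∃ p, j = p + 1 := ⟨j - 1, by omega⟩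
    rw [hdi, mul_pow, inv_one_sub_pow, PowerSeries.coeff_X_pow_mul', if_pos h, PowerSeries.coeff_mk,
      ring_choose_neg hj h, show p + (d.degree - (p + 1)) = d.degree - 1 by omega, neg_pow]
    push_cast
    ring
  · rw [if_neg hd, if_neg (mt hiff.mp hd)]

/-- The binomial series of `x^j (1 + βx/2)^{-j} = τ^j` is the defining series of `p_j^{(β)}` in one
variable. -/
theorem killCompl_powerSumBeta {n j : ℕ} (hj : 0 < j) :
    MvPowerSeries.killCompl Fin.valEmbedding (powerSumBeta j) =
      tauSum (Finset.univ : Finset (Fin n)) j := by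
  ext d
  rw [MvPowerSeries.coeff_killCompl]
  have hdeg : (Finsupp.embDomain Fin.valEmbedding d).degree = d.degree := by
    rw [Finsupp.degree_apply, Finsupp.degree_apply, Finsupp.support_embDomain, Finset.sum_map]
    simp only [Finsupp.embDomain_apply_self]
  by_cases h : j ≤ d.degree
  · rw [coeff_powerSumBeta_of_le (by rwa [hdeg]), hdeg, tauSum, map_sum,
      Finset.sum_congr rfl fun i _ => coeff_tau_pow i hj d h]
    by_cases hd : ∃ i, d = Finsupp.single i d.degree
    · obtain ⟨i, hi⟩ := hd
      have h1 : MvPowerSeries.coeff (Finsupp.embDomain Fin.valEmbedding d) (powerSum d.degree) = 1 :=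
        if_pos ⟨i, by rw [hi, Finsupp.embDomain_single]; simp⟩
      rw [h1, mul_one, Finset.sum_eq_single_of_mem i (Finset.mem_univ _), if_pos hi]
      intro i' _ hne
      refine if_neg fun hi' => hne ?_
      exact ((Finsupp.single_left_inj (by omega)).mp (hi.symm.trans hi')).symm
    · push Not at hd
      rw [Finset.sum_eq_zero fun i _ => if_neg (hd i)]
      have h1 : MvPowerSeries.coeff (Finsupp.embDomain Fin.valEmbedding d) (powerSum d.degree) = 0 := by
        refine if_neg ?_
        rintro ⟨k, hk⟩
        have hmem : k ∈ (Finsupp.embDomain Fin.valEmbedding d).support := by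
          rw [hk, Finsupp.support_single _ (by omega)]; simp
        rw [Finsupp.support_embDomain, Finset.mem_map] at hmem
        obtain ⟨i, -, rfl⟩ := hmem
        refine hd i (Finsupp.embDomain_injective Fin.valEmbedding ?_)
        rw [Finsupp.embDomain_single, ← hk]
      rw [h1, mul_zero]
  · rw [powerSumBeta_coeff_eq_zero (by omega), tauSum_mem _ _ d (by omega)]

theorem coeff_evalBeta_braSeries (v : Module.Dual K Bra) (n : ℕ) (d : Fin n →₀ ℕ) :
    MvPowerSeries.coeff (d.mapDomain Fin.val) (evalBeta (braSeries v)) =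
      MvPowerSeries.coeff d (coherent Finset.univ v) := by
  have e : d.mapDomain Fin.val = Finsupp.embDomain Fin.valEmbedding d := by
    rw [Finsupp.embDomain_eq_mapDomain]; rfl
  rw [e, coherent_apply, evalBeta, MvPowerSeries.substAlgHom_apply, MvPowerSeries.substAlgHom_apply,
    MvPowerSeries.coeff_subst powerSumBeta_hasSubst, MvPowerSeries.coeff_subst (hasSubst_tauSum _)]
  refine finsum_congr fun N => ?_
  rw [← MvPowerSeries.coeff_killCompl, map_finsuppProd]
  congr 2
  refine Finsupp.prod_congr fun j _ => ?_
  rw [map_pow, killCompl_powerSumBeta j.2.pos]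

/-! ### Polynomiality -/

/-- As `Δ` is homogeneous of degree `D`, the component of `ΔE` in degree `D + k` is `Δ` times the
component of `E` in degree `k`. It vanishes for `k` above the degree of `N`, and power series form a
domain, so `E` has only finitely many components. -/
theorem exists_polynomial_of_mul_eq {n D : ℕ} {Δ N : MvPolynomial (Fin n) K} (hΔ : Δ ≠ 0)
    (hD : Δ.IsHomogeneous D) {E : MvPowerSeries (Fin n) K}
    (h : (Δ : MvPowerSeries (Fin n) K) * E = N) :
    ∃ P : MvPolynomial (Fin n) K, (P : MvPowerSeries (Fin n) K) = E := by
  classical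
  have hvan : ∀ d : Fin n →₀ ℕ, N.totalDegree < d.degree → MvPowerSeries.coeff d E = 0 := by
    intro d hd
    set k := d.degree with hk
    set Ek : MvPowerSeries (Fin n) K :=
      fun a => if a.degree = k then MvPowerSeries.coeff a E else 0 with hEk
    have hcoeff : ∀ a, MvPowerSeries.coeff a Ek = if a.degree = k then MvPowerSeries.coeff a E else 0 :=
      fun a => rfl
    have hzero : (Δ : MvPowerSeries (Fin n) K) * Ek = 0 := by
      ext e
      rw [MvPowerSeries.coeff_mul, map_zero]
      by_cases he : e.degree = D + k
      · have h1 := congrArg (MvPowerSeries.coeff e) h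
        rw [MvPolynomial.coeff_coe, MvPolynomial.coeff_eq_zero_of_totalDegree_lt
          (by rw [← Finsupp.degree_apply]; omega), MvPowerSeries.coeff_mul] at h1
        rw [← h1]
        refine Finset.sum_congr rfl fun x hx => ?_
        have hdx := congrArg Finsupp.degree (Finset.HasAntidiagonal.mem_antidiagonal.mp hx)
        rw [map_add] at hdx
        by_cases hx1 : x.1.degree = D
        · rw [hcoeff, if_pos (by omega)]
        · rw [MvPolynomial.coeff_coe, hD.coeff_eq_zero hx1, zero_mul, zero_mul]
      · refine Finset.sum_eq_zero fun x hx => ?_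
        have hdx := congrArg Finsupp.degree (Finset.HasAntidiagonal.mem_antidiagonal.mp hx)
        rw [map_add] at hdx
        by_cases hx1 : x.1.degree = D
        · rw [hcoeff, if_neg (by omega), mul_zero]
        · rw [MvPolynomial.coeff_coe, hD.coeff_eq_zero hx1, zero_mul]
    have hEk0 : Ek = 0 := (mul_eq_zero.mp hzero).resolve_left (by simpa using hΔ)
    have := hcoeff d
    rw [hEk0, if_pos hk.symm, map_zero] at this
    exact this.symm
  refine ⟨E.truncTotal (N.totalDegree + 1), ?_⟩
  ext d
  rw [MvPolynomial.coeff_coe, MvPowerSeries.coeff_truncTotal_eq_ite]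
  split_ifs with hd
  · rfl
  · rw [hvan d (by omega)]

/-- The product of all differences of two distinct variables. -/
def diffProd (n : ℕ) : MvPolynomial (Fin n) K :=
  ∏ i : Fin n, ∏ j ∈ Finset.univ.erase i, (MvPolynomial.X i - MvPolynomial.X j)

theorem diffProd_ne_zero (n : ℕ) : diffProd n ≠ 0 :=
  Finset.prod_ne_zero_iff.mpr fun _ _ => Finset.prod_ne_zero_iff.mpr fun _ hj =>
    sub_ne_zero.mpr fun h => (Finset.ne_of_mem_erase hj) (MvPolynomial.X_injective h).symm

theorem diffProd_isHomogeneous (n : ℕ) : ∃ D, (diffProd n).IsHomogeneous D :=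
  ⟨_, MvPolynomial.IsHomogeneous.prod _ _ _ fun i _ => MvPolynomial.IsHomogeneous.prod _ _ _
    fun j _ => (MvPolynomial.isHomogeneous_X K i).sub (MvPolynomial.isHomogeneous_X K j)⟩

theorem GPfin_eq (l : List ℕ) (n : ℕ) :
    GPfin l n = symProd (algebraMap K (RatFun n) β) l n var := rfl

theorem var_injective (n : ℕ) : Function.Injective (var : Fin n → RatFun n) :=
  (IsFractionRing.injective (MvPolynomial (Fin n) K) (RatFun n)).comp MvPolynomial.X_injective

theorem algebraMap_ratFun {n : ℕ} (c : K) : algebraMap K (RatFun n) c =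
    algebraMap (MvPolynomial (Fin n) K) (RatFun n) (MvPolynomial.C c) :=
  IsScalarTower.algebraMap_apply K (MvPolynomial (Fin n) K) (RatFun n) c

theorem exists_mul_GPfin (l : List ℕ) (n : ℕ) : ∃ N : MvPolynomial (Fin n) K,
    algebraMap (MvPolynomial (Fin n) K) (RatFun n) (diffProd n) * GPfin l n = algebraMap _ _ N := by
  set I : Subring (RatFun n) := (algebraMap (MvPolynomial (Fin n) K) (RatFun n)).range with hI
  suffices h : algebraMap (MvPolynomial (Fin n) K) (RatFun n) (diffProd n) * GPfin l n ∈ I by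
    obtain ⟨N, hN⟩ := h
    exact ⟨N, hN.symm⟩
  have hvar : ∀ i : Fin n, var i ∈ I := fun i => ⟨_, rfl⟩
  have hβ : algebraMap K (RatFun n) β ∈ I := ⟨_, (algebraMap_ratFun β).symm⟩
  have hfac : ((n - l.length).factorial : RatFun n)⁻¹ ∈ I :=
    ⟨MvPolynomial.C ((n - l.length).factorial : K)⁻¹, by
      rw [← algebraMap_ratFun, map_inv₀, map_natCast]⟩
  rw [GPfin_eq, symProd, mul_left_comm, Finset.mul_sum]
  refine mul_mem hfac (sum_mem fun w _ => ?_)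
  -- The product runs over ordered pairs, so it is invariant under every permutation without a sign
  -- and clears the denominators of all terms at once.
  have e : algebraMap (MvPolynomial (Fin n) K) (RatFun n) (diffProd n) =
      ∏ i : Fin n, ∏ j ∈ Finset.univ.erase i, (var (w i) - var (w j)) := by
    rw [diffProd, map_prod, ← Equiv.prod_comp w]
    refine Finset.prod_congr rfl fun i _ => ?_
    have : Finset.univ.erase (w i) = (Finset.univ.erase i).map w.toEmbedding := by
      rw [Finset.map_erase]; simp
    rw [this, Finset.prod_map, map_prod]
    simp only [map_sub]
    rfl
  rw [e, ← Finset.prod_mul_distrib]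
  refine prod_mem fun i _ => ?_
  split_ifs with h
  · have e2 : Finset.Ioi i = (Finset.univ.erase i).filter (i < ·) := by
      ext j
      simp only [Finset.mem_Ioi, Finset.mem_filter, Finset.mem_erase, Finset.mem_univ, and_true]
      exact ⟨fun h => ⟨h.ne', h⟩, fun h => h.2⟩
    rw [mul_left_comm, e2, Finset.prod_filter, ← Finset.prod_mul_distrib]
    refine mul_mem (pow_mem (hvar _) _) (prod_mem fun j hj => ?_)
    have hne : var (w i) - var (w j) ≠ 0 := sub_ne_zero.mpr fun h =>
      (Finset.ne_of_mem_erase hj) (w.injective (var_injective n h)).symm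
    split_ifs
    · rw [pairWeight, div_div_eq_mul_div, mul_div_cancel₀ _ hne]
      exact mul_mem (add_mem (add_mem (hvar _) (hvar _)) (mul_mem (mul_mem hβ (hvar _)) (hvar _)))
        (add_mem (one_mem _) (mul_mem hβ (hvar _)))
    · rw [mul_one]
      exact sub_mem (hvar _) (hvar _)
  · rw [mul_one]
    exact prod_mem fun j _ => sub_mem (hvar _) (hvar _)

/-- The embedding of rational functions into fractions of power series. -/
def ratToFrac (n : ℕ) : RatFun n →+* FracSeries (Fin n) :=
  IsFractionRing.lift (A := MvPolynomial (Fin n) K)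
    (g := toFrac.comp MvPolynomial.coeToMvPowerSeries.ringHom)
    (toFrac_injective.comp (MvPolynomial.coe_injective _ _))

theorem ratToFrac_algebraMap {n : ℕ} (P : MvPolynomial (Fin n) K) :
    ratToFrac n (algebraMap _ _ P) = toFrac (P : MvPowerSeries (Fin n) K) :=
  IsFractionRing.lift_algebraMap _ P

theorem map_symProd {F F' : Type} [Field F] [Field F'] (ψ : F →+* F') (b : F) (l : List ℕ) (m : ℕ)
    (x : Fin m → F) : ψ (symProd b l m x) = symProd (ψ b) l m (fun i => ψ (x i)) := by
  simp only [symProd, map_mul, map_inv₀, map_natCast, map_sum, map_prod]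
  congr 1
  refine Finset.sum_congr rfl fun w _ => Finset.prod_congr rfl fun i _ => ?_
  split_ifs
  · simp only [map_mul, map_pow, map_prod, pairWeight, map_div₀, map_add, map_sub, map_one]
  · exact map_one ψ

theorem ratToFrac_GPfin (l : List ℕ) (n : ℕ) :
    ratToFrac n (GPfin l n) = symProd fracβ l n (fun i => fracVar i) := by
  rw [GPfin_eq, map_symProd, algebraMap_ratFun, ratToFrac_algebraMap, MvPolynomial.coe_C]
  congr 1
  funext i
  rw [var, ratToFrac_algebraMap, MvPolynomial.coe_X, fracVar]

theorem exists_polynomial_GPfin {l : List ℕ} {n : ℕ} {E : MvPowerSeries (Fin n) K}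
    (hE : toFrac E = symProd fracβ l n (fun i => fracVar i)) :
    ∃ P : MvPolynomial (Fin n) K, algebraMap _ (RatFun n) P = GPfin l n ∧
      (P : MvPowerSeries (Fin n) K) = E := by
  obtain ⟨N, hN⟩ := exists_mul_GPfin l n
  obtain ⟨D, hD⟩ := diffProd_isHomogeneous n
  have h : ((diffProd n : MvPolynomial (Fin n) K) : MvPowerSeries (Fin n) K) * E = N := by
    apply toFrac_injective
    rw [map_mul, hE, ← ratToFrac_GPfin, ← ratToFrac_algebraMap, ← map_mul, hN, ratToFrac_algebraMap]
  obtain ⟨P, rfl⟩ := exists_polynomial_of_mul_eq (diffProd_ne_zero n) hD h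
  refine ⟨P, (ratToFrac n).injective ?_, rfl⟩
  rw [ratToFrac_algebraMap, hE, ratToFrac_GPfin]

/-! ### The `K`-theoretic `P`-functions -/

theorem isGP_unique {l : List ℕ} {G G' : MvPowerSeries ℕ K} (h : IsGP l G) (h' : IsGP l G') :
    G = G' := by
  ext d
  -- Enough variables to contain the support of `d`, and at least as many as there are parts.
  set n := max l.length (d.support.sup id + 1) with hn
  obtain ⟨P, hP, hc⟩ := h n (le_max_left _ _)
  obtain ⟨P', hP', hc'⟩ := h' n (le_max_left _ _)
  have hPP : P = P' := IsFractionRing.injective _ (RatFun n) (hP.trans hP'.symm)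
  have hd : (d.comapDomain Fin.val (Fin.val_injective (n := n)).injOn).mapDomain Fin.val = d := by
    refine Finsupp.mapDomain_comapDomain _ Fin.val_injective d fun k hk => ?_
    have hk' : k ≤ d.support.sup id := Finset.le_sup (f := id) hk
    exact ⟨⟨k, by omega⟩, rfl⟩
  rw [← hd, hc, hc', hPP]

theorem isGP_evalBeta {l : List ℕ} (hl : ∀ n ∈ l, 0 < n) {v : Module.Dual K Bra}
    (hv : ∀ (n : ℕ) (S : Finset (Fin n)),
      coherent S (v ∘ₗ (braJ ^ l.length : Module.End K Bra)) = 1) :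
    IsGP l (evalBeta (braSeries (v ∘ₗ braProd l))) := by
  intro n hn
  have h := coherent_braProd l hl v (hv n) n id Function.injective_id hn
  rw [Finset.image_id] at h
  obtain ⟨P, hP, hPE⟩ := exists_polynomial_GPfin h
  refine ⟨P, hP, fun d => ?_⟩
  rw [coeff_evalBeta_braSeries, ← hPE, MvPolynomial.coeff_coe]

theorem braJ_pow_even {k : ℕ} (hk : Even k) : (braJ ^ k : Module.End K Bra) = 1 := by
  obtain ⟨m, rfl⟩ := hk
  have h : (braJ * braJ : Module.End K Bra) = 1 := LinearMap.ext braJ_braJ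
  rw [← two_mul, pow_mul, pow_two, h, one_pow]

/-- Even powers of `braJ` are trivial. The value `1` demanded at the end of the recursion is thus
that of the plain vacuum for an even number of parts, and that of `φ_0^{(β)} e^Θ` with one `φ_0` on
the left for an odd number. -/
theorem exists_ketP_eq (l : List ℕ) (hl : ∀ n ∈ l, 0 < n) : ∃ v : Module.Dual K Bra,
    ketP l = v ∘ₗ braEven.subtype ∧ IsGP l (evalBeta (braSeries v)) := by
  by_cases h : Even l.length
  · refine ⟨braVac ∘ₗ braProd l, by rw [ketP, if_pos h], isGP_evalBeta hl fun n S => ?_⟩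
    rw [braJ_pow_even h]
    exact coherent_braVac S
  · refine ⟨(braVac ∘ₗ braExpTheta ∘ₗ braPhi 0) ∘ₗ braProd l, by rw [ketP, if_neg h]; rfl,
      isGP_evalBeta hl fun n S => ?_⟩
    obtain ⟨m, hm⟩ := Nat.not_even_iff_odd.mp h
    rw [hm, pow_succ, braJ_pow_even (even_two_mul m), one_mul]
    exact coherent_odd_vacuum S

end KFermion

end

/-! ### The theorem. -/

open KFermion in
theorem theorem5p2 (l : List ℕ) (hstrict : l.Pairwise (· > ·)) (hpos : ∀ n ∈ l, 0 < n) :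
    (∃! G : MvPowerSeries ℕ K, IsGP l G) ∧
    (∃! F : MvPowerSeries ℕ K, IsOmega (ketP l) F) ∧
    GP l = expectH (ketP l) ∧
    expectH (ketP l) = Ω (ketP l) ∧
    GP l ∈ GΓhat := by
  obtain ⟨v, hv, hGP⟩ := exists_ketP_eq l hpos
  have hΩ : IsOmega (ketP l) (expectH (ketP l)) := by
    rw [hv]
    exact isOmega_expectH v
  have hE : expectH (ketP l) = evalBeta (braSeries v) := by
    rw [hv, expectH_eq]
  rw [← hE] at hGP
  have hGP_eq : GP l = expectH (ketP l) := isGP_unique (Classical.epsilon_spec ⟨_, hGP⟩) hGP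
  refine ⟨⟨_, hGP, fun G hG => isGP_unique hG hGP⟩, ⟨_, hΩ, fun F hF => isOmega_unique hF hΩ⟩,
    hGP_eq, isOmega_unique hΩ (Classical.epsilon_spec ⟨_, hΩ⟩), ?_⟩
  rw [hGP_eq, hE]
  exact ⟨_, rfl⟩
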